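/- **Setting.** An $[[n,k,d]]$ CSS code $Q$ is given by full-rank matrices $H^X\in\mathbb F_2^{m_x\times n}$, $H^Z\in\mathbb F_2^{m_z\times n}$ with $H^X(H^Z)^T=0$; $k=n-m_x-m_z$, and $d$ is the least Hamming weight of an element of $(\ker H^Z\setminus\mathrm{row}\,H^X)\cup(\ker H^X\setminus\mathrm{row}\,H^Z)$ ($d=\infty$ if $k=0$). $Q$ is $\ell$-LDPC if its stabilizer group is generated by some Pauli checks of weight at most $\ell$, at most $\ell$ of which act on any given qubit. A random Pauli error $E$ is local stochastic of rate $p\in[0,1]$, written $E\leftarrow\mathcal N(p)$, if $\Pr[S\subseteq\mathrm{supp}(E)]\le p^{|S|}$ for every set $S$ of qubits. For $T\ge1$ the alternating Tanner graph has $2T+1$ layers, each with a copy of the $n$ code qubits; code qubit $(i,t)$ is joined to $(i,t\pm1)$. Odd layers also carry $m_z$ check qubits, joined to the code qubits of the layer by the Tanner graph of $H^Z$; even layers carry $m_x$ check qubits, joined by the Tanner graph of $H^X$. $V$ is the set of all qubits, $\partial$ (the boundary) the $2n$ code qubits of layers $1$ and $2T+1$, which carry two copies of $Q$, and $\mathcal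 B=V\setminus\partial$ the bulk. $|\mathrm{ATG}\rangle=\prod_{uv\in E}\mathsf{CZ}_{uv}|+\rangle^{\otimes V}$, and $|\overline\Phi\rangle=2^{-k/2}\sum_{x\in\mathbb F_2^k}|\bar x\rangle|\bar x\rangle$ is the encoded Bell state ($k$ encoded EPR pairs). The meta-checks are the sets $\alpha=\{(c,t-1),(c,t+1)\}\cup\{(i,t):i\sim c\}\subseteq\mathcal B$, for $c\in[m_z]$ and $t$ even, or $c\in[m_x]$ and $t$ odd, $1<t<2T+1$. The Bell generators are the following stabilizers $S_\partial\otimes X(\gamma)_{\mathcal B}$ of $|\mathrm{ATG}\rangle$: $\bigotimes_{i\sim c}Z_{(i,t)}\otimes X_{(c,t)}$ for $c\in[m_z]$, $t\in\{1,2T+1\}$; $\bigotimes_{i\sim c}X_{(i,t)}\otimes X_{(c,t')}$ for $c\in[m_x]$, $(t,t')\in\{(1,2),(2T+1,2T)\}$; and the encoded $\bar X_1\bar X_{2T+1}$ and $\bar Z_1\bar Z_{2T+1}$, where $\gamma$ consists of the copies of the support of $\bar X$ on layers $3,5,\dots,2T-1$, resp. of $\bar Z$ on layers $2,4,\dots,2T$.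 *Procedure.* Prepare $|\mathrm{ATG}\rangle$ by a circuit $W$, measure $\mathcal B$ in the Hadamard basis with outcome $s\in\{0,1\}^{\mathcal B}$, and let $\beta(s)$ be a minimum-weight vector with $\beta\cdot\alpha=s\cdot\alpha$ for all meta-checks $\alpha$ (depending on these syndromes only). Apply a Pauli $\mathsf{Rec}(s)$ on $\partial$ which, for every Bell generator $S_\partial\otimes X(\gamma)$, commutes with $S_\partial$ if and only if $s\cdot\gamma+\beta(s)\cdot\gamma=0$. For an error $P$ on $V$ whose bulk part has $Z$-part $Z(\eta)$, let $\mathsf{Rep}_X(P)$ (resp. $\mathsf{Rep}_Z(P)$) be a minimum-weight $Z$-type (resp. $X$-type) Pauli on $\partial$ having the residual syndromes $\gamma\cdot(\beta(\eta)+\eta)$ for the $X$-type (resp. $Z$-type) stabilizers of the two boundary codes. **Theorem.** There are absolute constants $c>0$, $K$, and for every $\ell\ge1$ constants $p^*=p^*(\ell)\in(0,1)$ and $C=C(\ell)>0$, such that the following holds for every $T\ge1$ and every $\ell$-LDPC $[[n,k,d]]$ CSS code $Q$. The code has full-rank check matrices $H^X,H^Z$ all of whose rows and columns have weight at most $\ell$,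 and for any such matrices: 1. $|V|\le K\ell nT$, and $|\mathrm{ATG}\rangle=W|0^V\rangle$ for a circuit $W$ of one- and two-qubit gates of depth at most $K\ell^2$. 2. $\beta$, $\mathsf{Rec}$, $\mathsf{Rep}_X$, $\mathsf{Rep}_Z$ as above exist. For any choice of them there are a function $\mathsf{Rep}:\mathsf{Pauli}(V)\to\mathsf{Pauli}(\partial)$ and a success event $\mathcal S\subseteq\mathsf{Pauli}(V)$ such that, for every error $P$ on the output of $W$ and every outcome $s$, $$(\langle\pm_s|_{\mathcal B}\otimes\mathsf{Rec}(s)_\partial)\,P\,|\mathrm{ATG}\rangle=\gamma_{P,s}\,\mathsf{Rep}(P)\,|\overline\Phi\rangle,\qquad\gamma_{P,s}\in\mathbb C .$$ Up to phase, $\mathsf{Rep}(P)$ is $\mathsf{Rep}_X(P)\mathsf{Rep}_Z(P)$ times the boundary part of $P$ times a logical operator (possibly trivial) on the first surface, and this logical operator is the identity for $P\in\mathcal S$. 3. If $P\leftarrow\mathcal N(p)$ with $p<p^*$, then $\Pr[P\in\mathcal S]\ge b:=1-nT\,(p/p^*)^{c\min(T,d)}$, and $\Pr[P\in\mathcal S,\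 S\subseteq\mathrm{supp}\,\mathsf{Rep}(P)]\le(C\sqrt p)^{|S|}$ for every $S\subseteq\partial$. If moreover $b>0$, then conditioned on $P\in\mathcal S$ the residual error $\mathsf{Rep}(P)$ is local stochastic of rate $C\sqrt p=O(p^{1/2})$. 4. (Encoded $|\bar 0\rangle$ and $|\bar+\rangle$.) If in addition all qubits of the second surface (layer $2T+1$) are then measured in the standard (resp. Hadamard) basis with outcome $z$, there is an $X$-type (resp. $Z$-type) logical operator depending only on $z$ such that applying it to the first surface leaves $|\bar 0\rangle^{\otimes k}$ (resp. $|\bar+\rangle^{\otimes k}$) up to a scalar and a Pauli error $\mathsf{Rep}'(P)$ that depends only on $P$. There is a success event $\mathcal S'\subseteq\mathcal S$ on which $\mathsf{Rep}'(P)$ is the restriction of $\mathsf{Rep}(P)$ to the first surface, and the guarantees of 3 hold for $\mathcal S'$ and $\mathsf{Rep}'$ with the same constants. -/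

import Mathlib

open scoped Matrix

namespace SSSP

/-! ### Qubits, Pauli operators, local stochastic noise -/

/-- Pure (not necessarily normalized) states of the qubits indexed by `V`, as amplitude functions
in the computational basis. -/
abbrev State (V : Type) := (V → ZMod 2) → ℂ

/-- Pauli operators modulo phase: the pair `(a, b)` stands for `X(a) Z(b)`. Multiplication
(modulo phase) is addition of pairs. -/
abbrev Pauli (V : Type) := (V → ZMod 2) × (V → ZMod 2)

/-- The sign `(-1)^a`. -/
noncomputable def sgn (a : ZMod 2) : ℂ := if a = 0 then 1 else -1

/-- The scalar `1/√2`. -/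
noncomputable def invSqrtTwo : ℂ := ((1 / Real.sqrt 2 : ℝ) : ℂ)

/-- The support of a Pauli operator. -/
def supp {V : Type} [Fintype V] (P : Pauli V) : Finset V :=
  Finset.univ.filter fun v => P.1 v ≠ 0 ∨ P.2 v ≠ 0

/-- The action of `X(a) Z(b)` on states, `X(a) Z(b) |y⟩ = (-1)^(b·y) |y + a⟩`. -/
noncomputable def act {V : Type} [Fintype V] (P : Pauli V) (ψ : State V) : State V :=
  fun x => sgn (P.2 ⬝ᵥ (x + P.1)) * ψ (x + P.1)

/-- `0` if the two Pauli operators commute, `1` if they anticommute. -/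
def symp {V : Type} [Fintype V] (P P' : Pauli V) : ZMod 2 := P.1 ⬝ᵥ P'.2 + P.2 ⬝ᵥ P'.1

/-- The probability of an event under a discrete law. -/
noncomputable def prob {α : Type} (μ : PMF α) (A : Set α) : ℝ := (μ.toOuterMeasure A).toReal

/-- The law `μ` of a random Pauli error is local stochastic of rate `p ∈ [0,1]`. -/
def IsLocalStochastic {V : Type} [Fintype V] (μ : PMF (Pauli V)) (p : ℝ) : Prop :=
  0 ≤ p ∧ p ≤ 1 ∧ ∀ S : Finset V, prob μ {E | S ⊆ supp E} ≤ p ^ S.card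

/-! ### Graph states and circuits -/

/-- The graph state `(∏_{uv ∈ E} CZ_{uv}) |+⟩^V`. -/
noncomputable def graphState {V : Type} [Fintype V] (G : SimpleGraph V) : State V :=
  open Classical in
  fun x => invSqrtTwo ^ Fintype.card V *
    ∏ e ∈ G.edgeFinset, Sym2.lift ⟨fun u v => sgn (x u * x v), fun u v => congrArg sgn (mul_comm (x u) (x v))⟩ e

/-- Elementary one- and two-qubit gates. -/
inductive Gate (V : Type)
  | hadamard (v : V)
  | cz (u v : V)

namespace Gate

/-- The set of qubits on which a gate acts. -/
def qubits {V : Type} : Gate V → Set V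
  | hadamard v => {v}
  | cz u v => {u, v}

/-- A two-qubit gate must act on two different qubits. -/
def Valid {V : Type} : Gate V → Prop
  | hadamard _ => True
  | cz u v => u ≠ v

/-- The unitary action of a gate. -/
noncomputable def apply {V : Type} [DecidableEq V] : Gate V → State V → State V
  | hadamard v, ψ => fun x =>
      invSqrtTwo * (ψ (Function.update x v 0) + sgn (x v) * ψ (Function.update x v 1))
  | cz u v, ψ => fun x => sgn (x u * x v) * ψ x

end Gate

/-- A circuit is a list of layers, each a list of gates; its depth is the number of layers. -/
abbrev Circuit (V : Type) := List (List (Gate V))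

/-- All gates are valid, and the gates of one layer act on pairwise disjoint sets of qubits. -/
def Circuit.WellFormed {V : Type} (W : Circuit V) : Prop :=
  ∀ l ∈ W, (∀ g ∈ l, g.Valid) ∧ l.Pairwise fun g g' => Disjoint g.qubits g'.qubits

/-- Running a circuit, the layers from left to right. -/
noncomputable def Circuit.run {V : Type} [DecidableEq V] (W : Circuit V) (ψ : State V) : State V :=
  W.flatten.foldl (fun φ g => g.apply φ) ψ

/-- The all-zeros state `|0⟩^V`. -/
noncomputable def zeroState (V : Type) : State V := open Classical in fun x => if x = 0 then 1 else 0

/-! ### CSS codes -/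

/-- A CSS code given by two full-rank parity check matrices with `H^X (H^Z)ᵀ = 0`. -/
structure CSSCode (n mx mz : ℕ) where
  HX : Matrix (Fin mx) (Fin n) (ZMod 2)
  HZ : Matrix (Fin mz) (Fin n) (ZMod 2)
  fullRankX : LinearIndependent (ZMod 2) HX.row
  fullRankZ : LinearIndependent (ZMod 2) HZ.row
  comm : HX * HZᵀ = 0

namespace CSSCode

variable {n mx mz : ℕ}

/-- The row space of `H^X`: the supports of the `X`-type stabilizers. -/
def xStab (Q : CSSCode n mx mz) : Submodule (ZMod 2) (Fin n → ZMod 2) :=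
  Submodule.span (ZMod 2) (Set.range Q.HX.row)

/-- The row space of `H^Z`: the supports of the `Z`-type stabilizers. -/
def zStab (Q : CSSCode n mx mz) : Submodule (ZMod 2) (Fin n → ZMod 2) :=
  Submodule.span (ZMod 2) (Set.range Q.HZ.row)

/-- The kernel of `H^Z`: the supports of `X`-type operators that preserve the code
(`X`-type logical operators, including the trivial ones). -/
def xLogical (Q : CSSCode n mx mz) : Submodule (ZMod 2) (Fin n → ZMod 2) :=
  LinearMap.ker Q.HZ.mulVecLin

/-- The kernel of `H^X`: the supports of `Z`-type operators that preserve the code. -/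
def zLogical (Q : CSSCode n mx mz) : Submodule (ZMod 2) (Fin n → ZMod 2) :=
  LinearMap.ker Q.HX.mulVecLin

/-- The number `k` of logical qubits. -/
def numLogical (_Q : CSSCode n mx mz) : ℕ := n - mx - mz

/-- The distance of the code: the least Hamming weight of a nontrivial `X`- or `Z`-type logical
operator (`⊤` if there is none, that is, if `k = 0`). -/
noncomputable def distance (Q : CSSCode n mx mz) : ℕ∞ :=
  ⨅ y ∈ {y : Fin n → ZMod 2 | (y ∈ Q.xLogical ∧ y ∉ Q.xStab) ∨ (y ∈ Q.zLogical ∧ y ∉ Q.zStab)},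
    (hammingNorm y : ℕ∞)

/-- The code is `ℓ`-LDPC: its stabilizer group is generated by some family of Pauli checks of
weight at most `ℓ`, at most `ℓ` of which act nontrivially on any given qubit. -/
def IsLDPC (Q : CSSCode n mx mz) (ℓ : ℕ) : Prop :=
  ∃ (r : ℕ) (chk : Fin r → Pauli (Fin n)),
    Submodule.span (ZMod 2) (Set.range chk) = Q.xStab.prod Q.zStab ∧
    (∀ j, (supp (chk j)).card ≤ ℓ) ∧
    ∀ i, (Finset.univ.filter fun j => i ∈ supp (chk j)).card ≤ ℓ

/-- The two pairs of check matrices present the same code. -/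
def SameCode (R Q : CSSCode n mx mz) : Prop := R.xStab = Q.xStab ∧ R.zStab = Q.zStab

/-- All rows and columns of the given check matrices `H^X` and `H^Z` have weight at most `ℓ`,
i.e. the two Tanner graphs have degree at most `ℓ`. -/
def IsSparse (R : CSSCode n mx mz) (ℓ : ℕ) : Prop :=
  (∀ c, hammingNorm (R.HX.row c) ≤ ℓ) ∧ (∀ c, hammingNorm (R.HZ.row c) ≤ ℓ) ∧
  (∀ i, hammingNorm (R.HX.col i) ≤ ℓ) ∧ (∀ i, hammingNorm (R.HZ.col i) ≤ ℓ)

/-- `L 1, …, L k` are the supports of logical `X` operators of the `k` logical qubits: vectors of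
`ker H^Z` that form a basis modulo the row space of `H^X`. -/
def IsLogicalBasis (Q : CSSCode n mx mz) (L : Fin Q.numLogical → Fin n → ZMod 2) : Prop :=
  (∀ j, L j ∈ Q.xLogical) ∧
  ∀ y ∈ Q.xLogical, ∃! x : Fin Q.numLogical → ZMod 2, y - ∑ j, x j • L j ∈ Q.xStab

/-- The encoded computational basis state `|x̄⟩`: the normalized uniform superposition over the
coset `∑ⱼ xⱼ Lⱼ + rowspace H^X`. -/
noncomputable def encoded (Q : CSSCode n mx mz) (L : Fin Q.numLogical → Fin n → ZMod 2)
    (x : Fin Q.numLogical → ZMod 2) : State (Fin n) :=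
  open Classical in
  fun y => if y - ∑ j, x j • L j ∈ Q.xStab then invSqrtTwo ^ mx else 0

/-- `k` encoded EPR pairs across two copies of the code,
`2^(-k/2) ∑_x |x̄⟩ ⊗ |x̄⟩`. The first copy is labelled `false`, the second `true`. -/
noncomputable def bellState (Q : CSSCode n mx mz) (L : Fin Q.numLogical → Fin n → ZMod 2) :
    State (Bool × Fin n) :=
  fun y => invSqrtTwo ^ Q.numLogical *
    ∑ x, Q.encoded L x (fun i => y (false, i)) * Q.encoded L x (fun i => y (true, i))

/-- The encoded state `|0̄⟩` (all `k` logical qubits in `|0⟩`). -/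
noncomputable def encodedZero (Q : CSSCode n mx mz) (L : Fin Q.numLogical → Fin n → ZMod 2) :
    State (Fin n) := Q.encoded L 0

/-- The encoded state `|+̄⟩` (all `k` logical qubits in `|+⟩`). -/
noncomputable def encodedPlus (Q : CSSCode n mx mz) (L : Fin Q.numLogical → Fin n → ZMod 2) :
    State (Fin n) :=
  fun y => invSqrtTwo ^ Q.numLogical * ∑ x, Q.encoded L x y

end CSSCode

/-! ### The alternating Tanner graph

The layers are numbered `1, …, 2T+1`. Odd layers are `Z` layers, even layers are `X` layers. -/

/-- The vertices: `code t i` is code qubit `i` on layer `t + 1`, `zcheck t c` is the `Z` check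
qubit `c` on the odd layer `2t + 1`, and `xcheck t c` is the `X` check qubit `c` on the even
layer `2t + 2`. -/
inductive Vertex (T n mx mz : ℕ)
  | code (t : Fin (2 * T + 1)) (i : Fin n)
  | zcheck (t : Fin (T + 1)) (c : Fin mz)
  | xcheck (t : Fin T) (c : Fin mx)
  deriving DecidableEq, Fintype

namespace Vertex

variable {T n mx mz : ℕ}

/-- The layer of a vertex. -/
def layer : Vertex T n mx mz → ℕ
  | code t _ => t + 1
  | zcheck t _ => 2 * t + 1
  | xcheck t _ => 2 * t + 2

/-- The boundary qubits are the code qubits of the first layer (surface `false`) and of the last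
layer (surface `true`); all others are bulk qubits (`none`). -/
def toSurface : Vertex T n mx mz → Option (Bool × Fin n)
  | code t i => if (t : ℕ) = 0 then some (false, i) else
      if (t : ℕ) = 2 * T then some (true, i) else none
  | zcheck _ _ => none
  | xcheck _ _ => none

end Vertex

section ATG

variable {n mx mz : ℕ}

/-- The alternating Tanner graph of the check matrices of `R` on `2T+1` layers. -/
def atg (R : CSSCode n mx mz) (T : ℕ) : SimpleGraph (Vertex T n mx mz) :=
  SimpleGraph.fromRel fun u v =>
    match u, v with
    | .code t i, .code t' j => i = j ∧ (t' : ℕ) = t + 1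
    | .code t i, .zcheck t' c =>
        (Vertex.code t i : Vertex T n mx mz).layer = (Vertex.zcheck t' c : Vertex T n mx mz).layer
          ∧ R.HZ c i = 1
    | .code t i, .xcheck t' c =>
        (Vertex.code t i : Vertex T n mx mz).layer = (Vertex.xcheck t' c : Vertex T n mx mz).layer
          ∧ R.HX c i = 1
    | _, _ => False

/-- The bulk qubits. -/
abbrev Bulk (T n mx mz : ℕ) := {v : Vertex T n mx mz // v.toSurface = none}

/-- The boundary qubits as vertices of the graph. -/
def surfaceVertex (T mx mz : ℕ) (q : Bool × Fin n) : Vertex T n mx mz :=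
  .code (if q.1 then Fin.last (2 * T) else 0) q.2

/-- Joining a bit string on the boundary and a bit string on the bulk. -/
def glue {T : ℕ} (y : Bool × Fin n → ZMod 2) (b : Bulk T n mx mz → ZMod 2) :
    Vertex T n mx mz → ZMod 2 :=
  fun v => match h : v.toSurface with
    | some q => y q
    | none => b ⟨v, h⟩

/-- The bulk part of a Pauli operator. -/
def bulkPart {T : ℕ} (P : Pauli (Vertex T n mx mz)) : Pauli (Bulk T n mx mz) :=
  (fun v => P.1 v, fun v => P.2 v)

/-- The boundary part of a Pauli operator. -/
def boundaryPart {T : ℕ} (P : Pauli (Vertex T n mx mz)) : Pauli (Bool × Fin n) :=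
  (fun q => P.1 (surfaceVertex T mx mz q), fun q => P.2 (surfaceVertex T mx mz q))

/-- The unnormalized state `⟨±_s|_bulk ψ` of the boundary after the bulk has been measured in the
Hadamard basis with outcome `s`. -/
noncomputable def measureBulk {T : ℕ} (s : Bulk T n mx mz → ZMod 2)
    (ψ : State (Vertex T n mx mz)) : State (Bool × Fin n) :=
  fun y => invSqrtTwo ^ Fintype.card (Bulk T n mx mz) * ∑ b, sgn (s ⬝ᵥ b) * ψ (glue y b)

/-- The restriction of a Pauli operator on the two surfaces to one of them. -/
def onSurface (σ : Bool) (P : Pauli (Bool × Fin n)) : Pauli (Fin n) :=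
  (fun i => P.1 (σ, i), fun i => P.2 (σ, i))

/-- A bit string on the two surfaces from one on each surface. -/
def twoSurfaces (y z : Fin n → ZMod 2) : Bool × Fin n → ZMod 2 :=
  fun q => if q.1 then z q.2 else y q.2

/-- The unnormalized state of the first surface after all qubits of the second one have been
measured in the standard basis with outcome `z`. -/
def measureStandard (z : Fin n → ZMod 2) (φ : State (Bool × Fin n)) : State (Fin n) :=
  fun y => φ (twoSurfaces y z)

/-- The unnormalized state of the first surface after all qubits of the second one have been
measured in the Hadamard basis with outcome `z`. -/
noncomputable def measureHadamard (z : Fin n → ZMod 2) (φ : State (Bool × Fin n)) :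
    State (Fin n) :=
  fun y => invSqrtTwo ^ n * ∑ b, sgn (z ⬝ᵥ b) * φ (twoSurfaces y b)

/-! ### Stabilizers of the graph state that act on the bulk by `X` operators only -/

/-- The `Z` meta-check of `c ∈ [m_z]` centred at the even layer `2t + 2`: the bulk support of
`X_(c,2t+1) X_(c,2t+3) ∏_{i ∼ c} X_(i,2t+2)`. -/
def zMeta (R : CSSCode n mx mz) {T : ℕ} (t : Fin T) (c : Fin mz) : Bulk T n mx mz → ZMod 2 :=
  fun v => match v.1 with
    | .code τ i => if (τ : ℕ) = 2 * t + 1 then R.HZ c i else 0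
    | .zcheck τ c' => if c' = c ∧ ((τ : ℕ) = t ∨ (τ : ℕ) = t + 1) then 1 else 0
    | .xcheck _ _ => 0

/-- The `X` meta-check of `c ∈ [m_x]` centred at the odd layer `2t + 3` (where `t + 1 < T`): the
bulk support of `X_(c,2t+2) X_(c,2t+4) ∏_{i ∼ c} X_(i,2t+3)`. -/
def xMeta (R : CSSCode n mx mz) {T : ℕ} (t : ℕ) (c : Fin mx) : Bulk T n mx mz → ZMod 2 :=
  fun v => match v.1 with
    | .code τ i => if (τ : ℕ) = 2 * t + 2 then R.HX c i else 0
    | .zcheck _ _ => 0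
    | .xcheck τ c' => if c' = c ∧ ((τ : ℕ) = t ∨ (τ : ℕ) = t + 1) then 1 else 0

/-- The meta-checks: the supports `α` of the generators `I ⊗ X(α)` of `𝒮⁰`. -/
def metaChecks (R : CSSCode n mx mz) (T : ℕ) : Set (Bulk T n mx mz → ZMod 2) :=
  {α | (∃ (t : Fin T) (c : Fin mz), α = zMeta R t c) ∨
       (∃ (t : ℕ) (c : Fin mx), t + 1 < T ∧ α = xMeta R t c)}

/-- `Z`-type stabilizers of the two boundary codes: the stabilizer
`(∏_{i ∼ c} Z_(i,t)) ⊗ X_(c,t)` of the graph state for `t = 1` and `t = 2T+1`, as the pair of its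
boundary Pauli operator and the support of its bulk `X` operator. -/
def zBoundary (R : CSSCode n mx mz) (T : ℕ) (σ : Bool) (c : Fin mz) :
    Pauli (Bool × Fin n) × (Bulk T n mx mz → ZMod 2) :=
  ((0, fun q => if q.1 = σ then R.HZ c q.2 else 0),
   fun v => match v.1 with
    | .zcheck τ c' => if c' = c ∧ (τ : ℕ) = (if σ then T else 0) then 1 else 0
    | _ => 0)

/-- `X`-type stabilizers of the two boundary codes: `(∏_{i ∼ c} X_(i,1)) ⊗ X_(c,2)` and
`(∏_{i ∼ c} X_(i,2T+1)) ⊗ X_(c,2T)`. -/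
def xBoundary (R : CSSCode n mx mz) (T : ℕ) (σ : Bool) (c : Fin mx) :
    Pauli (Bool × Fin n) × (Bulk T n mx mz → ZMod 2) :=
  ((fun q => if q.1 = σ then R.HX c q.2 else 0, 0),
   fun v => match v.1 with
    | .xcheck τ c' => if c' = c ∧ (τ : ℕ) = (if σ then T - 1 else 0) then 1 else 0
    | _ => 0)

/-- The encoded `X̄ ⊗ X̄` stabilizer for a logical `X̄ = X(a)`: its bulk part consists of the
copies of `a` on the odd layers `3, 5, …, 2T-1`. -/
def xxLogical (T mx mz : ℕ) (a : Fin n → ZMod 2) :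
    Pauli (Bool × Fin n) × (Bulk T n mx mz → ZMod 2) :=
  ((fun q => a q.2, 0),
   fun v => match v.1 with
    | .code τ i => if Odd (τ + 1 : ℕ) then a i else 0
    | _ => 0)

/-- The encoded `Z̄ ⊗ Z̄` stabilizer for a logical `Z̄ = Z(a)`: its bulk part consists of the
copies of `a` on the even layers `2, 4, …, 2T`. -/
def zzLogical (T mx mz : ℕ) (a : Fin n → ZMod 2) :
    Pauli (Bool × Fin n) × (Bulk T n mx mz → ZMod 2) :=
  ((0, fun q => a q.2),
   fun v => match v.1 with
    | .code τ i => if Even (τ + 1 : ℕ) then a i else 0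
    | _ => 0)

/-- The generators `S_∂ ⊗ X(γ)` of `𝒮¹` (besides the meta-checks). -/
def bellGenerators (R : CSSCode n mx mz) (T : ℕ) :
    Set (Pauli (Bool × Fin n) × (Bulk T n mx mz → ZMod 2)) :=
  {g | (∃ σ c, g = zBoundary R T σ c) ∨ (∃ σ c, g = xBoundary R T σ c) ∨
       (∃ a ∈ R.xLogical, g = xxLogical T mx mz a) ∨
       (∃ a ∈ R.zLogical, g = zzLogical T mx mz a)}

/-! ### The decoder -/

/-- `dec` maps an outcome `s` to (the support of) a minimum-weight `Z`-type Pauli `Z(β)` on the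
bulk consistent with the meta-check syndromes of `s`; it uses only these syndromes. -/
def IsMinWeightDecoder (R : CSSCode n mx mz) (T : ℕ)
    (dec : (Bulk T n mx mz → ZMod 2) → (Bulk T n mx mz → ZMod 2)) : Prop :=
  (∀ s, ∀ α ∈ metaChecks R T, α ⬝ᵥ dec s = α ⬝ᵥ s) ∧
  (∀ s β, (∀ α ∈ metaChecks R T, α ⬝ᵥ β = α ⬝ᵥ s) → hammingNorm (dec s) ≤ hammingNorm β) ∧
  (∀ s s', (∀ α ∈ metaChecks R T, α ⬝ᵥ s = α ⬝ᵥ s') → dec s = dec s')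

/-- `Rec s` is a Pauli operator on the boundary consistent with the corrected syndromes
`s·γ + γ·β`, `β = dec s`, of the stabilizers `S_∂ ⊗ X(γ)`. -/
def IsPauliFrame (R : CSSCode n mx mz) (T : ℕ)
    (dec : (Bulk T n mx mz → ZMod 2) → (Bulk T n mx mz → ZMod 2))
    (Rec : (Bulk T n mx mz → ZMod 2) → Pauli (Bool × Fin n)) : Prop :=
  ∀ s, ∀ g ∈ bellGenerators R T, symp (Rec s) g.1 = g.2 ⬝ᵥ s + g.2 ⬝ᵥ dec s

/-- `Rmin P = Rep_Z(P) · Rep_X(P)`, where, for a bulk error `P` with `Z` part `Z(η)`, the `X`-type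
operator `Rep_Z(P)` (resp. the `Z`-type operator `Rep_X(P)`) has minimum weight among those
consistent with the residual syndromes `γ·β + γ·η`, `β = dec η`, of the `Z`-type (resp. `X`-type)
stabilizers of the two boundary codes. -/
def IsMinWeightResidual (R : CSSCode n mx mz) (T : ℕ)
    (dec : (Bulk T n mx mz → ZMod 2) → (Bulk T n mx mz → ZMod 2))
    (Rmin : Pauli (Bulk T n mx mz) → Pauli (Bool × Fin n)) : Prop :=
  ∀ P : Pauli (Bulk T n mx mz),
    let zConsistent : (Bool × Fin n → ZMod 2) → Prop := fun e =>
      ∀ σ c, symp (e, 0) (zBoundary R T σ c).1 =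
        (zBoundary R T σ c).2 ⬝ᵥ dec P.2 + (zBoundary R T σ c).2 ⬝ᵥ P.2
    let xConsistent : (Bool × Fin n → ZMod 2) → Prop := fun e =>
      ∀ σ c, symp (0, e) (xBoundary R T σ c).1 =
        (xBoundary R T σ c).2 ⬝ᵥ dec P.2 + (xBoundary R T σ c).2 ⬝ᵥ P.2
    (zConsistent (Rmin P).1 ∧ ∀ e, zConsistent e → hammingNorm (Rmin P).1 ≤ hammingNorm e) ∧
    (xConsistent (Rmin P).2 ∧ ∀ e, xConsistent e → hammingNorm (Rmin P).2 ≤ hammingNorm e)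

end ATG

/-! ### The probabilistic guarantee -/

/-- The lower bound `1 - nT (p/p*)^(c · min(T,d))` on the success probability. -/
noncomputable def successBound (c pstar p : ℝ) (n T : ℕ) (d : ℕ∞) : ℝ :=
  1 - n * T * (p / pstar) ^ (c * ((min (T : ℕ∞) d).toNat : ℝ))

/-- For every local stochastic error `P` of rate `p < p*` on the qubits `V`: the event `Succ` has
probability at least `1 - nT (p/p*)^(c · min(T,d))`; the residual error `Rep P`, on the event
`Succ`, contains any given set `S` in its support with probability at most `(C p^(1/2))^|S|`; and,
as soon as the lower bound is positive, `Rep P` conditioned on `Succ` is local stochastic of rate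
`C p^(1/2)`. -/
def Guarantee {V W : Type} [Fintype V] [Fintype W] (c pstar C : ℝ) (n T : ℕ) (d : ℕ∞)
    (Succ : Set (Pauli V)) (Rep : Pauli V → Pauli W) : Prop :=
  ∀ (p : ℝ) (μ : PMF (Pauli V)), p < pstar → IsLocalStochastic μ p →
    successBound c pstar p n T d ≤ prob μ Succ ∧
    (∀ S : Finset W, prob μ {P | P ∈ Succ ∧ S ⊆ supp (Rep P)} ≤ (C * Real.sqrt p) ^ S.card) ∧
    (0 < successBound c pstar p n T d → ∃ h : ∃ P ∈ Succ, P ∈ μ.support,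
      IsLocalStochastic ((μ.filter Succ h).map Rep) (C * Real.sqrt p))

end SSSP

open SSSP

namespace SSSP

/-! ### Rooted sets -/

/-! After a bulk error with `Z` part `η`, an outcome `s` has amplitude zero unless `s` and `η` have
the same meta-check syndromes. For the other outcomes the decoder returns the same vector for `s` as
for `η`, so the syndromes of `Rec s` compensate for `s` up to a term that depends on the error
alone. The output is therefore a state stabilized by all Bell generators, acted on by a Pauli that
depends only on the error. The generators fix the encoded Bell state up to a scalar
(`exists_eq_smul_bellState`, `exists_output_eq`).

It remains to choose this Pauli. The minimum-weight residual together with the boundary error has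
the right commutation with the checks of the two surfaces. Against the encoded `X̄X̄` and `Z̄Z̄` it
is wrong by the class of one vector, `layerSum`: the sum of all code layers of `η + β` and of the
residual on both surfaces, where `β = dec η`. The meta-check equations telescope over the layers, so
this vector is always a logical operator. It is put on the first surface as a correction, and
success means that it is a stabilizer.

The two kinds of meta-checks see disjoint parts of the bulk. Each kind gives a sector: repeated
syndrome measurement of one parity check matrix between two surfaces. Decompose `η + β` with the
residual into clusters, qubits being adjacent when they share a check. Minimality of `β` puts half
of the bulk part of a cluster into `η`. Minimality of the residual bounds the surface part by the
code part projected onto that surface. So a quarter of the whole cluster is error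
(`IsSectorDecoding.part_bounds`). A cluster with fewer than `min(T,d)` qubits cannot join the two
surfaces, and its layer sum, being lighter than `d`, is a stabilizer (`IsSectorDecoding.decode`).

A Peierls bound finishes the proof (`prob_rooted_le`). Connected sets grow exponentially in number,
and one that is a quarter error costs a factor of order `p^(1/4)` per qubit; hence failure is
exponentially small in `min(T,d)`. A set `S` in the residual error is covered by clusters containing
at least `|S|/2` errors, which gives the rate `√p`.

When the second surface is measured, its residual error is decoded from the outcome by minimum
weight in a single copy of the code. The same cluster argument, with one half in place of one
quarter, bounds the additional failure. -/

/-- `U` contains `S`, and every element of `U` can be reached from `S` by steps of `r` inside `U`. -/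
def Rooted {V : Type} (r : V → V → Prop) (S U : Finset V) : Prop :=
  S ⊆ U ∧ ∀ v ∈ U, ∃ s ∈ S, Relation.ReflTransGen (fun a b => r a b ∧ b ∈ U) s v

theorem Rooted.map {V W : Type} {r : V → V → Prop} {r' : W → W → Prop} (φ : V ↪ W)
    (hφ : ∀ a b, r a b → r' (φ a) (φ b)) {S U : Finset V} (h : Rooted r S U) :
    Rooted r' (S.map φ) (U.map φ) := by
  refine ⟨Finset.map_subset_map.2 h.1, fun v hv => ?_⟩
  obtain ⟨u, hu, rfl⟩ := Finset.mem_map.1 hv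
  obtain ⟨s, hs, hsu⟩ := h.2 u hu
  refine ⟨φ s, Finset.mem_map_of_mem _ hs, hsu.lift φ fun a b hab => ⟨hφ _ _ hab.1, ?_⟩⟩
  exact Finset.mem_map_of_mem _ hab.2

theorem Rooted.union {V : Type} [DecidableEq V] {r : V → V → Prop} {S S' U U' : Finset V}
    (h : Rooted r S U) (h' : Rooted r S' U') : Rooted r (S ∪ S') (U ∪ U') := by
  refine ⟨Finset.union_subset_union h.1 h'.1, fun v hv => ?_⟩
  rcases Finset.mem_union.1 hv with hv | hv
  · obtain ⟨s, hs, hsv⟩ := h.2 v hv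
    exact ⟨s, Finset.mem_union_left _ hs, Relation.ReflTransGen.mono (fun a b hab => ⟨hab.1, Finset.mem_union_left _ hab.2⟩) _ _ hsv⟩
  · obtain ⟨s, hs, hsv⟩ := h'.2 v hv
    exact ⟨s, Finset.mem_union_right _ hs, Relation.ReflTransGen.mono (fun a b hab => ⟨hab.1, Finset.mem_union_right _ hab.2⟩) _ _ hsv⟩

theorem Rooted.self {V : Type} (r : V → V → Prop) (S : Finset V) : Rooted r S S :=
  ⟨subset_rfl, fun v hv => ⟨v, hv, .refl⟩⟩

/-- In a graph of degree at most `Δ`, the sets rooted at `S` have total weight at most one when a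
set of size `u` has weight `2^(-(Δ+1)u)`: a set `U` is the cluster of `S` in a uniformly random set
of open vertices with at least that probability. -/
theorem sum_rooted_le_one {V : Type} [Fintype V] (r : V → V → Prop) (Δ : ℕ)
    (hΔ : ∀ u, {v | r u v}.ncard ≤ Δ) (S : Finset V) (𝒰 : Finset (Finset V))
    (h𝒰 : ∀ U ∈ 𝒰, Rooted r S U) :
    ∑ U ∈ 𝒰, (((2 : ℝ) ^ (Δ + 1)) ^ U.card)⁻¹ ≤ 1 := by
  classical
  let bd : Finset V → Finset V := fun U => Finset.univ.filter fun b => b ∉ U ∧ ∃ a ∈ U, r a b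
  let F : Finset V → Finset (Finset V) := fun U =>
    Finset.univ.filter fun ω => U ⊆ ω ∧ Disjoint ω (bd U)
  have hbd : ∀ U, (bd U).card ≤ U.card * Δ := by
    intro U
    have : bd U ⊆ U.biUnion fun a => Finset.univ.filter fun b => r a b := by
      intro b hb
      obtain ⟨-, -, a, ha, hab⟩ := Finset.mem_filter.1 hb
      exact Finset.mem_biUnion.2 ⟨a, ha, by simpa using hab⟩
    refine (Finset.card_le_card this).trans (Finset.card_biUnion_le_card_mul _ _ _ fun a _ => ?_)
    have := hΔ a
    rwa [Set.ncard_eq_toFinset_card', Set.toFinset_ofPred] at this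
  have hF : ∀ U, 2 ^ Fintype.card V ≤ (F U).card * (2 ^ (Δ + 1)) ^ U.card := by
    intro U
    have hdisj : Disjoint U (bd U) := by
      rw [Finset.disjoint_left]; intro a ha hb
      exact (Finset.mem_filter.1 hb).2.1 ha
    -- Members of `F U` are prescribed on `U ∪ bd U` and free elsewhere, so there are at least
    -- `2^(|V| - |U| - |bd U|)` of them.
    have hsub : ((U ∪ bd U)ᶜ.powerset.image fun ω => ω ∪ U) ⊆ F U := by
      intro ω hω
      obtain ⟨τ, hτ, rfl⟩ := Finset.mem_image.1 hω
      rw [Finset.mem_powerset] at hτ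
      refine Finset.mem_filter.2 ⟨Finset.mem_univ _, Finset.subset_union_right, ?_⟩
      rw [Finset.disjoint_union_left]
      refine ⟨?_, hdisj⟩
      rw [Finset.disjoint_left]
      intro a ha hb
      have := hτ ha
      simp [hb] at this
    have hinj : Set.InjOn (fun ω => ω ∪ U) ((U ∪ bd U)ᶜ.powerset : Finset (Finset V)) := by
      intro a ha b hb hab
      have ha' := Finset.mem_powerset.1 ha
      have hb' := Finset.mem_powerset.1 hb
      ext v
      have h1 := Finset.ext_iff.1 hab v
      have h2 : v ∈ a → v ∉ U := fun h => by have := ha' h; simp at this; tauto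
      have h3 : v ∈ b → v ∉ U := fun h => by have := hb' h; simp at this; tauto
      simp at h1
      tauto
    have hcard := Finset.card_le_card hsub
    rw [Finset.card_image_of_injOn hinj, Finset.card_powerset] at hcard
    have h1 : Fintype.card V ≤ (U ∪ bd U)ᶜ.card + (Δ + 1) * U.card := by
      have h2 := Finset.card_compl_add_card (U ∪ bd U)
      have h3 := Finset.card_union_le U (bd U)
      have h4 := hbd U
      nlinarith
    calc 2 ^ Fintype.card V ≤ 2 ^ ((U ∪ bd U)ᶜ.card + (Δ + 1) * U.card) :=
          Nat.pow_le_pow_right (by norm_num) h1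
      _ = 2 ^ (U ∪ bd U)ᶜ.card * (2 ^ (Δ + 1)) ^ U.card := by rw [pow_add, pow_mul]
      _ ≤ _ := Nat.mul_le_mul_right _ hcard
  -- A set `ω ∈ F U` contains `U` and misses its boundary, so `U` is recovered from `ω` as what is
  -- reachable from `S` through `ω`. Hence the families `F U` are disjoint.
  have hdet : ∀ U ∈ 𝒰, ∀ ω ∈ F U,
      ∀ v, v ∈ U ↔ ∃ s ∈ S, Relation.ReflTransGen (fun a b => r a b ∧ b ∈ ω) s v := by
    intro U hU ω hω v
    obtain ⟨-, hUω, hdis⟩ := Finset.mem_filter.1 hω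
    constructor
    · intro hv
      obtain ⟨s, hs, hsv⟩ := (h𝒰 U hU).2 v hv
      exact ⟨s, hs, Relation.ReflTransGen.mono (fun a b hab => ⟨hab.1, hUω hab.2⟩) _ _ hsv⟩
    · rintro ⟨s, hs, hsv⟩
      induction hsv with
      | refl => exact (h𝒰 U hU).1 hs
      | @tail a b _ hab ih =>
        by_contra hb
        exact Finset.disjoint_left.1 hdis hab.2
          (Finset.mem_filter.2 ⟨Finset.mem_univ _, hb, a, ih, hab.1⟩)
  have hpd : (𝒰 : Set (Finset V)).PairwiseDisjoint F := by
    intro U hU U' hU' hne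
    change Disjoint (F U) (F U')
    rw [Finset.disjoint_left]
    intro ω hω hω'
    exact hne (Finset.ext fun v => (hdet U hU ω hω v).trans (hdet U' hU' ω hω' v).symm)
  have htot : ∑ U ∈ 𝒰, (F U).card ≤ 2 ^ Fintype.card V := by
    rw [← Finset.card_biUnion hpd]
    exact (Finset.card_le_univ _).trans (by simp)
  have hpos : (0 : ℝ) < 2 ^ Fintype.card V := by positivity
  have : ∑ U ∈ 𝒰, (2 : ℝ) ^ Fintype.card V * (((2 : ℝ) ^ (Δ + 1)) ^ U.card)⁻¹
      ≤ 2 ^ Fintype.card V := by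
    calc _ ≤ ∑ U ∈ 𝒰, ((F U).card : ℝ) := by
          refine Finset.sum_le_sum fun U _ => ?_
          rw [mul_inv_le_iff₀ (by positivity)]
          exact_mod_cast hF U
      _ ≤ _ := by exact_mod_cast htot
  rw [← Finset.mul_sum] at this
  exact le_of_mul_le_mul_left (by linarith) hpos

/-! ### Probability -/

theorem toOuterMeasure_ne_top {α : Type} (μ : PMF α) (A : Set α) : μ.toOuterMeasure A ≠ ⊤ := by
  have h1 : μ.toOuterMeasure Set.univ = 1 :=
    (μ.toOuterMeasure_apply_eq_one_iff _).2 (Set.subset_univ _)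
  refine ne_top_of_le_ne_top ENNReal.one_ne_top ?_
  rw [← h1]
  exact MeasureTheory.measure_mono (Set.subset_univ _)

theorem prob_mono {α : Type} (μ : PMF α) {A B : Set α} (h : A ⊆ B) : prob μ A ≤ prob μ B := by
  exact ENNReal.toReal_mono (toOuterMeasure_ne_top μ B) (MeasureTheory.measure_mono h)

theorem prob_nonneg {α : Type} (μ : PMF α) (A : Set α) : 0 ≤ prob μ A := ENNReal.toReal_nonneg

theorem prob_univ {α : Type} (μ : PMF α) : prob μ Set.univ = 1 := by
  rw [prob, (μ.toOuterMeasure_apply_eq_one_iff _).2 (Set.subset_univ _), ENNReal.toReal_one]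

theorem prob_le_one {α : Type} (μ : PMF α) (A : Set α) : prob μ A ≤ 1 := by
  rw [← prob_univ μ]; exact prob_mono μ (Set.subset_univ _)

theorem prob_biUnion_le {α ι : Type} (μ : PMF α) (I : Finset ι) (A : ι → Set α) :
    prob μ (⋃ i ∈ I, A i) ≤ ∑ i ∈ I, prob μ (A i) := by
  have hne := toOuterMeasure_ne_top μ
  unfold prob
  rw [← ENNReal.toReal_sum fun i _ => hne _]
  exact ENNReal.toReal_mono (ENNReal.sum_ne_top.2 fun i _ => hne _)
    (MeasureTheory.measure_biUnion_finset_le I A)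

theorem prob_union_le {α : Type} (μ : PMF α) (A B : Set α) :
    prob μ (A ∪ B) ≤ prob μ A + prob μ B := by
  have hne := toOuterMeasure_ne_top μ
  unfold prob
  rw [← ENNReal.toReal_add (hne _) (hne _)]
  exact ENNReal.toReal_mono (ENNReal.add_ne_top.2 ⟨hne _, hne _⟩) (MeasureTheory.measure_union_le A B)

theorem one_le_prob_add_prob_compl {α : Type} (μ : PMF α) (A : Set α) :
    1 ≤ prob μ A + prob μ Aᶜ := by
  rw [← prob_univ μ, ← Set.union_compl_self A]; exact prob_union_le μ A Aᶜ

/-- The Peierls bound: if a random set `X` contains a given set `B` with probability at most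
`(ρ^a)^|B|`, then a rooted set with a `1/a` fraction of its vertices in `X` is rare. -/
theorem prob_rooted_le {V Ω : Type} [Fintype V] [DecidableEq V] (r : V → V → Prop) (Δ : ℕ)
    (hΔ : ∀ u, {v | r u v}.ncard ≤ Δ) (μ : PMF Ω) (F : Set Ω) (X : Ω → Finset V) (a : ℕ)
    (ρ : ℝ) (hρ : 0 ≤ ρ) (hsmall : 2 * 2 ^ (Δ + 1) * ρ ≤ 1)
    (hX : ∀ B : Finset V, prob μ {ω | ω ∈ F ∧ B ⊆ X ω} ≤ (ρ ^ a) ^ B.card)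
    (S : Finset V) (k : ℕ) :
    prob μ {ω | ω ∈ F ∧ ∃ U, Rooted r S U ∧ U.card ≤ a * (X ω ∩ U).card ∧
      k ≤ a * (X ω ∩ U).card} ≤ (2 * 2 ^ (Δ + 1) * ρ) ^ k := by
  classical
  set A : ℝ := 2 ^ (Δ + 1) with hA
  have hA1 : 1 ≤ A := one_le_pow₀ (by norm_num)
  have hρ1 : ρ ≤ 1 := by nlinarith
  let 𝒰 : Finset (Finset V) := Finset.univ.filter fun U => Rooted r S U
  -- The possible traces `X ω ∩ U`.
  let ℬ : Finset V → Finset (Finset V) := fun U =>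
    U.powerset.filter fun B => U.card ≤ a * B.card ∧ k ≤ a * B.card
  have hsub : {ω | ω ∈ F ∧ ∃ U, Rooted r S U ∧ U.card ≤ a * (X ω ∩ U).card ∧
      k ≤ a * (X ω ∩ U).card} ⊆ ⋃ U ∈ 𝒰, ⋃ B ∈ ℬ U, {ω | ω ∈ F ∧ B ⊆ X ω} := by
    rintro ω ⟨hω, U, hU, h1, h2⟩
    simp only [Set.mem_iUnion]
    exact ⟨U, Finset.mem_filter.2 ⟨Finset.mem_univ _, hU⟩, X ω ∩ U,
      Finset.mem_filter.2 ⟨Finset.mem_powerset.2 Finset.inter_subset_right, h1, h2⟩, hω,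
      Finset.inter_subset_left⟩
  have hB : ∀ U, ∑ B ∈ ℬ U, prob μ {ω | ω ∈ F ∧ B ⊆ X ω} ≤ 2 ^ U.card * ρ ^ max U.card k := by
    intro U
    calc _ ≤ ∑ B ∈ ℬ U, ρ ^ max U.card k := by
          refine Finset.sum_le_sum fun B hB => (hX B).trans ?_
          obtain ⟨-, h1, h2⟩ := Finset.mem_filter.1 hB
          rw [← pow_mul]
          exact pow_le_pow_of_le_one hρ hρ1 (max_le h1 h2)
      _ = (ℬ U).card * ρ ^ max U.card k := by rw [Finset.sum_const, nsmul_eq_mul]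
      _ ≤ _ := by
          refine mul_le_mul_of_nonneg_right ?_ (by positivity)
          have := Finset.card_filter_le U.powerset fun B => U.card ≤ a * B.card ∧ k ≤ a * B.card
          rw [Finset.card_powerset] at this
          exact_mod_cast this
  -- The factor `2^|U|` counts the traces. Splitting off `A^(-|U|)`, the weight that
  -- `sum_rooted_le_one` can sum, costs another `A^|U|`. The exponent `max |U| k` pays for both,
  -- whichever of the two is larger.
  have hU : ∀ U : Finset V, (2 : ℝ) ^ U.card * ρ ^ max U.card k ≤
      (2 * A * ρ) ^ k * (A ^ U.card)⁻¹ := by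
    intro U
    rw [le_mul_inv_iff₀ (by positivity)]
    have h0 : 0 ≤ 2 * A * ρ := by positivity
    rcases le_total U.card k with h | h
    · rw [max_eq_right h]
      calc (2 : ℝ) ^ U.card * ρ ^ k * A ^ U.card = (2 * A) ^ U.card * ρ ^ k := by
            rw [mul_pow]; ring
        _ ≤ (2 * A) ^ k * ρ ^ k := by
            gcongr
            nlinarith
        _ = _ := by rw [← mul_pow]
    · rw [max_eq_left h]
      calc (2 : ℝ) ^ U.card * ρ ^ U.card * A ^ U.card = (2 * A * ρ) ^ U.card := by
            rw [mul_pow, mul_pow]; ring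
        _ ≤ _ := pow_le_pow_of_le_one h0 hsmall h
  calc _ ≤ _ := prob_mono μ hsub
    _ ≤ ∑ U ∈ 𝒰, prob μ (⋃ B ∈ ℬ U, {ω | ω ∈ F ∧ B ⊆ X ω}) := prob_biUnion_le _ _ _
    _ ≤ ∑ U ∈ 𝒰, (2 * A * ρ) ^ k * (A ^ U.card)⁻¹ := by
        refine Finset.sum_le_sum fun U _ => ?_
        exact (prob_biUnion_le _ _ _).trans ((hB U).trans (hU U))
    _ ≤ (2 * A * ρ) ^ k * 1 := by
        rw [← Finset.mul_sum]
        refine mul_le_mul_of_nonneg_left ?_ (by positivity)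
        exact sum_rooted_le_one r Δ hΔ S 𝒰 fun U hU => (Finset.mem_filter.1 hU).2
    _ = _ := mul_one _

/-- Conditioning on an event of probability at least `1/2`. -/
theorem guarantee_of_bounds {V W : Type} [Fintype V] [Fintype W] {c pstar C : ℝ} {n T : ℕ}
    {d : ℕ∞} {Succ : Set (Pauli V)} {Rep : Pauli V → Pauli W} (hC : 0 ≤ C)
    (hCp : C * Real.sqrt pstar ≤ 1)
    (h1 : ∀ (p : ℝ) (μ : PMF (Pauli V)), p < pstar → IsLocalStochastic μ p →
      1 - n * T * (p / pstar) ^ (c * ((min (T : ℕ∞) d).toNat : ℝ)) / 2 ≤ prob μ Succ)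
    (h2 : ∀ (p : ℝ) (μ : PMF (Pauli V)), p < pstar → IsLocalStochastic μ p →
      ∀ S : Finset W, prob μ {P | P ∈ Succ ∧ S ⊆ supp (Rep P)} ≤
        (C / 2 * Real.sqrt p) ^ S.card) :
    Guarantee c pstar C n T d Succ Rep := by
  intro p μ hp hμ
  have hp0 := hμ.1
  have hps : 0 < pstar := hp0.trans_lt hp
  have hx : 0 ≤ n * T * (p / pstar) ^ (c * ((min (T : ℕ∞) d).toNat : ℝ)) := by positivity
  have hs : 0 ≤ C * Real.sqrt p := by positivity
  have hprob := h1 p μ hp hμ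
  have hS := h2 p μ hp hμ
  -- Conditioning at most doubles a probability; a factor `1/2` per element of a nonempty set
  -- absorbs this.
  have half : ∀ k : ℕ, k ≠ 0 → (C / 2 * Real.sqrt p) ^ k ≤ (C * Real.sqrt p) ^ k / 2 := by
    intro k hk
    have : C / 2 * Real.sqrt p = C * Real.sqrt p * (1 / 2) := by ring
    rw [this, mul_pow]
    have h12 : ((1 : ℝ) / 2) ^ k ≤ 1 / 2 := pow_le_of_le_one (by norm_num) (by norm_num) hk
    have := pow_nonneg hs k
    nlinarith
  refine ⟨?_, fun S => (hS S).trans ?_, fun hb => ?_⟩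
  · unfold successBound; linarith
  · gcongr; linarith
  · unfold successBound at hb
    -- A positive success bound means that the subtracted term is below `1`, and the failure
    -- probability is at most half of that term.
    have hhalf : 1 / 2 ≤ prob μ Succ := by linarith
    have hex : ∃ P ∈ Succ, P ∈ μ.support := by
      by_contra hcon
      have : μ.toOuterMeasure Succ = 0 := by
        rw [PMF.toOuterMeasure_apply_eq_zero_iff, Set.disjoint_left]
        exact fun P hP hP' => hcon ⟨P, hP', hP⟩
      rw [prob, this] at hhalf
      norm_num at hhalf
    refine ⟨hex, hs, ?_, fun S => ?_⟩
    · refine le_trans ?_ hCp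
      gcongr
    · by_cases hS0 : S.card = 0
      · rw [hS0, pow_zero]; exact prob_le_one _ _
      classical
      have key : prob ((μ.filter Succ hex).map Rep) {E | S ⊆ supp E} * prob μ Succ ≤
          prob μ {P | P ∈ Succ ∧ S ⊆ supp (Rep P)} := by
        unfold prob
        rw [PMF.toOuterMeasure_map_apply, ← ENNReal.toReal_mul]
        refine ENNReal.toReal_mono (toOuterMeasure_ne_top μ _) ?_
        simp only [PMF.toOuterMeasure_apply]
        rw [← ENNReal.tsum_mul_right]
        refine ENNReal.tsum_le_tsum fun P => ?_
        by_cases hP : P ∈ Succ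
        · by_cases hPS : S ⊆ supp (Rep P)
          · rw [Set.indicator_of_mem (by exact hPS), Set.indicator_of_mem (by exact ⟨hP, hPS⟩),
              PMF.filter_apply, Set.indicator_of_mem hP, mul_assoc, ENNReal.inv_mul_cancel, mul_one]
            · rw [← PMF.toOuterMeasure_apply]
              intro h0
              rw [prob, h0] at hhalf
              norm_num at hhalf
            · rw [← PMF.toOuterMeasure_apply]
              exact toOuterMeasure_ne_top μ _
          · rw [Set.indicator_of_notMem (by exact hPS)]; simp
        · rw [Set.indicator_apply, PMF.filter_apply, Set.indicator_of_notMem hP]; simp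
      have := (key.trans (hS S)).trans (half _ hS0)
      have h0 := prob_nonneg ((μ.filter Succ hex).map Rep) {E | S ⊆ supp E}
      nlinarith

/-! ### Clusters of binary vectors -/

/-- The support of a binary vector. -/
def vsupp {V : Type} [Fintype V] (x : V → ZMod 2) : Finset V := Finset.univ.filter fun v => x v ≠ 0

@[simp] theorem mem_vsupp {V : Type} [Fintype V] {x : V → ZMod 2} {v : V} :
    v ∈ vsupp x ↔ x v ≠ 0 := by simp [vsupp]

theorem hammingNorm_eq_card_vsupp {V : Type} [Fintype V] (x : V → ZMod 2) :
    hammingNorm x = (vsupp x).card := rfl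

theorem hammingNorm_add_le {V : Type} [Fintype V] (x y : V → ZMod 2) :
    hammingNorm (x + y) ≤ hammingNorm x + hammingNorm y := by
  classical
  rw [hammingNorm_eq_card_vsupp, hammingNorm_eq_card_vsupp, hammingNorm_eq_card_vsupp]
  refine (Finset.card_le_card ?_).trans (Finset.card_union_le _ _)
  intro v hv
  simp only [mem_vsupp, Finset.mem_union, Pi.add_apply] at hv ⊢
  by_contra h
  push Not at h
  simp [h.1, h.2] at hv

/-- `κ` arises from `x` by setting some entries to zero. -/
def IsPart {V : Type} (κ x : V → ZMod 2) : Prop := ∀ v, κ v = 0 ∨ κ v = x v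

theorem IsPart.trans {V : Type} {κ x y : V → ZMod 2} (h : IsPart κ x) (h' : IsPart x y) :
    IsPart κ y := fun v => by
  rcases h v with h1 | h1
  · exact .inl h1
  · rw [h1]; exact h' v

theorem IsPart.vsupp_subset {V : Type} [Fintype V] {κ x : V → ZMod 2} (h : IsPart κ x) :
    vsupp κ ⊆ vsupp x := by
  intro v hv
  rw [mem_vsupp] at *
  rcases h v with h1 | h1
  · exact absurd h1 hv
  · rwa [← h1]

theorem zmod2_add_self (a : ZMod 2) : a + a = 0 := CharTwo.add_self_eq_zero a

theorem vec_add_self {V : Type} (x : V → ZMod 2) : x + x = 0 := funext fun _ => zmod2_add_self _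

theorem zmod2_eq_one {a : ZMod 2} (h : a ≠ 0) : a = 1 := by
  revert h; revert a; decide

theorem IsPart.sub {V : Type} {κ x : V → ZMod 2} (h : IsPart κ x) : IsPart (x + κ) x := by
  intro v
  rcases h v with h1 | h1
  · right; simp [h1]
  · left; simp [h1, zmod2_add_self]

theorem IsPart.hammingNorm_add {V : Type} [Fintype V] {κ x : V → ZMod 2} (h : IsPart κ x) :
    hammingNorm (x + κ) + hammingNorm κ = hammingNorm x := by
  classical
  rw [hammingNorm_eq_card_vsupp, hammingNorm_eq_card_vsupp, hammingNorm_eq_card_vsupp,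
    ← Finset.card_union_of_disjoint]
  · congr 1
    ext v
    simp only [Finset.mem_union, mem_vsupp, Pi.add_apply]
    rcases h v with h1 | h1
    · simp [h1]
    · simp [h1, zmod2_add_self]
  · rw [Finset.disjoint_left]
    intro v
    simp only [mem_vsupp, Pi.add_apply]
    rcases h v with h1 | h1
    · simp [h1]
    · simp [h1, zmod2_add_self]

/-- If both `β` and `β + κ` are explanations of the same syndrome, `β` is the lighter one, and
`κ` is a part of `η + β`, then at least half of `κ` lies in `η`. -/
theorem card_vsupp_le_of_le {V : Type} [Fintype V] [DecidableEq V] {κ η β : V → ZMod 2}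
    (h : IsPart κ (η + β)) (hle : hammingNorm β ≤ hammingNorm (β + κ)) :
    (vsupp κ).card ≤ 2 * (vsupp κ ∩ vsupp η).card := by
  have h1 : vsupp κ ⊆ (vsupp κ ∩ vsupp η) ∪ (vsupp κ ∩ vsupp β) := by
    intro v hv
    have := h.vsupp_subset hv
    simp only [mem_vsupp, Pi.add_apply, Finset.mem_union, Finset.mem_inter] at *
    by_contra hc
    push Not at hc
    have := hc.1 hv
    have := hc.2 hv
    simp_all
  have h2 : (vsupp κ ∩ vsupp β).card + (vsupp β \ vsupp κ).card = (vsupp β).card := by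
    rw [Finset.inter_comm, Finset.card_inter_add_card_sdiff]
  -- Off the support of `κ` the sum `β + κ` is `β`; on it `κ = η + β`, so the sum is `η`.
  have h3 : vsupp (β + κ) ⊆ (vsupp β \ vsupp κ) ∪ (vsupp κ ∩ vsupp η) := by
    intro v hv
    have hη : κ v = 0 ∨ κ v = η v + β v := h v
    simp only [mem_vsupp, Pi.add_apply, Finset.mem_union, Finset.mem_sdiff, Finset.mem_inter] at *
    revert hη hv
    generalize κ v = a
    generalize η v = b
    generalize β v = c
    revert a b c
    decide
  rw [hammingNorm_eq_card_vsupp, hammingNorm_eq_card_vsupp] at hle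
  have h4 := (Finset.card_le_card h3).trans (Finset.card_union_le _ _)
  have h5 := (Finset.card_le_card h1).trans (Finset.card_union_le _ _)
  omega

/-- Two columns of a parity check matrix are adjacent if some row contains both. -/
def rowAdj {G V : Type} (M : Matrix G V (ZMod 2)) (u v : V) : Prop := ∃ g, M g u ≠ 0 ∧ M g v ≠ 0

theorem ncard_rowAdj_le {G V : Type} [Fintype G] [Fintype V] (M : Matrix G V (ZMod 2)) (a b : ℕ)
    (ha : ∀ v, hammingNorm (M.col v) ≤ a) (hb : ∀ g, hammingNorm (M.row g) ≤ b) (u : V) :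
    {v | rowAdj M u v}.ncard ≤ a * b := by
  classical
  have : {v | rowAdj M u v} ⊆ ((vsupp (M.col u)).biUnion fun g => vsupp (M.row g) : Finset V) := by
    rintro v ⟨g, h1, h2⟩
    simp only [Finset.coe_biUnion, Set.mem_iUnion, Finset.mem_coe, mem_vsupp]
    exact ⟨g, h1, h2⟩
  refine (Set.ncard_le_ncard this (Finset.finite_toSet _)).trans ?_
  rw [Set.ncard_coe_finset]
  refine (Finset.card_biUnion_le_card_mul _ _ b fun g _ => hb g).trans ?_
  exact Nat.mul_le_mul_right _ (ha u)

/-- The restriction of a vector to a set of coordinates. -/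
noncomputable def restr {V : Type} (x : V → ZMod 2) (K : Finset V) : V → ZMod 2 :=
  open Classical in fun v => if v ∈ K then x v else 0

theorem isPart_restr {V : Type} (x : V → ZMod 2) (K : Finset V) : IsPart (restr x K) x := by
  intro v
  unfold restr
  split_ifs <;> simp

theorem restr_of_mem {V : Type} {x : V → ZMod 2} {K : Finset V} {v : V} (h : v ∈ K) :
    restr x K v = x v := if_pos h

theorem restr_of_notMem {V : Type} {x : V → ZMod 2} {K : Finset V} {v : V} (h : v ∉ K) :
    restr x K v = 0 := if_neg h

theorem vsupp_restr {V : Type} [Fintype V] {x : V → ZMod 2} {K : Finset V} (hK : K ⊆ vsupp x) :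
    vsupp (restr x K) = K := by
  ext v
  rw [mem_vsupp]
  by_cases h : v ∈ K
  · rw [restr_of_mem h]; simpa [h] using mem_vsupp.1 (hK h)
  · simp [restr_of_notMem h, h]

/-- The union of the clusters of `x` that meet `S`. -/
noncomputable def cluster {G V : Type} [Fintype V] (M : Matrix G V (ZMod 2)) (x : V → ZMod 2)
    (S : Finset V) : Finset V :=
  open Classical in
  Finset.univ.filter fun v => ∃ s ∈ S, Relation.ReflTransGen (fun a b => rowAdj M a b ∧ b ∈ vsupp x) s v

theorem mem_cluster {G V : Type} [Fintype V] {M : Matrix G V (ZMod 2)} {x : V → ZMod 2}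
    {S : Finset V} {v : V} : v ∈ cluster M x S ↔
      ∃ s ∈ S, Relation.ReflTransGen (fun a b => rowAdj M a b ∧ b ∈ vsupp x) s v := by
  simp only [cluster, Finset.mem_filter, Finset.mem_univ, true_and]

theorem subset_cluster {G V : Type} [Fintype V] (M : Matrix G V (ZMod 2)) (x : V → ZMod 2)
    (S : Finset V) : S ⊆ cluster M x S := fun s hs =>
  mem_cluster.2 ⟨s, hs, .refl⟩

theorem cluster_subset {G V : Type} [Fintype V] {M : Matrix G V (ZMod 2)} {x : V → ZMod 2}
    {S : Finset V} (hS : S ⊆ vsupp x) : cluster M x S ⊆ vsupp x := by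
  intro v hv
  obtain ⟨s, hs, h⟩ := mem_cluster.1 hv
  cases h with
  | refl => exact hS hs
  | tail _ h => exact h.2

theorem cluster_closed {G V : Type} [Fintype V] {M : Matrix G V (ZMod 2)} {x : V → ZMod 2}
    {S : Finset V} {a b : V} (ha : a ∈ cluster M x S) (hab : rowAdj M a b) (hb : b ∈ vsupp x) :
    b ∈ cluster M x S := by
  obtain ⟨s, hs, h⟩ := mem_cluster.1 ha
  exact mem_cluster.2 ⟨s, hs, h.tail ⟨hab, hb⟩⟩

theorem rooted_cluster {G V : Type} [Fintype V] (M : Matrix G V (ZMod 2)) (x : V → ZMod 2)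
    (S : Finset V) : Rooted (rowAdj M) S (cluster M x S) := by
  refine ⟨subset_cluster M x S, fun v hv => ?_⟩
  obtain ⟨s, hs, h⟩ := mem_cluster.1 hv
  refine ⟨s, hs, ?_⟩
  clear hv
  induction h with
  | refl => exact .refl
  | tail h hab ih =>
    refine ih.tail ⟨hab.1, mem_cluster.2 ⟨s, hs, h.tail hab⟩⟩

/-- A row that meets the cluster contains no support point of `x` outside it, since such a point
would be adjacent to the cluster. The row therefore sees either all of `x` or nothing. -/
theorem mulVec_restr_cluster {G V : Type} [Fintype V] {M : Matrix G V (ZMod 2)}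
    {x : V → ZMod 2} {S : Finset V} {g : G} (hg : (M *ᵥ x) g = 0) :
    (M *ᵥ restr x (cluster M x S)) g = 0 := by
  by_cases h : ∃ a ∈ cluster M x S, M g a ≠ 0
  · obtain ⟨a, ha, hga⟩ := h
    rw [← hg]
    refine Finset.sum_congr rfl fun v _ => ?_
    by_cases hv : v ∈ cluster M x S
    · rw [restr_of_mem hv]
    · rw [restr_of_notMem hv]
      by_cases hgv : M g v = 0
      · simp [hgv]
      · have : x v = 0 := by
          by_contra hx
          exact hv (cluster_closed ha ⟨g, hga, hgv⟩ (mem_vsupp.2 hx))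
        simp [this]
  · push Not at h
    refine Finset.sum_eq_zero fun v _ => ?_
    by_cases hv : v ∈ cluster M x S
    · change M g v * _ = 0
      rw [h v hv, zero_mul]
    · rw [restr_of_notMem hv, mul_zero]

/-- If a property of vectors in the kernel of `M` is additive and holds for clusters, it holds for
all parts of `x` in the kernel. -/
theorem cluster_induction {G V : Type} [Fintype V] (M : Matrix G V (ZMod 2))
    (p : (V → ZMod 2) → Prop) (x : V → ZMod 2) (hx : M *ᵥ x = 0) (h0 : p 0)
    (hadd : ∀ y z, p y → p z → p (y + z))
    (hcl : ∀ κ v, IsPart κ x → M *ᵥ κ = 0 → Rooted (rowAdj M) {v} (vsupp κ) → p κ) : p x := by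
  suffices h : ∀ k : ℕ, ∀ y, IsPart y x → M *ᵥ y = 0 → (vsupp y).card = k → p y from
    h _ x (fun v => .inr rfl) hx rfl
  intro k
  induction k using Nat.strong_induction_on with
  | _ k ih =>
    intro y hyx hy hk
    by_cases hy0 : y = 0
    · rwa [hy0]
    obtain ⟨v, hv⟩ := Function.ne_iff.1 hy0
    have hv' : {v} ⊆ vsupp y := Finset.singleton_subset_iff.2 (mem_vsupp.2 hv)
    -- One cluster is split off; the remainder is again a part of `x` in the kernel, with smaller
    -- support.
    set κ := restr y (cluster M y {v}) with hκ
    have hκy : IsPart κ y := isPart_restr _ _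
    have hMκ : M *ᵥ κ = 0 := funext fun g => mulVec_restr_cluster (congrFun hy g)
    have hs : vsupp κ = cluster M y {v} := vsupp_restr (cluster_subset hv')
    have hpκ : p κ := hcl κ v (hκy.trans hyx) hMκ (hs ▸ rooted_cluster M y {v})
    have hlt : (vsupp (y + κ)).card < k := by
      have h1 := hκy.hammingNorm_add
      rw [hammingNorm_eq_card_vsupp, hammingNorm_eq_card_vsupp, hammingNorm_eq_card_vsupp, hk] at h1
      have h2 : 0 < (vsupp κ).card :=
        Finset.card_pos.2 ⟨v, hs ▸ subset_cluster M y {v} (Finset.mem_singleton_self v)⟩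
      omega
    have := ih _ hlt (y + κ) (hκy.sub.trans hyx) (by rw [Matrix.mulVec_add, hy, hMκ, add_zero]) rfl
    have h3 := hadd _ _ this hpκ
    rwa [add_assoc, vec_add_self, add_zero] at h3

/-- Along a rooted set with a single root, a function that changes by at most one along edges
takes all intermediate values. -/
theorem Rooted.lt_card {V : Type} {r : V → V → Prop} {s v : V} {U : Finset V}
    (h : Rooted r {s} U) (hv : v ∈ U) (τ : V → ℕ) (hτ : ∀ a b, r a b → τ b ≤ τ a + 1)
    (hs : τ s = 0) : τ v < U.card := by
  classical
  obtain ⟨s', hs', hsv⟩ := h.2 v hv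
  rw [Finset.mem_singleton] at hs'
  subst hs'
  have key : ∀ k ≤ τ v, ∃ u ∈ U, τ u = k := by
    clear hv
    induction hsv with
    | refl => exact fun k hk => ⟨s', h.1 (Finset.mem_singleton_self _), by omega⟩
    | @tail a b _ hab ih =>
      intro k hk
      rcases Nat.lt_or_ge (τ a) k with h1 | h1
      · exact ⟨b, hab.2, by have := hτ _ _ hab.1; omega⟩
      · exact ih k h1
  have : Finset.range (τ v + 1) ⊆ U.image τ := by
    intro k hk
    obtain ⟨u, hu, huk⟩ := key k (by simpa [Nat.lt_succ_iff] using hk)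
    exact Finset.mem_image.2 ⟨u, hu, huk⟩
  have := (Finset.card_le_card this).trans Finset.card_image_le
  rw [Finset.card_range] at this
  omega

/-! ### Decoding one sector of the alternating Tanner graph

One type of meta-checks sees only one type of check qubits, and the code qubits of every other
layer. Together with the surfaces this is a repeated syndrome measurement with `N` code layers
between `N + 1` layers of checks. -/

/-- The qubits of a sector. -/
inductive SV (N n m : ℕ)
  | code (t : Fin N) (i : Fin n)
  | check (t : Fin (N + 1)) (c : Fin m)
  | surf (σ : Bool) (i : Fin n)
  deriving DecidableEq, Fintype

variable {N n m : ℕ}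

/-- The qubits of a sector as a sum type. -/
def SV.equivSum : SV N n m ≃ (Fin N × Fin n) ⊕ (Fin (N + 1) × Fin m) ⊕ (Bool × Fin n) where
  toFun
    | .code t i => .inl (t, i)
    | .check t c => .inr (.inl (t, c))
    | .surf σ i => .inr (.inr (σ, i))
  invFun
    | .inl (t, i) => .code t i
    | .inr (.inl (t, c)) => .check t c
    | .inr (.inr (σ, i)) => .surf σ i
  left_inv v := by cases v <;> rfl
  right_inv v := by rcases v with v | v | v <;> rfl

theorem SV.sum_univ {M : Type} [AddCommMonoid M] (f : SV N n m → M) :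
    ∑ v, f v = (∑ t, ∑ i, f (.code t i)) + ((∑ t, ∑ c, f (.check t c)) + ∑ σ, ∑ i, f (.surf σ i)) := by
  rw [← SV.equivSum.symm.sum_comp, Fintype.sum_sum_type, Fintype.sum_sum_type,
    Fintype.sum_prod_type, Fintype.sum_prod_type, Fintype.sum_prod_type]
  rfl

/-- The outermost layer of checks next to a surface. -/
def endLayer (N : ℕ) (σ : Bool) : Fin (N + 1) := if σ then Fin.last N else 0

/-- The meta-checks of a sector, and the checks of the two surfaces. -/
def sectorMatrix (N : ℕ) (H : Matrix (Fin m) (Fin n) (ZMod 2)) :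
    Matrix ((Fin N ⊕ Bool) × Fin m) (SV N n m) (ZMod 2) := fun g v =>
  match g, v with
  | (.inl s, c), .code t i => if t = s then H c i else 0
  | (.inl s, c), .check t c' => if c' = c ∧ (t = s.castSucc ∨ t = s.succ) then 1 else 0
  | (.inl _, _), .surf _ _ => 0
  | (.inr _, _), .code _ _ => 0
  | (.inr σ, c), .check t c' => if c' = c ∧ t = endLayer N σ then 1 else 0
  | (.inr σ, c), .surf σ' i => if σ' = σ then H c i else 0

theorem sectorMatrix_mulVec_inl (H : Matrix (Fin m) (Fin n) (ZMod 2)) (x : SV N n m → ZMod 2)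
    (s : Fin N) (c : Fin m) : (sectorMatrix N H *ᵥ x) (.inl s, c) =
      ∑ i, H c i * x (.code s i) + (x (.check s.castSucc c) + x (.check s.succ c)) := by
  have hne : s.castSucc ≠ s.succ := (Fin.castSucc_lt_succ).ne
  change ∑ v, sectorMatrix N H (.inl s, c) v * x v = _
  rw [SV.sum_univ]
  simp only [sectorMatrix, zero_mul, Finset.sum_const_zero, add_zero]
  congr 1
  · simp [ite_mul]
  · have : ∀ (t : Fin (N + 1)) (c' : Fin m),
        (if c' = c ∧ (t = s.castSucc ∨ t = s.succ) then (1 : ZMod 2) else 0) * x (.check t c') =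
        (if t = s.castSucc then if c' = c then x (.check t c') else 0 else 0) +
        (if t = s.succ then if c' = c then x (.check t c') else 0 else 0) := by
      intro t c'
      by_cases h1 : c' = c <;> by_cases h2 : t = s.castSucc <;> by_cases h3 : t = s.succ <;>
        simp_all
    simp only [this, Finset.sum_add_distrib]
    congr 1 <;> · rw [Finset.sum_comm]; simp

theorem sectorMatrix_mulVec_inr (H : Matrix (Fin m) (Fin n) (ZMod 2)) (x : SV N n m → ZMod 2)
    (σ : Bool) (c : Fin m) : (sectorMatrix N H *ᵥ x) (.inr σ, c) =
      x (.check (endLayer N σ) c) + ∑ i, H c i * x (.surf σ i) := by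
  change ∑ v, sectorMatrix N H (.inr σ, c) v * x v = _
  rw [SV.sum_univ]
  simp only [sectorMatrix, zero_mul, Finset.sum_const_zero, zero_add]
  congr 1
  · have : ∀ (t : Fin (N + 1)) (c' : Fin m),
        (if c' = c ∧ t = endLayer N σ then (1 : ZMod 2) else 0) * x (.check t c') =
        (if t = endLayer N σ then if c' = c then x (.check t c') else 0 else 0) := by
      intro t c'
      by_cases h1 : c' = c <;> by_cases h2 : t = endLayer N σ <;> simp_all
    simp only [this]
    rw [Finset.sum_comm]; simp
  · simp [ite_mul]

/-- The layer of a qubit, up to one. -/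
def SV.time : SV N n m → ℕ
  | .code t _ => t
  | .check t _ => t
  | .surf σ _ => if σ then N else 0

/-- Every row is local in time: a meta-check meets one code layer and the check layers on both
sides, a surface check meets one surface and the check layer next to it. With `Rooted.lt_card` this
bounds from below the size of a cluster that crosses the sector. -/
theorem SV.time_le_of_rowAdj (H : Matrix (Fin m) (Fin n) (ZMod 2)) (u v : SV N n m)
    (h : rowAdj (sectorMatrix N H) u v) : v.time ≤ u.time + 1 := by
  obtain ⟨⟨g, c⟩, h1, h2⟩ := h
  cases g with
  | inl s =>
    cases u <;> cases v <;>
      simp only [sectorMatrix, ne_eq, ite_eq_right_iff, Classical.not_imp, not_true_eq_false,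
        one_ne_zero, not_false_eq_true, and_true] at h1 h2 <;>
      simp only [SV.time]
    · simp [h1.1, h2.1]
    · obtain ⟨-, rfl | rfl⟩ := h2 <;> simp [h1.1]
    · obtain ⟨-, rfl | rfl⟩ := h1 <;> simp [h2.1]; omega
    · obtain ⟨-, rfl | rfl⟩ := h1 <;> obtain ⟨-, rfl | rfl⟩ := h2 <;> simp; omega
  | inr σ =>
    cases u <;> cases v <;>
      simp only [sectorMatrix, ne_eq, ite_eq_right_iff, Classical.not_imp, not_true_eq_false,
        one_ne_zero, not_false_eq_true, and_true] at h1 h2 <;>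
      simp only [SV.time]
    · simp [h1.2, h2.2]
    · cases σ <;> simp [h1.2, h2.1, endLayer]
    · cases σ <;> simp [h1.1, h2.2, endLayer]
    · simp [h1.1, h2.1]

/-- `x` is the sum of the `Z` part `η` of a bulk error and a minimum-weight correction, and `e` is
a minimum-weight operator on the two surfaces with the residual syndrome. -/
structure IsSectorDecoding (H : Matrix (Fin m) (Fin n) (ZMod 2)) (x : SV N n m → ZMod 2)
    (e : Bool × Fin n → ZMod 2) (η : Finset (SV N n m)) : Prop where
  surf : ∀ σ i, x (.surf σ i) = 0
  meta_eq_zero : ∀ s c, (sectorMatrix N H *ᵥ x) (.inl s, c) = 0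
  min : ∀ ξ, IsPart ξ x → (∀ s c, (sectorMatrix N H *ᵥ ξ) (.inl s, c) = 0) →
    (vsupp ξ).card ≤ 2 * (vsupp ξ ∩ η).card
  surf_syndrome : ∀ σ c, ∑ i, H c i * e (σ, i) = x (.check (endLayer N σ) c)
  surf_min : ∀ e' : Bool × Fin n → ZMod 2, (∀ σ c, ∑ i, H c i * e' (σ, i) = x (.check (endLayer N σ) c)) →
    hammingNorm e ≤ hammingNorm e'

/-- The bulk vector `x` together with the vector `e` on the surfaces. -/
def withSurf (x : SV N n m → ZMod 2) (e : Bool × Fin n → ZMod 2) : SV N n m → ZMod 2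
  | .code t i => x (.code t i)
  | .check t c => x (.check t c)
  | .surf σ i => e (σ, i)

/-- The sum of all code layers and of the surfaces. -/
def layerSum (y : SV N n m → ZMod 2) : Fin n → ZMod 2 :=
  fun i => ∑ t, y (.code t i) + (y (.surf false i) + y (.surf true i))

theorem layerSum_add (y z : SV N n m → ZMod 2) : layerSum (y + z) = layerSum y + layerSum z := by
  funext i
  simp only [layerSum, Pi.add_apply, Finset.sum_add_distrib]
  ring

/-- The column of a code qubit. -/
def SV.codeColumn : SV N n m → Option (Fin n)
  | .code _ i => some i
  | _ => none

/-- Projecting the code layers onto a single copy of the code can only cancel entries, never create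
them. -/
theorem hammingNorm_sum_code_le (κ : SV N n m → ZMod 2) :
    hammingNorm (fun i => ∑ t, κ (.code t i)) ≤
      (vsupp (withSurf κ 0)).card := by
  classical
  rw [hammingNorm_eq_card_vsupp, ← Finset.card_map Function.Embedding.some]
  refine (Finset.card_le_card ?_).trans (Finset.card_image_le (f := SV.codeColumn))
  intro o ho
  obtain ⟨i, hi, rfl⟩ := Finset.mem_map.1 ho
  obtain ⟨t, -, ht⟩ := Finset.exists_ne_zero_of_sum_ne_zero
    (mem_vsupp (x := fun i => ∑ t, κ (.code t i)).1 hi)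
  exact Finset.mem_image.2 ⟨.code t i, mem_vsupp.2 ht, rfl⟩

theorem card_vsupp_withSurf (κ : SV N n m → ZMod 2) :
    (vsupp κ).card = (vsupp (withSurf κ 0)).card + hammingNorm fun q : Bool × Fin n => κ (.surf q.1 q.2) := by
  classical
  let φ : Bool × Fin n ↪ SV N n m := ⟨fun q => .surf q.1 q.2, by
    rintro ⟨a, b⟩ ⟨c, d⟩ h
    simpa using h⟩
  rw [hammingNorm_eq_card_vsupp, ← Finset.card_map φ, ← Finset.card_union_of_disjoint]
  · congr 1
    ext v
    simp only [Finset.mem_union, mem_vsupp, Finset.mem_map]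
    cases v with
    | code t i => simp [withSurf, φ]
    | check t i => simp [withSurf, φ]
    | surf σ i =>
      constructor
      · exact fun h => .inr ⟨(σ, i), h, rfl⟩
      · rintro (h | ⟨q, h, hq⟩)
        · exact absurd rfl h
        · rw [← hq]; exact h
  · rw [Finset.disjoint_left]
    rintro v hv hv'
    obtain ⟨q, -, rfl⟩ := Finset.mem_map.1 hv'
    exact mem_vsupp.1 hv rfl

namespace IsSectorDecoding

variable {H : Matrix (Fin m) (Fin n) (ZMod 2)} {x : SV N n m → ZMod 2}
  {e : Bool × Fin n → ZMod 2} {η : Finset (SV N n m)}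

/-- The meta-check equations of a fixed row telescope: modulo 2 every inner check layer occurs
twice, and only the first and the last survive. -/
theorem sum_row_code (κ : SV N n m → ZMod 2)
    (hκ : ∀ s c, (sectorMatrix N H *ᵥ κ) (.inl s, c) = 0) (c : Fin m) :
    ∑ i, H c i * ∑ t, κ (.code t i) = κ (.check 0 c) + κ (.check (Fin.last N) c) := by
  have h1 : ∑ s : Fin N, (∑ i, H c i * κ (.code s i) +
      (κ (.check s.castSucc c) + κ (.check s.succ c))) = 0 :=
    Finset.sum_eq_zero fun s _ => by rw [← sectorMatrix_mulVec_inl, hκ]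
  have h2 := Fin.sum_univ_succ fun t => κ (.check t c)
  have h3 := Fin.sum_univ_castSucc fun t => κ (.check t c)
  rw [Finset.sum_add_distrib, Finset.sum_add_distrib, Finset.sum_comm] at h1
  simp only [← Finset.mul_sum] at h1
  have h4 : κ (.check 0 c) + ∑ s : Fin N, κ (.check s.succ c) =
    ∑ s : Fin N, κ (.check s.castSucc c) + κ (.check (Fin.last N) c) := by rw [← h2, ← h3]
  generalize ∑ s : Fin N, κ (.check s.succ c) = a at *
  generalize ∑ s : Fin N, κ (.check s.castSucc c) = b at *
  generalize ∑ i, H c i * ∑ t, κ (.code t i) = d at *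
  generalize κ (.check 0 c) = f at *
  generalize κ (.check (Fin.last N) c) = g at *
  clear h2 h3
  revert a b d f g
  decide

/-- The two surface syndromes cancel the end terms left by the telescoping sum. This is why the
residue of a sector is a logical operator, whether or not decoding succeeds. -/
theorem mulVec_layerSum (κ : SV N n m → ZMod 2) (hM : sectorMatrix N H *ᵥ κ = 0) :
    H *ᵥ layerSum κ = 0 := by
  funext c
  have e1 := sum_row_code κ (fun s c => congrFun hM (.inl s, c)) c
  have e2 := congrFun hM (.inr false, c)
  have e3 := congrFun hM (.inr true, c)
  rw [sectorMatrix_mulVec_inr] at e2 e3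
  change ∑ i, H c i * (∑ t, κ (.code t i) + (κ (.surf false i) + κ (.surf true i))) = 0
  simp only [mul_add, Finset.sum_add_distrib]
  simp only [endLayer, if_true, Bool.false_eq_true, if_false, Pi.zero_apply] at e2 e3
  rw [e1, ← CharTwo.add_eq_zero.1 e2, ← CharTwo.add_eq_zero.1 e3, zmod2_add_self]

/-- The residual on the surfaces closes the syndrome that `x` leaves open at its two end layers of
checks. -/
theorem mulVec_withSurf {x : SV N n m → ZMod 2} {e : Bool × Fin n → ZMod 2}
    (hx : ∀ s c, (sectorMatrix N H *ᵥ x) (.inl s, c) = 0)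
    (he : ∀ σ c, ∑ i, H c i * e (σ, i) = x (.check (endLayer N σ) c)) :
    sectorMatrix N H *ᵥ withSurf x e = 0 := by
  funext ⟨g, c⟩
  cases g with
  | inl s =>
    have := hx s c
    rw [sectorMatrix_mulVec_inl] at this ⊢
    exact this
  | inr σ =>
    rw [sectorMatrix_mulVec_inr]
    change x _ + ∑ i, H c i * e (σ, i) = 0
    rw [he, zmod2_add_self]

/-- Minimality of the correction on the surface `σ`. -/
theorem part_bounds (h : IsSectorDecoding H x e η) (σ : Bool) (κ : SV N n m → ZMod 2)
    (hκ : IsPart κ (withSurf x e)) (hM : sectorMatrix N H *ᵥ κ = 0)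
    (hσ : ∀ i, κ (.surf (!σ) i) = 0) :
    hammingNorm (fun q : Bool × Fin n => κ (.surf q.1 q.2)) ≤ 2 * (vsupp κ ∩ η).card ∧
    (vsupp κ).card ≤ 4 * (vsupp κ ∩ η).card ∧ hammingNorm (layerSum κ) ≤ (vsupp κ).card := by
  set k : Bool × Fin n → ZMod 2 := fun q => κ (.surf q.1 q.2) with hk
  set f : Fin n → ZMod 2 := fun i => ∑ t, κ (.code t i) with hf
  set f' : Bool × Fin n → ZMod 2 := fun q => if q.1 = σ then f q.2 else 0 with hf'
  -- Meta-checks do not see the surfaces, so dropping the surface part of `κ` leaves a competitor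
  -- for the bulk correction.
  have hbulk : (vsupp (withSurf κ 0)).card ≤ 2 * (vsupp (withSurf κ 0) ∩ η).card := by
    refine h.min _ ?_ fun s c => ?_
    · rintro (⟨t, i⟩ | ⟨t, c⟩ | ⟨τ, i⟩)
      · exact hκ (.code t i)
      · exact hκ (.check t c)
      · exact .inl rfl
    · have := congrFun hM (.inl s, c)
      rw [sectorMatrix_mulVec_inl] at this ⊢
      exact this
  have hsub : vsupp (withSurf κ 0) ⊆ vsupp κ := by
    refine IsPart.vsupp_subset ?_
    rintro (⟨t, i⟩ | ⟨t, c⟩ | ⟨τ, i⟩)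
    · exact .inr rfl
    · exact .inr rfl
    · exact .inl rfl
  have hbulk' : (vsupp (withSurf κ 0)).card ≤ 2 * (vsupp κ ∩ η).card :=
    hbulk.trans (Nat.mul_le_mul_left _ (Finset.card_le_card (Finset.inter_subset_inter_right hsub)))
  have hke : IsPart k e := fun q => hκ (.surf q.1 q.2)
  have hff : hammingNorm f' ≤ hammingNorm f := by
    rw [hammingNorm_eq_card_vsupp, hammingNorm_eq_card_vsupp,
      ← Finset.card_map (s := vsupp f) ⟨fun i => (σ, i), fun a b hab => by simpa using hab⟩]
    refine Finset.card_le_card fun q hq => ?_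
    rw [mem_vsupp] at hq
    simp only [hf'] at hq
    split_ifs at hq with h1
    · exact Finset.mem_map.2 ⟨q.2, mem_vsupp.2 hq, by simp [← h1]⟩
    · exact absurd rfl hq
  -- In `e`, replace the surface part `k` of `κ` by the projection `f` of its code layers. Both have
  -- the same syndrome: `κ` vanishes on the other surface, so the telescoping sum has only the end
  -- term at `σ`. Minimality of `e` then gives `|k| ≤ |f|`.
  have hkf : hammingNorm k ≤ hammingNorm f := by
    have h1 := h.surf_min (e + k + f') fun τ c => by
      simp only [Pi.add_apply, mul_add, Finset.sum_add_distrib, h.surf_syndrome]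
      suffices h2 : ∑ i, H c i * k (τ, i) + ∑ i, H c i * f' (τ, i) = 0 by
        rw [add_assoc, h2, add_zero]
      have hr : ∀ τ', ∑ i, H c i * k (τ', i) = κ (.check (endLayer N τ') c) := by
        intro τ'
        have := congrFun hM (.inr τ', c)
        rw [sectorMatrix_mulVec_inr] at this
        exact (CharTwo.add_eq_zero.1 this).symm
      have h0 : ∑ i, H c i * k (!σ, i) = 0 := Finset.sum_eq_zero fun i _ => by
        rw [hk]; simp only; rw [hσ, mul_zero]
      have hsum := sum_row_code κ (fun s c => congrFun hM (.inl s, c)) c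
      by_cases hτ : τ = σ
      · subst hτ
        have : ∑ i, H c i * f' (τ, i) = ∑ i, H c i * f i := by simp [hf']
        rw [this]
        change _ + ∑ i, H c i * ∑ t, κ (.code t i) = 0
        rw [hsum]
        have e1 := hr false
        have e2 := hr true
        simp only [endLayer, if_true, Bool.false_eq_true, if_false] at e1 e2
        rw [← e1, ← e2]
        cases τ
        · rw [Bool.not_false] at h0
          rw [h0, add_zero, zmod2_add_self]
        · rw [Bool.not_true] at h0
          rw [h0, zero_add, zmod2_add_self]
      · have : τ = !σ := by cases τ <;> cases σ <;> simp_all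
        subst this
        rw [h0, zero_add]
        refine Finset.sum_eq_zero fun i _ => ?_
        simp [hf']
    have h2 := hke.hammingNorm_add
    have h3 := hammingNorm_add_le (e + k) f'
    omega
  have hfb : hammingNorm f ≤ (vsupp (withSurf κ 0)).card := hammingNorm_sum_code_le κ
  have hcard : (vsupp κ).card = (vsupp (withSurf κ 0)).card + hammingNorm k :=
    card_vsupp_withSurf κ
  refine ⟨by omega, by omega, ?_⟩
  have hl : layerSum κ = f + fun i => κ (.surf σ i) := by
    funext i
    have := hσ i
    cases σ <;> simp_all [layerSum]
  have hkσ : hammingNorm (fun i => κ (.surf σ i)) ≤ hammingNorm k := by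
    rw [hammingNorm_eq_card_vsupp, hammingNorm_eq_card_vsupp]
    refine Finset.card_le_card_of_injOn (fun i => (σ, i)) (fun i hi => ?_) fun a _ b _ hab => by simpa using hab
    simpa [hk] using hi
  rw [hl]
  have := hammingNorm_add_le f fun i => κ (.surf σ i)
  omega

/-- The main deterministic statement on a sector. If there is no connected set of at least `d₀`
qubits a quarter of which lie in `η`, then the residual operator is correct up to stabilizers, and
it is covered by connected sets a large part of which lies in `η`. -/
theorem decode (h : IsSectorDecoding H x e η) (d₀ : ℕ) (hd₀ : d₀ ≤ N + 1)
    (Stab : Submodule (ZMod 2) (Fin n → ZMod 2))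
    (hStab : ∀ y, H *ᵥ y = 0 → hammingNorm y < d₀ → y ∈ Stab)
    (hη : ∀ v U, Rooted (rowAdj (sectorMatrix N H)) {v} U → U.card ≤ 4 * (U ∩ η).card → U.card < d₀) :
    layerSum (withSurf x e) ∈ Stab ∧
    ∀ S : Finset (Bool × Fin n), S ⊆ vsupp e → ∃ U,
      Rooted (rowAdj (sectorMatrix N H)) (S.image fun q => .surf q.1 q.2) U ∧
      U.card ≤ 4 * (U ∩ η).card ∧ S.card ≤ 2 * (U ∩ η).card := by
  set M := sectorMatrix N H with hM
  -- the clusters of `x` that meet the first layer of checks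
  set S₀ : Finset (SV N n m) := (vsupp x).filter fun v => ∃ c, v = .check 0 c with hS₀
  have hS₀x : S₀ ⊆ vsupp x := Finset.filter_subset _ _
  set xf := restr x (cluster M x S₀) with hxf
  have hxfx : IsPart xf x := isPart_restr _ _
  have hxf0 : ∀ c, xf (.check 0 c) = x (.check 0 c) := by
    intro c
    by_cases hc : x (.check 0 c) = 0
    · rw [hc]; rcases hxfx (.check 0 c) with h1 | h1
      · exact h1
      · rw [h1, hc]
    · exact restr_of_mem (subset_cluster M x S₀ (Finset.mem_filter.2 ⟨mem_vsupp.2 hc, c, rfl⟩))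
  -- A cluster from check layer `0` to check layer `N` takes all `N + 1` times, hence has more than
  -- `N` qubits; but its size is below `d₀ ≤ N + 1`. So no cluster of `x` joins the two ends.
  have hxfN : ∀ c, xf (.check (Fin.last N) c) = 0 := by
    intro c
    by_contra hc
    have hmem : SV.check (Fin.last N) c ∈ cluster M x S₀ := by
      by_contra hn
      exact hc (restr_of_notMem hn)
    obtain ⟨s, hs, hsv⟩ := mem_cluster.1 hmem
    have hsx : {s} ⊆ vsupp x := Finset.singleton_subset_iff.2 (hS₀x hs)
    have hroot := rooted_cluster M x {s}
    have hb := h.min (restr x (cluster M x {s})) (isPart_restr _ _) fun t c =>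
      mulVec_restr_cluster (h.meta_eq_zero t c)
    rw [vsupp_restr (cluster_subset hsx)] at hb
    have h1 := hη s _ hroot (by omega)
    have h2 := hroot.lt_card (v := .check (Fin.last N) c)
      (mem_cluster.2 ⟨s, Finset.mem_singleton_self s, hsv⟩) SV.time
      (SV.time_le_of_rowAdj H) (by
        obtain ⟨c', rfl⟩ := (Finset.mem_filter.1 hs).2
        simp [SV.time])
    simp only [SV.time, Fin.val_last] at h2
    omega
  -- splitting the error between the two surfaces
  set Y : Bool → SV N n m → ZMod 2 := fun σ =>
    withSurf (if σ then x + xf else xf) fun q => if q.1 = σ then e q else 0 with hY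
  have hYpart : ∀ σ, IsPart (Y σ) (withSurf x e) := by
    intro σ
    have hb : IsPart (if σ then x + xf else xf) x := by
      cases σ
      · exact hxfx
      · exact hxfx.sub
    rintro (⟨t, i⟩ | ⟨t, c⟩ | ⟨τ, i⟩)
    · exact hb _
    · exact hb _
    · simp only [hY, withSurf]
      split_ifs <;> simp
  -- Each half vanishes on the opposite surface, which is the hypothesis under which `part_bounds`
  -- applies to its clusters.
  have hYsurf : ∀ σ i, Y σ (.surf (!σ) i) = 0 := by
    intro σ i
    simp [hY, withSurf]
  have hYM : ∀ σ, M *ᵥ Y σ = 0 := by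
    intro σ
    have hinl : ∀ t c, (M *ᵥ (if σ then x + xf else xf)) (.inl t, c) = 0 := by
      intro t c
      have h1 : (M *ᵥ xf) (.inl t, c) = 0 := mulVec_restr_cluster (h.meta_eq_zero t c)
      cases σ
      · exact h1
      · simp only [if_true, Matrix.mulVec_add, Pi.add_apply]
        rw [h1, h.meta_eq_zero, add_zero]
    funext ⟨g, c⟩
    cases g with
    | inl t =>
      have := hinl t c
      rw [hM, sectorMatrix_mulVec_inl] at this ⊢
      exact this
    | inr τ =>
      rw [hM, sectorMatrix_mulVec_inr]
      simp only [hY, withSurf]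
      have hs := h.surf_syndrome τ c
      cases σ <;> cases τ <;> simp [endLayer] at hs ⊢
      · rw [hs, hxf0, zmod2_add_self]
      · exact hxfN c
      · rw [hxf0, zmod2_add_self]
      · rw [hs, hxfN, add_zero, zmod2_add_self]
  have hsum : withSurf x e = Y false + Y true := by
    funext v
    rcases v with ⟨t, i⟩ | ⟨t, c⟩ | ⟨τ, i⟩
    · simp [hY, withSurf, add_left_comm, zmod2_add_self]
    · simp [hY, withSurf, add_left_comm, zmod2_add_self]
    · cases τ <;> simp [hY, withSurf]
  have hdisj : Disjoint (vsupp (Y false)) (vsupp (Y true)) := by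
    rw [Finset.disjoint_left]
    intro v h1 h2
    rw [mem_vsupp] at h1 h2
    rcases v with ⟨t, i⟩ | ⟨t, c⟩ | ⟨τ, i⟩
    · simp only [hY, withSurf, if_true, Bool.false_eq_true, if_false, Pi.add_apply] at h1 h2
      rcases hxfx (.code t i) with h3 | h3
      · exact h1 h3
      · rw [h3, zmod2_add_self] at h2; exact h2 rfl
    · simp only [hY, withSurf, if_true, Bool.false_eq_true, if_false, Pi.add_apply] at h1 h2
      rcases hxfx (.check t c) with h3 | h3
      · exact h1 h3
      · rw [h3, zmod2_add_self] at h2; exact h2 rfl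
    · cases τ
      · exact h2 (hYsurf true i)
      · exact h1 (hYsurf false i)
  have hpart0 : ∀ {κ : SV N n m → ZMod 2} {σ}, IsPart κ (Y σ) → ∀ i, κ (.surf (!σ) i) = 0 := by
    intro κ σ hκ i
    rcases hκ (.surf (!σ) i) with h1 | h1
    · exact h1
    · rw [h1, hYsurf]
  constructor
  · rw [hsum, layerSum_add]
    -- The layer sum of a cluster lies in `ker H` and weighs at most as much as the cluster, which
    -- has fewer than `d₀` qubits.
    have hall : ∀ σ, layerSum (Y σ) ∈ Stab := by
      intro σ
      refine cluster_induction M (fun y => layerSum y ∈ Stab) (Y σ) (hYM σ) ?_ ?_ ?_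
      · have : layerSum (0 : SV N n m → ZMod 2) = 0 := by funext i; simp [layerSum]
        rw [this]; exact Stab.zero_mem
      · intro y z hy hz
        rw [layerSum_add]; exact Stab.add_mem hy hz
      · intro κ v hκ hMκ hroot
        obtain ⟨-, h2, h3⟩ := h.part_bounds σ κ (hκ.trans (hYpart σ)) hMκ (hpart0 hκ)
        exact hStab _ (mulVec_layerSum κ hMκ) (h3.trans_lt (hη v _ hroot h2))
    exact Stab.add_mem (hall false) (hall true)
  · intro S hS
    let Sσ : Bool → Finset (SV N n m) := fun σ =>
      (S.filter fun q => q.1 = σ).image fun q => .surf q.1 q.2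
    have hSY : ∀ σ, Sσ σ ⊆ vsupp (Y σ) := by
      intro σ v hv
      obtain ⟨q, hq, rfl⟩ := Finset.mem_image.1 hv
      obtain ⟨hq1, hq2⟩ := Finset.mem_filter.1 hq
      have := mem_vsupp.1 (hS hq1)
      rw [mem_vsupp]
      simp only [hY, withSurf, hq2, if_true]
      rwa [← hq2]
    let U : Bool → Finset (SV N n m) := fun σ => cluster M (Y σ) (Sσ σ)
    have hU : ∀ σ, (U σ).card ≤ 4 * (U σ ∩ η).card ∧ (Sσ σ).card ≤ 2 * (U σ ∩ η).card := by
      intro σ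
      have hvs : vsupp (restr (Y σ) (U σ)) = U σ := vsupp_restr (cluster_subset (hSY σ))
      obtain ⟨h1, h2, -⟩ := h.part_bounds σ (restr (Y σ) (U σ))
        ((isPart_restr _ _).trans (hYpart σ))
        (funext fun g => mulVec_restr_cluster (congrFun (hYM σ) g)) (hpart0 (isPart_restr _ _))
      rw [hvs] at h1 h2
      refine ⟨h2, le_trans ?_ h1⟩
      rw [hammingNorm_eq_card_vsupp]
      refine Finset.card_image_le.trans (Finset.card_le_card fun q hq => ?_)
      rw [mem_vsupp]
      have hmem : SV.surf q.1 q.2 ∈ Sσ σ := Finset.mem_image_of_mem _ hq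
      rw [restr_of_mem (subset_cluster M _ _ hmem)]
      exact mem_vsupp.1 (hSY σ hmem)
    -- The two covers lie in disjoint supports, so the errors they contain are counted once and the
    -- bounds for the two surfaces add up.
    have hUd : Disjoint (U false) (U true) :=
      hdisj.mono (cluster_subset (hSY false)) (cluster_subset (hSY true))
    refine ⟨U false ∪ U true, ?_, ?_⟩
    · have : (S.image fun q => (SV.surf q.1 q.2 : SV N n m)) = Sσ false ∪ Sσ true := by
        rw [← Finset.image_union, ← Finset.filter_or]
        congr 1
        ext q
        simp
      rw [this]
      exact (rooted_cluster M _ _).union (rooted_cluster M _ _)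
    · have h1 := hU false
      have h2 := hU true
      have h3 : S.card = (Sσ false).card + (Sσ true).card := by
        have hinj : Function.Injective fun q : Bool × Fin n => (SV.surf q.1 q.2 : SV N n m) := by
          rintro ⟨a, b⟩ ⟨c, d⟩ h
          simpa using h
        rw [Finset.card_image_of_injective _ hinj, Finset.card_image_of_injective _ hinj,
          ← Finset.card_union_of_disjoint, ← Finset.filter_or]
        · congr 1
          ext q
          simp
        · rw [Finset.disjoint_left]
          intro q hq hq'
          have := (Finset.mem_filter.1 hq).2
          have := (Finset.mem_filter.1 hq').2
          simp_all
      rw [Finset.union_inter_distrib_right, Finset.card_union_of_disjoint hUd,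
        Finset.card_union_of_disjoint
          (hUd.mono Finset.inter_subset_left Finset.inter_subset_left)]
      omega

end IsSectorDecoding

/-! ### Sparsity of the sector matrices, and decoding of a single code -/

variable {N n m : ℕ}

theorem hammingNorm_row_sectorMatrix_le (H : Matrix (Fin m) (Fin n) (ZMod 2)) (ℓ : ℕ)
    (hrow : ∀ c, hammingNorm (H.row c) ≤ ℓ) (g : (Fin N ⊕ Bool) × Fin m) :
    hammingNorm ((sectorMatrix N H).row g) ≤ ℓ + 2 := by
  classical
  obtain ⟨g, c⟩ := g
  rw [hammingNorm_eq_card_vsupp]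
  cases g with
  | inl s =>
    have : vsupp ((sectorMatrix N H).row (.inl s, c)) ⊆
        ((vsupp (H.row c)).image fun i => .code s i) ∪ {.check s.castSucc c, .check s.succ c} := by
      intro v hv
      rw [mem_vsupp] at hv
      change sectorMatrix N H (.inl s, c) v ≠ 0 at hv
      cases v with
      | code t i =>
        simp only [sectorMatrix, ne_eq, ite_eq_right_iff, Classical.not_imp] at hv
        exact Finset.mem_union_left _ (Finset.mem_image.2 ⟨i, mem_vsupp.2 hv.2, by rw [hv.1]⟩)
      | check t c' =>
        simp only [sectorMatrix, ne_eq, ite_eq_right_iff, Classical.not_imp] at hv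
        obtain ⟨⟨rfl, rfl | rfl⟩, -⟩ := hv <;> simp
      | surf σ i => exact absurd rfl hv
    refine (Finset.card_le_card this).trans ((Finset.card_union_le _ _).trans ?_)
    exact Nat.add_le_add (Finset.card_image_le.trans (hrow c)) Finset.card_le_two
  | inr σ =>
    have : vsupp ((sectorMatrix N H).row (.inr σ, c)) ⊆
        ((vsupp (H.row c)).image fun i => .surf σ i) ∪ {.check (endLayer N σ) c} := by
      intro v hv
      rw [mem_vsupp] at hv
      change sectorMatrix N H (.inr σ, c) v ≠ 0 at hv
      cases v with
      | code t i => exact absurd rfl hv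
      | check t c' =>
        simp only [sectorMatrix, ne_eq, ite_eq_right_iff, Classical.not_imp] at hv
        obtain ⟨⟨rfl, rfl⟩, -⟩ := hv; simp
      | surf τ i =>
        simp only [sectorMatrix, ne_eq, ite_eq_right_iff, Classical.not_imp] at hv
        exact Finset.mem_union_left _ (Finset.mem_image.2 ⟨i, mem_vsupp.2 hv.2, by rw [hv.1]⟩)
    refine (Finset.card_le_card this).trans ((Finset.card_union_le _ _).trans ?_)
    refine Nat.add_le_add (Finset.card_image_le.trans (hrow c)) ?_
    simp

/-- Code and surface columns repeat columns of `H`. A check qubit lies in at most two meta-checks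
and at most two surface checks, whence the `4`; the bound `ℓ + 4` covers all kinds at once. -/
theorem hammingNorm_col_sectorMatrix_le (H : Matrix (Fin m) (Fin n) (ZMod 2)) (ℓ : ℕ)
    (hcol : ∀ i, hammingNorm (H.col i) ≤ ℓ) (v : SV N n m) :
    hammingNorm ((sectorMatrix N H).col v) ≤ ℓ + 4 := by
  classical
  rw [hammingNorm_eq_card_vsupp]
  cases v with
  | code t i =>
    have : vsupp ((sectorMatrix N H).col (.code t i)) ⊆
        (vsupp (H.col i)).image fun c => (.inl t, c) := by
      rintro ⟨g | g, c⟩ hv <;> rw [mem_vsupp] at hv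
      · change (if t = g then H c i else 0) ≠ 0 at hv
        simp only [ne_eq, ite_eq_right_iff, Classical.not_imp] at hv
        exact Finset.mem_image.2 ⟨c, mem_vsupp.2 hv.2, by rw [hv.1]⟩
      · exact absurd rfl hv
    exact (Finset.card_le_card this).trans (Finset.card_image_le.trans ((hcol i).trans (by omega)))
  | surf σ i =>
    have : vsupp ((sectorMatrix N H).col (.surf σ i)) ⊆
        (vsupp (H.col i)).image fun c => (.inr σ, c) := by
      rintro ⟨g | g, c⟩ hv <;> rw [mem_vsupp] at hv
      · exact absurd rfl hv
      · change (if σ = g then H c i else 0) ≠ 0 at hv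
        simp only [ne_eq, ite_eq_right_iff, Classical.not_imp] at hv
        exact Finset.mem_image.2 ⟨c, mem_vsupp.2 hv.2, by rw [hv.1]⟩
    exact (Finset.card_le_card this).trans (Finset.card_image_le.trans ((hcol i).trans (by omega)))
  | check t c =>
    have : vsupp ((sectorMatrix N H).col (.check t c)) ⊆
        ((Finset.univ.filter fun s : Fin N => s.castSucc = t).image fun s => (.inl s, c)) ∪
        ((Finset.univ.filter fun s : Fin N => s.succ = t).image fun s => (.inl s, c)) ∪
        {(.inr false, c), (.inr true, c)} := by
      rintro ⟨g | g, c'⟩ hv <;> rw [mem_vsupp] at hv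
      · change (if c = c' ∧ (t = g.castSucc ∨ t = g.succ) then (1 : ZMod 2) else 0) ≠ 0 at hv
        simp only [ne_eq, ite_eq_right_iff, Classical.not_imp] at hv
        obtain ⟨⟨rfl, rfl | rfl⟩, -⟩ := hv <;> simp
      · change (if c = c' ∧ t = endLayer N g then (1 : ZMod 2) else 0) ≠ 0 at hv
        simp only [ne_eq, ite_eq_right_iff, Classical.not_imp] at hv
        obtain ⟨⟨rfl, rfl⟩, -⟩ := hv
        cases g <;> simp
    have h1 : ((Finset.univ.filter fun s : Fin N => s.castSucc = t).image
        fun s => ((.inl s, c) : (Fin N ⊕ Bool) × Fin m)).card ≤ 1 := by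
      refine Finset.card_image_le.trans (Finset.card_le_one.2 fun a ha b hb => ?_)
      simp only [Finset.mem_filter, Finset.mem_univ, true_and] at ha hb
      exact Fin.castSucc_injective _ (ha.trans hb.symm)
    have h2 : ((Finset.univ.filter fun s : Fin N => s.succ = t).image
        fun s => ((.inl s, c) : (Fin N ⊕ Bool) × Fin m)).card ≤ 1 := by
      refine Finset.card_image_le.trans (Finset.card_le_one.2 fun a ha b hb => ?_)
      simp only [Finset.mem_filter, Finset.mem_univ, true_and] at ha hb
      exact Fin.succ_injective _ (ha.trans hb.symm)
    have h3 : ({(.inr false, c), (.inr true, c)} : Finset ((Fin N ⊕ Bool) × Fin m)).card ≤ 2 :=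
      Finset.card_le_two
    refine (Finset.card_le_card this).trans ?_
    refine (Finset.card_union_le _ _).trans ?_
    have := Finset.card_union_le
      ((Finset.univ.filter fun s : Fin N => s.castSucc = t).image
        fun s => ((.inl s, c) : (Fin N ⊕ Bool) × Fin m))
      ((Finset.univ.filter fun s : Fin N => s.succ = t).image fun s => (.inl s, c))
    omega

/-- Decoding of a single code: if a minimum-weight correction `y` of `x` fails, there is a large
connected set half of which lies in `x`. -/
theorem exists_rooted_of_add_notMem {G V : Type} [Fintype V] [DecidableEq V]
    (H : Matrix G V (ZMod 2)) (x y : V → ZMod 2) (hxy : H *ᵥ y = H *ᵥ x)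
    (hmin : ∀ y', H *ᵥ y' = H *ᵥ x → hammingNorm y ≤ hammingNorm y') (d₀ : ℕ)
    (Stab : Submodule (ZMod 2) (V → ZMod 2))
    (hStab : ∀ y, H *ᵥ y = 0 → hammingNorm y < d₀ → y ∈ Stab) (hne : x + y ∉ Stab) :
    ∃ v U, Rooted (rowAdj H) {v} U ∧ U.card ≤ 2 * (vsupp x ∩ U).card ∧ d₀ ≤ U.card := by
  by_contra hcon
  push Not at hcon
  refine hne (cluster_induction H (· ∈ Stab) (x + y) ?_ Stab.zero_mem
    (fun _ _ => Stab.add_mem) fun κ v hκ hHκ hroot => ?_)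
  · rw [Matrix.mulVec_add, hxy, vec_add_self]
  · have h1 := card_vsupp_le_of_le hκ (hmin (y + κ) (by rw [Matrix.mulVec_add, hHκ, add_zero, hxy]))
    rw [Finset.inter_comm] at h1
    exact hStab κ hHκ (hcon v _ hroot h1)

/-! ### CSS codes -/

namespace CSSCode

variable {n mx mz : ℕ}

/-- The code with the roles of `X` and `Z` exchanged. -/
def dual (Q : CSSCode n mx mz) : CSSCode n mz mx where
  HX := Q.HZ
  HZ := Q.HX
  fullRankX := Q.fullRankZ
  fullRankZ := Q.fullRankX
  comm := by
    have := congrArg Matrix.transpose Q.comm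
    rwa [Matrix.transpose_mul, Matrix.transpose_transpose, Matrix.transpose_zero] at this

theorem mem_xLogical {Q : CSSCode n mx mz} {y : Fin n → ZMod 2} :
    y ∈ Q.xLogical ↔ Q.HZ *ᵥ y = 0 := by
  rw [xLogical, LinearMap.mem_ker, Matrix.mulVecLin_apply]

theorem mem_zLogical {Q : CSSCode n mx mz} {y : Fin n → ZMod 2} :
    y ∈ Q.zLogical ↔ Q.HX *ᵥ y = 0 := mem_xLogical (Q := Q.dual)

/-- Describing the kernel as an orthogonal complement makes it depend on the stabilizer space only,
so that it is shared by all presentations of the code. -/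
theorem mem_xLogical_iff (Q : CSSCode n mx mz) (y : Fin n → ZMod 2) :
    y ∈ Q.xLogical ↔ ∀ z ∈ Q.zStab, z ⬝ᵥ y = 0 := by
  rw [mem_xLogical]
  constructor
  · intro h z hz
    induction hz using Submodule.span_induction with
    | mem z hz => obtain ⟨c, rfl⟩ := hz; exact congrFun h c
    | zero => exact zero_dotProduct y
    | add a b _ _ ha hb => rw [add_dotProduct, ha, hb, add_zero]
    | smul a b _ hb => rw [smul_dotProduct, hb, smul_zero]
  · intro h
    funext c
    exact h _ (Submodule.subset_span ⟨c, rfl⟩)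

theorem mem_zLogical_iff (Q : CSSCode n mx mz) (y : Fin n → ZMod 2) :
    y ∈ Q.zLogical ↔ ∀ z ∈ Q.xStab, z ⬝ᵥ y = 0 := mem_xLogical_iff Q.dual y

theorem SameCode.xLogical_eq {R Q : CSSCode n mx mz} (h : R.SameCode Q) :
    R.xLogical = Q.xLogical := by
  ext y; rw [mem_xLogical_iff, mem_xLogical_iff, h.2]

theorem SameCode.zLogical_eq {R Q : CSSCode n mx mz} (h : R.SameCode Q) :
    R.zLogical = Q.zLogical := by
  ext y; rw [mem_zLogical_iff, mem_zLogical_iff, h.1]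

theorem row_HX_mem_xStab (Q : CSSCode n mx mz) (c : Fin mx) : Q.HX c ∈ Q.xStab :=
  Submodule.subset_span ⟨c, rfl⟩

theorem HZ_mulVec_row (Q : CSSCode n mx mz) (c : Fin mx) : Q.HZ *ᵥ Q.HX c = 0 := by
  funext z
  have h1 : Q.HX c ⬝ᵥ Q.HZ z = 0 := congrFun (congrFun Q.comm c) z
  change Q.HZ z ⬝ᵥ Q.HX c = 0
  rw [dotProduct_comm, h1]

theorem HX_mulVec_row (Q : CSSCode n mx mz) (c : Fin mz) : Q.HX *ᵥ Q.HZ c = 0 :=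
  HZ_mulVec_row Q.dual c

theorem xStab_le_xLogical (Q : CSSCode n mx mz) : Q.xStab ≤ Q.xLogical := by
  rw [xStab, Submodule.span_le]
  rintro _ ⟨c, rfl⟩
  exact mem_xLogical.2 (HZ_mulVec_row Q c)

theorem zStab_le_zLogical (Q : CSSCode n mx mz) : Q.zStab ≤ Q.zLogical :=
  xStab_le_xLogical Q.dual

/-- Double orthogonality: a functional that vanishes on the kernel of `HX` factors through `HX`, so
the vector representing it is a combination of rows. -/
theorem mem_xStab_of_forall (Q : CSSCode n mx mz) (y : Fin n → ZMod 2)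
    (h : ∀ a ∈ Q.zLogical, a ⬝ᵥ y = 0) : y ∈ Q.xStab := by
  let φ : Module.Dual (ZMod 2) (Fin n → ZMod 2) :=
    { toFun := fun a => a ⬝ᵥ y
      map_add' := fun a b => add_dotProduct a b y
      map_smul' := fun a b => smul_dotProduct a b y }
  have hφ : ∀ a, φ a = a ⬝ᵥ y := fun a => rfl
  have h1 : φ ∈ LinearMap.range Q.HX.mulVecLin.dualMap := by
    rw [LinearMap.range_dualMap_eq_dualAnnihilator_ker, Submodule.mem_dualAnnihilator]
    exact fun a ha => h a ha
  obtain ⟨ψ, hψ⟩ := h1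
  have h2 : y = ∑ c, ψ (Pi.single c 1) • Q.HX.row c := by
    funext i
    have h3 : φ (Pi.single i 1) = y i := by rw [hφ, single_dotProduct, one_mul]
    rw [← h3, ← hψ, LinearMap.dualMap_apply, Matrix.mulVecLin_apply, Matrix.mulVec_single_one,
      LinearMap.pi_apply_eq_sum_univ ψ, Finset.sum_apply]
    refine Finset.sum_congr rfl fun c _ => ?_
    rw [Pi.smul_apply, smul_eq_mul, smul_eq_mul, mul_comm]
    congr 2
    funext j
    rw [Pi.single_apply]
    simp only [eq_comm]
  rw [h2]
  exact Submodule.sum_mem _ fun c _ => Submodule.smul_mem _ _ (row_HX_mem_xStab Q c)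

/-- Full row rank makes every syndrome attainable. The existence of Pauli frames and of residuals
for arbitrary outcomes rests on this. -/
theorem HX_surjective (Q : CSSCode n mx mz) (s : Fin mx → ZMod 2) : ∃ y, Q.HX *ᵥ y = s := by
  have h1 := Q.fullRankX.rank_matrix
  have h2 : LinearMap.range Q.HX.mulVecLin = ⊤ := by
    apply Submodule.eq_top_of_finrank_eq
    rw [Module.finrank_fin_fun]
    rw [Fintype.card_fin] at h1
    exact h1
  obtain ⟨y, hy⟩ := LinearMap.range_eq_top.1 h2 s
  exact ⟨y, hy⟩

theorem HZ_surjective (Q : CSSCode n mx mz) (s : Fin mz → ZMod 2) : ∃ y, Q.HZ *ᵥ y = s :=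
  HX_surjective Q.dual s

theorem finrank_xStab (Q : CSSCode n mx mz) : Module.finrank (ZMod 2) Q.xStab = mx := by
  rw [xStab, finrank_span_eq_card Q.fullRankX, Fintype.card_fin]

theorem mx_le (Q : CSSCode n mx mz) : mx ≤ n := by
  simpa using Q.fullRankX.fintype_card_le_finrank

theorem mz_le (Q : CSSCode n mx mz) : mz ≤ n := mx_le Q.dual

theorem finrank_xLogical (Q : CSSCode n mx mz) : Module.finrank (ZMod 2) Q.xLogical + mz = n := by
  have h1 := Q.HZ.mulVecLin.finrank_range_add_finrank_ker
  have h2 : Module.finrank (ZMod 2) (LinearMap.range Q.HZ.mulVecLin) = mz := by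
    have := Q.fullRankZ.rank_matrix
    rwa [Fintype.card_fin] at this
  rw [h2, Module.finrank_fin_fun] at h1
  rw [xLogical]
  omega

/-- Lift a basis of the quotient `xLogical / xStab`, whose dimension is `n - mx - mz` by rank
counting. -/
theorem exists_isLogicalBasis (Q : CSSCode n mx mz) : ∃ L, Q.IsLogicalBasis L := by
  let W : Submodule (ZMod 2) Q.xLogical := Q.xStab.comap Q.xLogical.subtype
  have hW : Module.finrank (ZMod 2) W = mx := by
    refine Eq.trans ?_ (finrank_xStab Q)
    exact (Submodule.comapSubtypeEquivOfLe Q.xStab_le_xLogical).finrank_eq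
  have hquot : Module.finrank (ZMod 2) (Q.xLogical ⧸ W) = Q.numLogical := by
    have h1 := Submodule.finrank_quotient_add_finrank W
    have h2 := finrank_xLogical Q
    rw [numLogical]
    omega
  let b := Module.finBasisOfFinrankEq (ZMod 2) (Q.xLogical ⧸ W) hquot
  choose l hl using fun j => Submodule.Quotient.mk_surjective W (b j)
  refine ⟨fun j => (l j : Fin n → ZMod 2), fun j => (l j).2, fun y hy => ?_⟩
  have key : ∀ x : Fin Q.numLogical → ZMod 2, y - ∑ j, x j • (l j : Fin n → ZMod 2) ∈ Q.xStab ↔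
      b.equivFun (Submodule.Quotient.mk ⟨y, hy⟩) = x := by
    intro x
    rw [← b.equivFun.symm.injective.eq_iff, LinearEquiv.symm_apply_apply, Module.Basis.equivFun_symm_apply]
    simp only [← hl]
    have : ∑ j, x j • (Submodule.Quotient.mk (l j) : Q.xLogical ⧸ W) =
        Submodule.Quotient.mk (∑ j, x j • l j) := by
      simp only [← Submodule.mkQ_apply, map_sum, map_smul]
    rw [this, Submodule.Quotient.eq, Submodule.mem_comap]
    simp
  exact ⟨_, (key _).2 rfl, fun x hx => ((key x).1 hx).symm⟩

theorem mem_xStab_of_lt_distance (Q : CSSCode n mx mz) {y : Fin n → ZMod 2} (hy : y ∈ Q.xLogical)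
    (hd : (hammingNorm y : ℕ∞) < Q.distance) : y ∈ Q.xStab := by
  by_contra hn
  exact absurd (iInf₂_le y (.inl ⟨hy, hn⟩)) (not_le.2 hd)

theorem mem_zStab_of_lt_distance (Q : CSSCode n mx mz) {y : Fin n → ZMod 2} (hy : y ∈ Q.zLogical)
    (hd : (hammingNorm y : ℕ∞) < Q.distance) : y ∈ Q.zStab := by
  by_contra hn
  exact absurd (iInf₂_le y (.inr ⟨hy, hn⟩)) (not_le.2 hd)

/-- Nontrivial logical operators are nonzero. This makes `min(T,d)` positive, which the choice of
constants needs. -/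
theorem one_le_distance (Q : CSSCode n mx mz) : 1 ≤ Q.distance := by
  refine le_iInf₂ fun y hy => ?_
  have : y ≠ 0 := by
    rintro rfl
    rcases hy with h | h
    · exact h.2 (Submodule.zero_mem _)
    · exact h.2 (Submodule.zero_mem _)
  have := hammingNorm_pos_iff.2 this
  exact_mod_cast this

/-- A linearly independent and sparse family of rows, extracted from a sparse spanning family. -/
theorem exists_sparse_rows {r k ℓ : ℕ} (v : Fin r → Fin n → ZMod 2)
    (hk : Module.finrank (ZMod 2) (Submodule.span (ZMod 2) (Set.range v)) = k)
    (hrow : ∀ j, hammingNorm (v j) ≤ ℓ) (hcol : ∀ i, hammingNorm (fun j => v j i) ≤ ℓ) :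
    ∃ H : Matrix (Fin k) (Fin n) (ZMod 2), LinearIndependent (ZMod 2) H.row ∧
      Submodule.span (ZMod 2) (Set.range H.row) = Submodule.span (ZMod 2) (Set.range v) ∧
      (∀ c, hammingNorm (H.row c) ≤ ℓ) ∧ ∀ i, hammingNorm (H.col i) ≤ ℓ := by
  obtain ⟨κ, a, ha, hspan, hli⟩ := exists_linearIndependent' (ZMod 2) v
  have : Finite κ := Finite.of_injective a ha
  have := Fintype.ofFinite κ
  have hcard : Fintype.card κ = k := by rw [← finrank_span_eq_card hli, hspan, hk]
  let e := (Fintype.equivFinOfCardEq hcard).symm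
  refine ⟨fun c => v (a (e c)), hli.comp e e.injective, ?_, fun c => hrow _, fun i => ?_⟩
  · rw [← hspan]
    congr 1
    exact e.surjective.range_comp (v ∘ a)
  · refine le_trans ?_ (hcol i)
    rw [hammingNorm_eq_card_vsupp, hammingNorm_eq_card_vsupp]
    refine Finset.card_le_card_of_injOn (fun c => a (e c)) (fun c hc => ?_)
      fun b _ c _ hbc => e.injective (ha hbc)
    have hc' : v (a (e c)) i ≠ 0 := (mem_vsupp (x := fun c => v (a (e c)) i)).1 hc
    exact Finset.mem_coe.2 (mem_vsupp (x := fun j => v j i).2 hc')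

/-- The checks may mix `X` and `Z`, but their span is a product, so their `X` parts alone span
`xStab` and their `Z` parts `zStab`. Taking parts and then a linearly independent subfamily
increases no weight. -/
theorem IsLDPC.exists_isSparse {Q : CSSCode n mx mz} {ℓ : ℕ} (h : Q.IsLDPC ℓ) :
    ∃ R : CSSCode n mx mz, R.SameCode Q ∧ R.IsSparse ℓ := by
  obtain ⟨r, chk, hspan, hw, hq⟩ := h
  have hX : Submodule.span (ZMod 2) (Set.range fun j => (chk j).1) = Q.xStab := by
    rw [← Submodule.prod_map_fst Q.xStab Q.zStab, ← hspan, Submodule.map_span, ← Set.range_comp]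
    rfl
  have hZ : Submodule.span (ZMod 2) (Set.range fun j => (chk j).2) = Q.zStab := by
    rw [← Submodule.prod_map_snd Q.xStab Q.zStab, ← hspan, Submodule.map_span, ← Set.range_comp]
    rfl
  obtain ⟨HX, liX, spX, rX, cX⟩ := exists_sparse_rows (fun j => (chk j).1) (by rw [hX, finrank_xStab])
    (ℓ := ℓ) (fun j => le_trans (Finset.card_le_card fun i hi => by simp [supp] at hi ⊢; tauto) (hw j))
    (fun i => le_trans (Finset.card_le_card fun j hj => by simp [supp] at hj ⊢; tauto) (hq i))
  obtain ⟨HZ, liZ, spZ, rZ, cZ⟩ := exists_sparse_rows (k := mz) (fun j => (chk j).2)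
    (by rw [hZ]; exact finrank_xStab Q.dual)
    (ℓ := ℓ) (fun j => le_trans (Finset.card_le_card fun i hi => by simp [supp] at hi ⊢; tauto) (hw j))
    (fun i => le_trans (Finset.card_le_card fun j hj => by simp [supp] at hj ⊢; tauto) (hq i))
  have hcomm : HX * HZᵀ = 0 := by
    ext c z
    have h1 : HX.row c ∈ Q.xStab := by rw [← hX, ← spX]; exact Submodule.subset_span ⟨c, rfl⟩
    have h2 : HZ.row z ∈ Q.zStab := by rw [← hZ, ← spZ]; exact Submodule.subset_span ⟨z, rfl⟩
    exact (mem_zLogical_iff Q _).1 (Q.zStab_le_zLogical h2) _ h1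
  exact ⟨⟨HX, HZ, liX, liZ, hcomm⟩, ⟨spX.trans hX, spZ.trans hZ⟩, rX, rZ, cX, cZ⟩

end CSSCode

/-! ### Pauli operators -/

theorem sgn_zero : sgn 0 = 1 := if_pos rfl

theorem sgn_add (a b : ZMod 2) : sgn (a + b) = sgn a * sgn b := by
  have h : ∀ a : ZMod 2, a = 0 ∨ a = 1 := by decide
  have h1 : (1 : ZMod 2) + 1 = 0 := by decide
  rcases h a with rfl | rfl <;> rcases h b with rfl | rfl <;> simp [sgn, h1]

theorem sgn_mul_self (a : ZMod 2) : sgn a * sgn a = 1 := by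
  rw [← sgn_add, zmod2_add_self, sgn_zero]

theorem sgn_sum {ι : Type} (s : Finset ι) (f : ι → ZMod 2) :
    sgn (∑ i ∈ s, f i) = ∏ i ∈ s, sgn (f i) := by
  classical
  induction s using Finset.induction_on with
  | empty => exact sgn_zero
  | insert a s ha ih => rw [Finset.sum_insert ha, Finset.prod_insert ha, sgn_add, ih]

theorem invSqrtTwo_ne_zero : invSqrtTwo ≠ 0 := by
  unfold invSqrtTwo
  rw [Complex.ofReal_ne_zero]
  positivity

section Act

variable {V : Type} [Fintype V]

theorem act_act (P P' : Pauli V) (ψ : State V) :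
    act P (act P' ψ) = sgn (P.2 ⬝ᵥ P'.1) • act (P + P') ψ := by
  funext x
  simp only [act, Pi.smul_apply, smul_eq_mul, Prod.fst_add, Prod.snd_add]
  rw [← add_assoc, ← mul_assoc, ← mul_assoc, ← sgn_add, ← sgn_add]
  congr 2
  rw [add_dotProduct, dotProduct_add P.2 (x + P.1) P'.1]
  generalize P.2 ⬝ᵥ (x + P.1) = a
  generalize P.2 ⬝ᵥ P'.1 = b
  generalize P'.2 ⬝ᵥ _ = c
  revert a b c
  decide

theorem act_smul (P : Pauli V) (a : ℂ) (ψ : State V) : act P (a • ψ) = a • act P ψ := by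
  funext x
  simp only [act, Pi.smul_apply, smul_eq_mul]
  ring

theorem act_zero_state (P : Pauli V) : act P (0 : State V) = 0 := by
  funext x
  simp [act]

theorem act_zero (ψ : State V) : act 0 ψ = ψ := by
  funext x
  simp [act, sgn_zero]

theorem act_comm (P P' : Pauli V) (ψ : State V) :
    act P (act P' ψ) = sgn (symp P P') • act P' (act P ψ) := by
  rw [act_act, act_act, smul_smul, add_comm P', symp, sgn_add, dotProduct_comm P.1, mul_assoc,
    mul_comm (sgn (P.2 ⬝ᵥ P'.1)), ← mul_assoc, sgn_mul_self, one_mul]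

theorem symp_add_left (P P' g : Pauli V) : symp (P + P') g = symp P g + symp P' g := by
  simp only [symp, Prod.fst_add, Prod.snd_add, add_dotProduct]
  ring

theorem symp_comm (P P' : Pauli V) : symp P P' = symp P' P := by
  rw [symp, symp, dotProduct_comm P.1, dotProduct_comm P.2, add_comm]

end Act

/-! ### The vertices of the alternating Tanner graph -/

namespace Vertex

variable {T n mx mz : ℕ}

/-- The vertices as a sum type. -/
def equivSum : Vertex T n mx mz ≃
    (Fin (2 * T + 1) × Fin n) ⊕ (Fin (T + 1) × Fin mz) ⊕ (Fin T × Fin mx) where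
  toFun
    | .code t i => .inl (t, i)
    | .zcheck t c => .inr (.inl (t, c))
    | .xcheck t c => .inr (.inr (t, c))
  invFun
    | .inl (t, i) => .code t i
    | .inr (.inl (t, c)) => .zcheck t c
    | .inr (.inr (t, c)) => .xcheck t c
  left_inv v := by cases v <;> rfl
  right_inv v := by rcases v with v | v | v <;> rfl

theorem sum_univ {M : Type} [AddCommMonoid M] (f : Vertex T n mx mz → M) :
    ∑ v, f v = (∑ t, ∑ i, f (.code t i)) + ((∑ t, ∑ c, f (.zcheck t c)) + ∑ t, ∑ c, f (.xcheck t c)) := by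
  rw [← equivSum.symm.sum_comp, Fintype.sum_sum_type, Fintype.sum_sum_type,
    Fintype.sum_prod_type, Fintype.sum_prod_type, Fintype.sum_prod_type]
  rfl

theorem card_eq : Fintype.card (Vertex T n mx mz) = (2 * T + 1) * n + ((T + 1) * mz + T * mx) := by
  rw [Fintype.card_congr equivSum]
  simp

theorem toSurface_surfaceVertex (hT : 1 ≤ T) (q : Bool × Fin n) :
    (surfaceVertex T mx mz q).toSurface = some q := by
  obtain ⟨σ, i⟩ := q
  cases σ
  · simp [surfaceVertex, toSurface]
  · simp [surfaceVertex, toSurface]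
    omega

theorem eq_surfaceVertex {v : Vertex T n mx mz} {q : Bool × Fin n} (h : v.toSurface = some q) :
    v = surfaceVertex T mx mz q := by
  cases v with
  | code t i =>
    simp only [toSurface] at h
    split_ifs at h with h1 h2
    · obtain rfl := Option.some.inj h
      simp only [surfaceVertex, Bool.false_eq_true, if_false]
      congr 1
      exact Fin.ext h1
    · obtain rfl := Option.some.inj h
      simp only [surfaceVertex, if_true]
      congr 1
      exact Fin.ext h2
  | zcheck t c => simp [toSurface] at h
  | xcheck t c => simp [toSurface] at h

theorem surfaceVertex_injective (hT : 1 ≤ T) :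
    Function.Injective (surfaceVertex T mx mz : Bool × Fin n → Vertex T n mx mz) := by
  intro q q' h
  have := congrArg toSurface h
  rw [toSurface_surfaceVertex hT, toSurface_surfaceVertex hT] at this
  exact Option.some.inj this

theorem sum_surface_add_sum_bulk {M : Type} [AddCommMonoid M] (hT : 1 ≤ T)
    (f : Vertex T n mx mz → M) :
    ∑ v, f v = ∑ q, f (surfaceVertex T mx mz q) + ∑ b : Bulk T n mx mz, f b := by
  classical
  rw [← Fintype.sum_subtype_add_sum_subtype (fun v : Vertex T n mx mz => v.toSurface = none) f,
    add_comm]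
  congr 1
  symm
  refine Fintype.sum_bijective
    (fun q => ⟨surfaceVertex T mx mz q, by rw [toSurface_surfaceVertex hT]; simp⟩) ⟨?_, ?_⟩ _ _
    fun q => rfl
  · intro q q' h
    exact surfaceVertex_injective hT (Subtype.ext_iff.1 h)
  · rintro ⟨v, hv⟩
    obtain ⟨q, hq⟩ := Option.ne_none_iff_exists'.1 hv
    exact ⟨q, Subtype.ext (eq_surfaceVertex hq).symm⟩

end Vertex

section Glue

variable {T n mx mz : ℕ}

theorem glue_surfaceVertex (hT : 1 ≤ T) (y : Bool × Fin n → ZMod 2)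
    (b : Bulk T n mx mz → ZMod 2) (q : Bool × Fin n) :
    glue y b (surfaceVertex T mx mz q) = y q := by
  unfold glue
  split
  · rename_i q' h
    rw [Vertex.toSurface_surfaceVertex hT] at h
    rw [Option.some.inj h]
  · rename_i h
    rw [Vertex.toSurface_surfaceVertex hT] at h
    simp at h

theorem glue_bulk (y : Bool × Fin n → ZMod 2) (b : Bulk T n mx mz → ZMod 2)
    (v : Bulk T n mx mz) : glue y b v.1 = b v := by
  unfold glue
  split
  · rename_i q' h
    rw [v.2] at h
    simp at h
  · rfl

theorem glue_add (y : Bool × Fin n → ZMod 2) (b : Bulk T n mx mz → ZMod 2)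
    (a : Vertex T n mx mz → ZMod 2) : glue y b + a =
      glue (y + fun q => a (surfaceVertex T mx mz q)) (b + fun v => a v.1) := by
  funext v
  simp only [Pi.add_apply]
  unfold glue
  split
  · rename_i q h
    rw [Pi.add_apply, ← Vertex.eq_surfaceVertex h]
  · rfl

theorem dotProduct_glue (hT : 1 ≤ T) (a : Vertex T n mx mz → ZMod 2)
    (y : Bool × Fin n → ZMod 2) (b : Bulk T n mx mz → ZMod 2) :
    a ⬝ᵥ glue y b = (fun q => a (surfaceVertex T mx mz q)) ⬝ᵥ y + (fun v : Bulk T n mx mz => a v.1) ⬝ᵥ b := by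
  simp only [dotProduct]
  rw [Vertex.sum_surface_add_sum_bulk hT]
  congr 1
  · exact Finset.sum_congr rfl fun q _ => by rw [glue_surfaceVertex hT]
  · exact Finset.sum_congr rfl fun q _ => by rw [glue_bulk]

/-- Measuring the bulk after a Pauli error. -/
theorem measureBulk_act (hT : 1 ≤ T) (s : Bulk T n mx mz → ZMod 2)
    (P : Pauli (Vertex T n mx mz)) (ψ : State (Vertex T n mx mz)) :
    measureBulk s (act P ψ) =
      sgn (s ⬝ᵥ (bulkPart P).1) • act (boundaryPart P) (measureBulk (s + (bulkPart P).2) ψ) := by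
  funext y
  simp only [measureBulk, act, Pi.smul_apply, smul_eq_mul]
  simp only [Finset.mul_sum]
  -- The bulk `X` part translates the summation variable, at the price of a sign from `s`; the bulk
  -- `Z` part is absorbed into the outcome.
  rw [← Equiv.sum_comp (Equiv.addRight (bulkPart P).1)]
  refine Finset.sum_congr rfl fun b _ => ?_
  rw [glue_add, dotProduct_glue hT]
  have h1 : ((Equiv.addRight (bulkPart P).1) b + fun v : Bulk T n mx mz => P.1 v.1) = b := by
    change b + (bulkPart P).1 + (bulkPart P).1 = b
    rw [add_assoc, vec_add_self, add_zero]
  rw [h1]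
  change _ * (sgn (s ⬝ᵥ (b + (bulkPart P).1)) * (sgn ((boundaryPart P).2 ⬝ᵥ (y + (boundaryPart P).1) +
    (bulkPart P).2 ⬝ᵥ b) * ψ (glue (y + (boundaryPart P).1) b))) = _
  rw [dotProduct_add, add_dotProduct, sgn_add, sgn_add, sgn_add]
  ring

end Glue

/-! ### The graph state -/

/-- An asymmetric relation orients every edge exactly once, so a product over edges becomes one over
ordered pairs. -/
theorem prod_edgeFinset_fromRel {V M : Type} [Fintype V] [DecidableEq V] [CommMonoid M]
    (r : V → V → Prop) [DecidableRel r] (hr : ∀ u v, r u v → ¬ r v u)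
    {_ : Fintype (SimpleGraph.fromRel r).edgeSet} (f : Sym2 V → M) :
    ∏ e ∈ (SimpleGraph.fromRel r).edgeFinset, f e =
      ∏ p ∈ Finset.univ.filter fun p : V × V => r p.1 p.2, f s(p.1, p.2) := by
  symm
  refine Finset.prod_nbij (fun p => s(p.1, p.2)) ?_ ?_ ?_ fun _ _ => rfl
  · rintro ⟨u, v⟩ h
    have h' : r u v := (Finset.mem_filter.1 h).2
    rw [SimpleGraph.mem_edgeFinset, SimpleGraph.mem_edgeSet, SimpleGraph.fromRel_adj]
    exact ⟨fun huv : u = v => hr u v h' (huv ▸ huv ▸ h'), .inl h'⟩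
  · rintro ⟨u, v⟩ h ⟨u', v'⟩ h' he
    have h1 : r u v := (Finset.mem_filter.1 (Finset.mem_coe.1 h)).2
    have h2 : r u' v' := (Finset.mem_filter.1 (Finset.mem_coe.1 h')).2
    rcases Sym2.eq_iff.1 he with ⟨h3, h4⟩ | ⟨h3, h4⟩
    · exact Prod.ext h3 h4
    · simp only at h3 h4
      subst h3 h4
      exact absurd h2 (hr _ _ h1)
  · intro e he
    induction e using Sym2.ind with
    | _ u v =>
      rw [Finset.mem_coe, SimpleGraph.mem_edgeFinset, SimpleGraph.mem_edgeSet,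
        SimpleGraph.fromRel_adj] at he
      rcases he.2 with h | h
      · exact ⟨(u, v), by simpa using h, rfl⟩
      · exact ⟨(v, u), by simpa using h, Sym2.eq_swap⟩

section Graph

variable {n mx mz : ℕ} (R : CSSCode n mx mz) (T : ℕ)

/-- The adjacency matrix of the alternating Tanner graph, with the edges oriented from the earlier
to the later layers and from the code qubits to the checks. -/
def atgMatrix : Matrix (Vertex T n mx mz) (Vertex T n mx mz) (ZMod 2) := fun u v =>
  match u, v with
  | .code t i, .code t' j => if i = j ∧ (t' : ℕ) = t + 1 then 1 else 0
  | .code t i, .zcheck t' c => if (t : ℕ) = 2 * t' then R.HZ c i else 0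
  | .code t i, .xcheck t' c => if (t : ℕ) = 2 * t' + 1 then R.HX c i else 0
  | _, _ => 0

theorem atgMatrix_asymm (u v : Vertex T n mx mz) (h : atgMatrix R T u v ≠ 0) :
    ¬ atgMatrix R T v u ≠ 0 := by
  cases u <;> cases v <;> simp [atgMatrix] at h ⊢
  intro h1
  omega

theorem atg_eq_fromRel : atg R T = SimpleGraph.fromRel fun u v => atgMatrix R T u v ≠ 0 := by
  have h1 : ∀ a : ZMod 2, a = 1 ↔ ¬ a = 0 := by decide
  unfold atg
  congr 1
  funext u v
  cases u <;> cases v <;> simp [atgMatrix, Vertex.layer, h1]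

/-- In this form the phase of the graph state is a quadratic form with an oriented adjacency matrix,
and stabilizers become a matter of linear algebra. -/
theorem graphState_atg (x : Vertex T n mx mz → ZMod 2) :
    graphState (atg R T) x =
      invSqrtTwo ^ Fintype.card (Vertex T n mx mz) * sgn (x ⬝ᵥ (atgMatrix R T *ᵥ x)) := by
  classical
  unfold graphState
  congr 1
  rw [atg_eq_fromRel]
  rw [prod_edgeFinset_fromRel _ (atgMatrix_asymm R T)]
  have : x ⬝ᵥ (atgMatrix R T *ᵥ x) =
      ∑ p ∈ Finset.univ.filter fun p : Vertex T n mx mz × Vertex T n mx mz =>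
        atgMatrix R T p.1 p.2 ≠ 0, x p.1 * x p.2 := by
    rw [Finset.sum_filter, Fintype.sum_prod_type]
    simp only [dotProduct, Matrix.mulVec, Finset.mul_sum]
    refine Finset.sum_congr rfl fun u _ => Finset.sum_congr rfl fun v _ => ?_
    split_ifs with h
    · rw [zmod2_eq_one h, one_mul]
    · rw [not_not.1 h, zero_mul, mul_zero]
  rw [this, sgn_sum]
  exact Finset.prod_congr (by ext; simp) fun _ _ => rfl

/-- With `q(x) = x·Mx`, one has `q(x + α) = q(x) + x·(M + Mᵀ)α + q(α)`. The linear term is undone by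
`Z(β)`, and the constant is zero by hypothesis. -/
theorem act_graphState {α β : Vertex T n mx mz → ZMod 2}
    (h1 : atgMatrix R T *ᵥ α + (atgMatrix R T)ᵀ *ᵥ α = β) (h2 : α ⬝ᵥ (atgMatrix R T *ᵥ α) = 0) :
    act (α, β) (graphState (atg R T)) = graphState (atg R T) := by
  funext x
  simp only [act, graphState_atg]
  rw [mul_left_comm, ← sgn_add]
  congr 2
  set M := atgMatrix R T
  have h3 : ∀ a b : Vertex T n mx mz → ZMod 2, (Mᵀ *ᵥ a) ⬝ᵥ b = a ⬝ᵥ (M *ᵥ b) := by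
    intro a b
    rw [Matrix.dotProduct_mulVec, Matrix.mulVec_transpose]
  rw [← h1, Matrix.mulVec_add, add_dotProduct, h3, dotProduct_add, dotProduct_add, add_dotProduct,
    add_dotProduct, Matrix.mulVec_add, dotProduct_add, h2, dotProduct_comm _ α, h2,
    dotProduct_comm _ x]
  generalize x ⬝ᵥ (M *ᵥ α) = a
  generalize α ⬝ᵥ (M *ᵥ x) = b
  generalize x ⬝ᵥ (M *ᵥ x) = c
  revert a b c
  decide

end Graph

/-! ### Stabilizers of the alternating Tanner graph state -/

theorem sum_fin_ite_eq {M : Type} [AddCommMonoid M] (k a : ℕ) (f : ℕ → M) :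
    ∑ t : Fin k, (if (t : ℕ) = a then f t else 0) = if a < k then f a else 0 := by
  rw [Fin.sum_univ_eq_sum_range (fun t => if t = a then f t else 0) k]
  simp

section Layered

variable {n mx mz : ℕ}

/-- The vector on the vertices with the given values on the layers. -/
def layered (T : ℕ) (A : ℕ → Fin n → ZMod 2) (B : ℕ → Fin mz → ZMod 2)
    (C : ℕ → Fin mx → ZMod 2) : Vertex T n mx mz → ZMod 2
  | .code t i => A t i
  | .zcheck t c => B t c
  | .xcheck t c => C t c

variable (R : CSSCode n mx mz) (T : ℕ) (A : ℕ → Fin n → ZMod 2) (B : ℕ → Fin mz → ZMod 2)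
  (C : ℕ → Fin mx → ZMod 2)

/-- Indices start at zero: index `t` is layer `t + 1`, so `Z` checks sit at even `t`. Edges point to
later layers and to checks, so the earlier neighbour appears only in the transpose. -/
theorem atgMatrix_mulVec_code (t : Fin (2 * T + 1)) (i : Fin n) :
    (atgMatrix R T *ᵥ layered T A B C) (.code t i) = (if (t : ℕ) < 2 * T then A (t + 1) i else 0) +
      if Even (t : ℕ) then (R.HZᵀ *ᵥ B (t / 2)) i else (R.HXᵀ *ᵥ C (t / 2)) i := by
  change ∑ v, atgMatrix R T (.code t i) v * layered T A B C v = _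
  rw [Vertex.sum_univ]
  simp only [atgMatrix, layered]
  congr 1
  · have : ∀ (t' : Fin (2 * T + 1)) (j : Fin n),
        (if i = j ∧ (t' : ℕ) = t + 1 then (1 : ZMod 2) else 0) * A t' j =
        if i = j then (if (t' : ℕ) = t + 1 then A t' j else 0) else 0 := by
      intro t' j
      split_ifs <;> simp_all
    simp only [this, Finset.sum_ite_eq, Finset.mem_univ, if_true]
    rw [sum_fin_ite_eq _ _ fun t => A t i]
    simp
  · rw [Finset.sum_comm, Finset.sum_comm (s := (Finset.univ : Finset (Fin T)))]
    simp only [Matrix.mulVec, dotProduct, Matrix.transpose_apply]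
    rcases Nat.even_or_odd (t : ℕ) with he | ho
    · rw [if_pos he]
      have h2 : ∀ (t' : Fin T), ¬ ((t : ℕ) = 2 * t' + 1) := fun t' h => by
        rw [h] at he; exact (Nat.not_even_iff_odd.2 ⟨t', rfl⟩) he
      simp only [h2, if_false, zero_mul, Finset.sum_const_zero, add_zero]
      refine Finset.sum_congr rfl fun c _ => ?_
      have h3 : ∀ t' : Fin (T + 1), (if (t : ℕ) = 2 * t' then R.HZ c i else 0) * B t' c =
          if (t' : ℕ) = t / 2 then R.HZ c i * B t' c else 0 := by
        intro t'
        have h4 : (t : ℕ) = 2 * t' ↔ (t' : ℕ) = t / 2 := by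
          obtain ⟨k, hk⟩ := he; omega
        simp only [h4, ite_mul, zero_mul]
      simp only [h3]
      rw [sum_fin_ite_eq _ _ fun t => R.HZ c i * B t c, if_pos]
      have := t.2
      omega
    · rw [if_neg (Nat.not_even_iff_odd.2 ho)]
      have h2 : ∀ (t' : Fin (T + 1)), ¬ ((t : ℕ) = 2 * t') := fun t' h => by
        rw [h] at ho; exact (Nat.not_even_iff_odd.2 ho) ⟨t', by ring⟩
      simp only [h2, if_false, zero_mul, Finset.sum_const_zero, zero_add]
      refine Finset.sum_congr rfl fun c _ => ?_
      have h3 : ∀ t' : Fin T, (if (t : ℕ) = 2 * t' + 1 then R.HX c i else 0) * C t' c =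
          if (t' : ℕ) = t / 2 then R.HX c i * C t' c else 0 := by
        intro t'
        have h4 : (t : ℕ) = 2 * t' + 1 ↔ (t' : ℕ) = t / 2 := by
          obtain ⟨k, hk⟩ := ho; omega
        simp only [h4, ite_mul, zero_mul]
      simp only [h3]
      rw [sum_fin_ite_eq _ _ fun t => R.HX c i * C t c, if_pos]
      have := t.2
      obtain ⟨k, hk⟩ := ho
      omega

theorem atgMatrix_transpose_mulVec_code (t : Fin (2 * T + 1)) (i : Fin n) :
    ((atgMatrix R T)ᵀ *ᵥ layered T A B C) (.code t i) = if 0 < (t : ℕ) then A (t - 1) i else 0 := by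
  change ∑ v, atgMatrix R T v (.code t i) * layered T A B C v = _
  rw [Vertex.sum_univ]
  simp only [atgMatrix, layered, zero_mul, Finset.sum_const_zero, add_zero]
  have : ∀ (t' : Fin (2 * T + 1)) (j : Fin n),
      (if j = i ∧ (t : ℕ) = t' + 1 then (1 : ZMod 2) else 0) * A t' j =
      if j = i then (if (t' : ℕ) = t - 1 then (if 0 < (t : ℕ) then A t' j else 0) else 0) else 0 := by
    intro t' j
    split_ifs <;> first | omega | simp
  simp only [this, Finset.sum_ite_eq', Finset.mem_univ, if_true]
  rw [sum_fin_ite_eq _ _ fun t' => if 0 < (t : ℕ) then A t' i else 0, if_pos]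
  have := t.2
  omega

theorem atgMatrix_mulVec_zcheck (x : Vertex T n mx mz → ZMod 2) (t : Fin (T + 1)) (c : Fin mz) :
    (atgMatrix R T *ᵥ x) (.zcheck t c) = 0 := by
  change ∑ v, atgMatrix R T (.zcheck t c) v * x v = _
  rw [Vertex.sum_univ]
  simp [atgMatrix]

theorem atgMatrix_mulVec_xcheck (x : Vertex T n mx mz → ZMod 2) (t : Fin T) (c : Fin mx) :
    (atgMatrix R T *ᵥ x) (.xcheck t c) = 0 := by
  change ∑ v, atgMatrix R T (.xcheck t c) v * x v = _
  rw [Vertex.sum_univ]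
  simp [atgMatrix]

theorem atgMatrix_transpose_mulVec_zcheck (t : Fin (T + 1)) (c : Fin mz) :
    ((atgMatrix R T)ᵀ *ᵥ layered T A B C) (.zcheck t c) = (R.HZ *ᵥ A (2 * t)) c := by
  change ∑ v, atgMatrix R T v (.zcheck t c) * layered T A B C v = _
  rw [Vertex.sum_univ, Finset.sum_comm]
  simp only [atgMatrix, layered, zero_mul, Finset.sum_const_zero, add_zero, ite_mul]
  refine Finset.sum_congr rfl fun i _ => ?_
  rw [sum_fin_ite_eq _ _ fun t => R.HZ c i * A t i, if_pos]
  have := t.2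
  omega

theorem atgMatrix_transpose_mulVec_xcheck (t : Fin T) (c : Fin mx) :
    ((atgMatrix R T)ᵀ *ᵥ layered T A B C) (.xcheck t c) = (R.HX *ᵥ A (2 * t + 1)) c := by
  change ∑ v, atgMatrix R T v (.xcheck t c) * layered T A B C v = _
  rw [Vertex.sum_univ, Finset.sum_comm]
  simp only [atgMatrix, layered, zero_mul, Finset.sum_const_zero, add_zero, ite_mul]
  refine Finset.sum_congr rfl fun i _ => ?_
  rw [sum_fin_ite_eq _ _ fun t => R.HX c i * A t i, if_pos]
  have := t.2
  omega

variable {R T A B C}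

/-- The stabilizer of the graph state generated by `X(α)` with `α = layered T A B C`. -/
theorem act_measureBulk_graphState (hT : 1 ≤ T) (hZ : ∀ τ, τ ≤ T → R.HZ *ᵥ A (2 * τ) = 0)
    (hX : ∀ τ, τ < T → R.HX *ᵥ A (2 * τ + 1) = 0) (hA : ∀ t, t < 2 * T → A t ⬝ᵥ A (t + 1) = 0)
    (heven : ∀ τ, 0 < τ → τ < T → A (2 * τ + 1) + A (2 * τ - 1) + R.HZᵀ *ᵥ B τ = 0)
    (hodd : ∀ τ, τ < T → A (2 * τ + 2) + A (2 * τ) + R.HXᵀ *ᵥ C τ = 0)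
    (s : Bulk T n mx mz → ZMod 2) {g : Pauli (Bool × Fin n) × (Bulk T n mx mz → ZMod 2)}
    (hg1 : ∀ i, g.1.1 (false, i) = A 0 i) (hg2 : ∀ i, g.1.1 (true, i) = A (2 * T) i)
    (hg3 : ∀ i, g.1.2 (false, i) = (A 1 + R.HZᵀ *ᵥ B 0) i)
    (hg4 : ∀ i, g.1.2 (true, i) = (A (2 * T - 1) + R.HZᵀ *ᵥ B T) i)
    (hg : ∀ v, g.2 v = layered T A B C v.1) :
    act g.1 (measureBulk s (graphState (atg R T))) =
      sgn (g.2 ⬝ᵥ s) • measureBulk s (graphState (atg R T)) := by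
  set M := atgMatrix R T with hM
  set α := layered T A B C with hα
  -- Consecutive code layers of `α` are orthogonal, and every code layer is annihilated by the
  -- checks attached to it.
  have hq : α ⬝ᵥ (M *ᵥ α) = 0 := by
    rw [dotProduct, Vertex.sum_univ]
    simp only [hM, hα, atgMatrix_mulVec_code, atgMatrix_mulVec_zcheck, atgMatrix_mulVec_xcheck, mul_zero,
      Finset.sum_const_zero, add_zero]
    refine Finset.sum_eq_zero fun t _ => ?_
    change ∑ i, A t i * _ = 0
    simp only [mul_add, Finset.sum_add_distrib]
    have h1 : ∑ i, A t i * (if (t : ℕ) < 2 * T then A (t + 1) i else 0) = 0 := by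
      split_ifs with ht
      · exact hA t ht
      · simp
    rw [h1, zero_add]
    split_ifs with he
    · obtain ⟨τ, hτ⟩ := he
      change A t ⬝ᵥ (R.HZᵀ *ᵥ B (t / 2)) = 0
      have := t.2
      rw [Matrix.dotProduct_mulVec, Matrix.vecMul_transpose, show (t : ℕ) = 2 * τ by omega,
        hZ τ (by omega), zero_dotProduct]
    · obtain ⟨τ, hτ⟩ := Nat.not_even_iff_odd.1 he
      change A t ⬝ᵥ (R.HXᵀ *ᵥ C (t / 2)) = 0
      have := t.2
      rw [Matrix.dotProduct_mulVec, Matrix.vecMul_transpose, hτ,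
        hX τ (by omega), zero_dotProduct]
  have key := measureBulk_act hT s (α, M *ᵥ α + Mᵀ *ᵥ α) (graphState (atg R T))
  rw [act_graphState R T rfl hq] at key
  -- The hypotheses say that all `Z` contributions cancel in the bulk. There only `X(α)` is left,
  -- which the Hadamard measurement turns into the sign of `α·s`.
  have hb : (bulkPart (α, M *ᵥ α + Mᵀ *ᵥ α)).2 = 0 := by
    funext ⟨v, hv⟩
    simp only [bulkPart, Pi.add_apply, Pi.zero_apply]
    cases v with
    | code t i =>
      rw [hM, hα, atgMatrix_mulVec_code, atgMatrix_transpose_mulVec_code]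
      simp only [Vertex.toSurface] at hv
      split_ifs at hv with h1 h2
      have ht := t.2
      rw [if_pos (show (t : ℕ) < 2 * T by omega), if_pos (show 0 < (t : ℕ) by omega)]
      split_ifs with he
      · obtain ⟨τ, hτ⟩ := he
        have := congrFun (heven τ (by omega) (by omega)) i
        rw [show (t : ℕ) = 2 * τ by omega, show 2 * τ / 2 = τ by omega, add_right_comm]
        exact this
      · obtain ⟨τ, hτ⟩ := Nat.not_even_iff_odd.1 he
        have := congrFun (hodd τ (by omega)) i
        rw [hτ, show (2 * τ + 1) / 2 = τ by omega, add_right_comm]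
        exact this
    | zcheck t c =>
      have := t.2
      rw [hM, hα, atgMatrix_mulVec_zcheck, atgMatrix_transpose_mulVec_zcheck, hZ t (by omega)]
      rfl
    | xcheck t c =>
      rw [hM, hα, atgMatrix_mulVec_xcheck, atgMatrix_transpose_mulVec_xcheck, hX t t.2]
      rfl
  have hbd : boundaryPart (α, M *ᵥ α + Mᵀ *ᵥ α) = g.1 := by
    refine Prod.ext (funext fun ⟨σ, i⟩ => ?_) (funext fun ⟨σ, i⟩ => ?_)
    · cases σ
      · exact (hg1 i).symm
      · exact (hg2 i).symm
    · simp only [boundaryPart, surfaceVertex, Pi.add_apply]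
      rw [hM, hα, atgMatrix_mulVec_code, atgMatrix_transpose_mulVec_code]
      cases σ
      · rw [hg3]
        simp
        omega
      · rw [hg4]
        simp only [if_true, Fin.val_last, lt_irrefl, if_false, zero_add]
        rw [if_pos (by simp), if_pos (by omega), add_comm]
        simp
  have hbα : (bulkPart (α, M *ᵥ α + Mᵀ *ᵥ α)).1 = g.2 := funext fun v => (hg v).symm
  rw [hb, hbd, hbα, add_zero] at key
  rw [dotProduct_comm g.2]
  conv_rhs => rw [key]
  rw [smul_smul, sgn_mul_self, one_smul]

end Layered

section Generators

set_option linter.unusedSimpArgs false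
set_option linter.unusedTactic false
set_option linter.unreachableTactic false

variable {n mx mz : ℕ} {R : CSSCode n mx mz} {T : ℕ}

/-- A meta-check is a stabilizer with trivial boundary part. Outcomes with `α·s = 1` therefore have
amplitude zero. -/
theorem measureBulk_eq_sgn_smul (hT : 1 ≤ T) (s α : Bulk T n mx mz → ZMod 2)
    (hα : α ∈ metaChecks R T) : measureBulk s (graphState (atg R T)) =
      sgn (α ⬝ᵥ s) • measureBulk s (graphState (atg R T)) := by
  conv_lhs => rw [← act_zero (measureBulk s (graphState (atg R T)))]
  have hX := R.HX_mulVec_row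
  have hrX : ∀ c, R.HX.row c = R.HX c := fun _ => rfl
  have hrZ : ∀ c, R.HZ.row c = R.HZ c := fun _ => rfl
  have hZ := R.HZ_mulVec_row
  rcases hα with ⟨t, c, rfl⟩ | ⟨t, c, ht, rfl⟩
  · have := t.2
    refine act_measureBulk_graphState (g := (0, zMeta R t c)) hT
      -- The row on one `X` layer produces `Z(HZ c)` on both neighbouring code layers; the check `c`
      -- on each of these `Z` layers cancels it.
      (A := fun τ => if τ = 2 * t + 1 then R.HZ c else 0)
      (B := fun τ => if τ = t ∨ τ = t + 1 then Pi.single c 1 else 0) (C := fun _ => 0)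
      (fun τ hτ => ?_) (fun τ hτ => ?_) (fun τ hτ => ?_) (fun τ h0 hτ => ?_) (fun τ hτ => ?_) s
      (fun i => ?_) (fun i => ?_) (fun i => ?_) (fun i => ?_) fun v => ?_
    case refine_10 =>
      obtain ⟨⟨τ, i⟩ | ⟨τ, c'⟩ | ⟨τ, c'⟩, hv⟩ := v
      · simp only [zMeta, layered]
        split_ifs <;> rfl
      · simp only [zMeta, layered]
        split_ifs <;> simp_all
      · rfl
    all_goals
      (try split_ifs) <;> first
        | (exfalso; omega)
        | (simp [hX, hZ, hrX, hrZ, vec_add_self, zmod2_add_self]; done)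
        | (exfalso; simp_all; done)
  · refine act_measureBulk_graphState (g := (0, xMeta R t c)) hT
      (A := fun τ => if τ = 2 * t + 2 then R.HX c else 0)
      (B := fun _ => 0) (C := fun τ => if τ = t ∨ τ = t + 1 then Pi.single c 1 else 0)
      (fun τ hτ => ?_) (fun τ hτ => ?_) (fun τ hτ => ?_) (fun τ h0 hτ => ?_) (fun τ hτ => ?_) s
      (fun i => ?_) (fun i => ?_) (fun i => ?_) (fun i => ?_) fun v => ?_
    case refine_10 =>
      obtain ⟨⟨τ, i⟩ | ⟨τ, c'⟩ | ⟨τ, c'⟩, hv⟩ := v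
      · simp only [xMeta, layered]
        split_ifs <;> rfl
      · rfl
      · simp only [xMeta, layered]
        split_ifs <;> simp_all
    all_goals
      (try split_ifs) <;> first
        | (exfalso; omega)
        | (simp [hX, hZ, hrX, hrZ, vec_add_self, zmod2_add_self]; done)
        | (exfalso; simp_all; done)

theorem act_bellGenerator (hT : 1 ≤ T) (s : Bulk T n mx mz → ZMod 2)
    (g : Pauli (Bool × Fin n) × (Bulk T n mx mz → ZMod 2)) (hg : g ∈ bellGenerators R T) :
    act g.1 (measureBulk s (graphState (atg R T))) =
      sgn (g.2 ⬝ᵥ s) • measureBulk s (graphState (atg R T)) := by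
  have hX := R.HX_mulVec_row
  have hrX : ∀ c, R.HX.row c = R.HX c := fun _ => rfl
  have hrZ : ∀ c, R.HZ.row c = R.HZ c := fun _ => rfl
  have hZ := R.HZ_mulVec_row
  rcases hg with ⟨σ, c, rfl⟩ | ⟨σ, c, rfl⟩ | ⟨a, ha, rfl⟩ | ⟨a, ha, rfl⟩
  · refine act_measureBulk_graphState hT
      (A := fun _ => 0) (B := fun τ => if τ = (if σ then T else 0) then Pi.single c 1 else 0)
      (C := fun _ => 0)
      (fun τ hτ => ?_) (fun τ hτ => ?_) (fun τ hτ => ?_) (fun τ h0 hτ => ?_) (fun τ hτ => ?_) s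
      (fun i => ?_) (fun i => ?_) (fun i => ?_) (fun i => ?_) fun v => ?_
    case refine_10 =>
      obtain ⟨⟨τ, i⟩ | ⟨τ, c'⟩ | ⟨τ, c'⟩, hv⟩ := v
      · rfl
      · simp only [zBoundary, layered]
        split_ifs <;> simp_all
      · rfl
    all_goals
      cases σ <;> (try simp only [zBoundary, if_true, Bool.false_eq_true, if_false, reduceCtorEq]) <;>
      (try split_ifs) <;> first
        | (exfalso; omega)
        | (simp [hX, hZ, hrX, hrZ, vec_add_self, zmod2_add_self]; done)
        | (exfalso; simp_all; done)
  · refine act_measureBulk_graphState hT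
      -- The row on the end layer produces `Z(HX c)` on the adjacent `X` layer only, where the check
      -- `c` cancels it.
      (A := fun τ => if τ = (if σ then 2 * T else 0) then R.HX c else 0) (B := fun _ => 0)
      (C := fun τ => if τ = (if σ then T - 1 else 0) then Pi.single c 1 else 0)
      (fun τ hτ => ?_) (fun τ hτ => ?_) (fun τ hτ => ?_) (fun τ h0 hτ => ?_) (fun τ hτ => ?_) s
      (fun i => ?_) (fun i => ?_) (fun i => ?_) (fun i => ?_) fun v => ?_
    case refine_10 =>
      obtain ⟨⟨τ, i⟩ | ⟨τ, c'⟩ | ⟨τ, c'⟩, hv⟩ := v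
      · simp only [Vertex.toSurface] at hv
        simp only [xBoundary, layered]
        have h0 : (τ : ℕ) ≠ 0 ∧ (τ : ℕ) ≠ 2 * T := by
          split_ifs at hv
          omega
        cases σ <;> simp [h0]
      · rfl
      · simp only [xBoundary, layered]
        split_ifs <;> simp_all
    all_goals
      cases σ <;> (try simp only [xBoundary, if_true, Bool.false_eq_true, if_false, reduceCtorEq]) <;>
      (try split_ifs) <;> first
        | (exfalso; omega)
        | (simp [hX, hZ, hrX, hrZ, vec_add_self, zmod2_add_self]; done)
        | (exfalso; simp_all; done)
  · have ha' := CSSCode.mem_xLogical.1 ha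
    refine act_measureBulk_graphState hT
      -- No checks are needed: each layer in between has two neighbours carrying `a`, and their
      -- contributions cancel.
      (A := fun τ => if Odd (τ + 1 : ℕ) then a else 0) (B := fun _ => 0) (C := fun _ => 0)
      (fun τ hτ => ?_) (fun τ hτ => ?_) (fun τ hτ => ?_) (fun τ h0 hτ => ?_) (fun τ hτ => ?_) s
      (fun i => ?_) (fun i => ?_) (fun i => ?_) (fun i => ?_) fun v => ?_
    case refine_10 =>
      obtain ⟨⟨τ, i⟩ | ⟨τ, c'⟩ | ⟨τ, c'⟩, hv⟩ := v
      · simp only [xxLogical, layered]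
        split_ifs <;> rfl
      · rfl
      · rfl
    all_goals
      try simp only [xxLogical, Nat.odd_iff]
      (try split_ifs) <;> first
        | (exfalso; omega)
        | simp [ha', vec_add_self, zmod2_add_self]
  · have ha' := CSSCode.mem_zLogical.1 ha
    refine act_measureBulk_graphState hT
      (A := fun τ => if Even (τ + 1 : ℕ) then a else 0) (B := fun _ => 0) (C := fun _ => 0)
      (fun τ hτ => ?_) (fun τ hτ => ?_) (fun τ hτ => ?_) (fun τ h0 hτ => ?_) (fun τ hτ => ?_) s
      (fun i => ?_) (fun i => ?_) (fun i => ?_) (fun i => ?_) fun v => ?_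
    case refine_10 =>
      obtain ⟨⟨τ, i⟩ | ⟨τ, c'⟩ | ⟨τ, c'⟩, hv⟩ := v
      · simp only [zzLogical, layered]
        split_ifs <;> rfl
      · rfl
      · rfl
    all_goals
      try simp only [zzLogical, Nat.even_iff]
      (try split_ifs) <;> first
        | (exfalso; omega)
        | simp [ha', vec_add_self, zmod2_add_self]

end Generators

/-! ### Preparing graph states -/

theorem foldl_cz {V : Type} [DecidableEq V] (l : List (V × V)) (ψ : State V) :
    (l.map fun p => Gate.cz p.1 p.2).foldl (fun φ g => g.apply φ) ψ =
      fun x => (l.map fun p => sgn (x p.1 * x p.2)).prod * ψ x := by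
  induction l generalizing ψ with
  | nil => simp
  | cons p l ih =>
    rw [List.map_cons, List.foldl_cons, ih]
    funext x
    simp only [Gate.apply, List.map_cons, List.prod_cons]
    ring

section Circuit

variable {V : Type} [Fintype V] [DecidableEq V]

/-- The uniform superposition of the bit strings supported on `S`. -/
noncomputable def plusOn (S : Finset V) : State V :=
  open Classical in fun x => if ∀ v ∉ S, x v = 0 then invSqrtTwo ^ S.card else 0

theorem hadamard_plusOn (S : Finset V) (v : V) (hv : v ∉ S) :
    (Gate.hadamard v).apply (plusOn S) = plusOn (insert v S) := by
  funext x
  simp only [Gate.apply, plusOn]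
  have h1 : ¬ ∀ w ∉ S, Function.update x v 1 w = 0 := fun h => by
    have := h v hv
    simp at this
  have h2 : (∀ w ∉ S, Function.update x v 0 w = 0) ↔ ∀ w ∉ insert v S, x w = 0 := by
    constructor
    · intro h w hw
      rw [Finset.mem_insert, not_or] at hw
      have := h w hw.2
      rwa [Function.update_of_ne hw.1] at this
    · intro h w hw
      by_cases hwv : w = v
      · subst hwv; simp
      · rw [Function.update_of_ne hwv]
        exact h w (by simp [hwv, hw])
  rw [if_neg h1, mul_zero, add_zero, Finset.card_insert_of_notMem hv, pow_succ']
  simp only [h2]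
  split_ifs <;> simp

theorem foldl_hadamard (l : List V) (S : Finset V) (hl : l.Nodup) (hS : ∀ v ∈ l, v ∉ S) :
    (l.map Gate.hadamard).foldl (fun φ g => g.apply φ) (plusOn S) = plusOn (S ∪ l.toFinset) := by
  induction l generalizing S with
  | nil => simp
  | cons v l ih =>
    rw [List.map_cons, List.foldl_cons, hadamard_plusOn S v (hS v (by simp)),
      ih _ (List.nodup_cons.1 hl).2]
    · congr 1
      ext w
      simp
    · intro w hw
      have h1 := hS w (by simp [hw])
      have h2 : w ≠ v := fun h => (List.nodup_cons.1 hl).1 (h ▸ hw)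
      simp [h1, h2]

/-- A graph state with a properly coloured edge set is prepared by a layer of Hadamard gates and
one layer of controlled `Z` gates for each colour. -/
theorem exists_circuit {κ : Type} [Fintype κ] [DecidableEq κ] (r : V → V → Prop) [DecidableRel r]
    (hr : ∀ u v, r u v → ¬ r v u) (col : V × V → κ)
    (hcol : ∀ p q : V × V, r p.1 p.2 → r q.1 q.2 → col p = col q →
      (p.1 = q.1 ∨ p.1 = q.2 ∨ p.2 = q.1 ∨ p.2 = q.2) → p = q) :
    ∃ W : Circuit V, W.WellFormed ∧ W.length = Fintype.card κ + 1 ∧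
      W.run (zeroState V) = graphState (SimpleGraph.fromRel r) := by
  let E : κ → Finset (V × V) := fun k => Finset.univ.filter fun p => r p.1 p.2 ∧ col p = k
  let layer : κ → List (Gate V) := fun k => (E k).toList.map fun p => Gate.cz p.1 p.2
  refine ⟨((Finset.univ : Finset V).toList.map Gate.hadamard) ::
    (Finset.univ : Finset κ).toList.map layer, ?_, ?_, ?_⟩
  · intro l hl
    rcases List.mem_cons.1 hl with rfl | hl
    · refine ⟨fun g hg => ?_, ?_⟩
      · obtain ⟨v, -, rfl⟩ := List.mem_map.1 hg
        trivial
      · rw [List.pairwise_map]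
        exact List.Pairwise.imp (fun h => by simpa [Gate.qubits] using h) (Finset.nodup_toList _)
    · obtain ⟨k, -, rfl⟩ := List.mem_map.1 hl
      refine ⟨fun g hg => ?_, ?_⟩
      · obtain ⟨p, hp, rfl⟩ := List.mem_map.1 hg
        have h := (Finset.mem_filter.1 (Finset.mem_toList.1 hp)).2.1
        exact fun heq : p.1 = p.2 => hr _ _ h (by rw [← heq] at h ⊢; exact h)
      · rw [List.pairwise_map]
        refine List.Pairwise.imp_of_mem (fun {p q} hp hq hne => ?_) (Finset.nodup_toList _)
        obtain ⟨hp1, hp2⟩ := (Finset.mem_filter.1 (Finset.mem_toList.1 hp)).2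
        obtain ⟨hq1, hq2⟩ := (Finset.mem_filter.1 (Finset.mem_toList.1 hq)).2
        rw [Set.disjoint_left]
        intro v hv hv'
        refine hne (hcol p q hp1 hq1 (hp2.trans hq2.symm) ?_)
        simp only [Gate.qubits, Set.mem_insert_iff, Set.mem_singleton_iff] at hv hv'
        rcases hv with rfl | rfl <;> rcases hv' with h | h <;> simp [h]
  · simp
  · have hzero : zeroState V = plusOn ∅ := by
      funext x
      simp [zeroState, plusOn, funext_iff]
    rw [Circuit.run, List.flatten_cons, List.foldl_append, hzero,
      foldl_hadamard _ _ (Finset.nodup_toList _) (by simp)]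
    have hlayers : ∀ (ks : List κ) (ψ : State V),
        ((ks.map layer).flatten).foldl (fun φ g => g.apply φ) ψ =
        fun x => (ks.map fun k => ∏ p ∈ E k, sgn (x p.1 * x p.2)).prod * ψ x := by
      intro ks
      induction ks with
      | nil => intro ψ; simp
      | cons k ks ih =>
        intro ψ
        rw [List.map_cons, List.flatten_cons, List.foldl_append, foldl_cz, ih]
        funext x
        simp only [Finset.prod_map_toList, List.map_cons, List.prod_cons]
        ring
    rw [hlayers]
    funext x
    have h1 : plusOn (∅ ∪ ((Finset.univ : Finset V).toList).toFinset) x =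
        invSqrtTwo ^ Fintype.card V := by
      simp [plusOn]
    rw [h1, Finset.prod_map_toList, mul_comm]
    unfold graphState
    congr 1
    rw [prod_edgeFinset_fromRel r hr,
      ← Finset.prod_fiberwise _ col fun p : V × V => Sym2.lift _ s(p.1, p.2)]
    refine Finset.prod_congr rfl fun k _ => ?_
    rw [Finset.filter_filter]
    rfl

end Circuit

theorem exists_injOn_fin {α : Type} (s : Finset α) (ℓ : ℕ) (hℓ : 1 ≤ ℓ) (hs : s.card ≤ ℓ) :
    ∃ f : α → Fin ℓ, Set.InjOn f s := by
  classical
  let f : α → Fin ℓ := fun a => if h : a ∈ s then Fin.castLE hs (s.equivFin ⟨a, h⟩) else ⟨0, hℓ⟩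
  refine ⟨f, fun a ha b hb hab => ?_⟩
  have ha' : a ∈ s := ha
  have hb' : b ∈ s := hb
  simp only [f, dif_pos ha', dif_pos hb'] at hab
  have := s.equivFin.injective (Fin.castLE_injective hs hab)
  exact congrArg Subtype.val this

/-- Code–code edges form paths and need two colours. An edge from `i` to a check `c` is coloured by
the position of `i` in row `c` and that of `c` in column `i`, so edges of one colour share neither
end: `ℓ²` colours for each type of check. With the Hadamard layer the depth is `2ℓ² + 3 ≤ 6ℓ²`. -/
theorem exists_circuit_atg {n mx mz : ℕ} (R : CSSCode n mx mz) (T ℓ : ℕ) (hℓ : 1 ≤ ℓ)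
    (hR : R.IsSparse ℓ) : ∃ W : Circuit (Vertex T n mx mz), W.WellFormed ∧
      W.length ≤ 6 * ℓ ^ 2 ∧ W.run (zeroState (Vertex T n mx mz)) = graphState (atg R T) := by
  classical
  choose fX hfX using fun c => exists_injOn_fin (vsupp (R.HX.row c)) ℓ hℓ (hR.1 c)
  choose fZ hfZ using fun c => exists_injOn_fin (vsupp (R.HZ.row c)) ℓ hℓ (hR.2.1 c)
  choose gX hgX using fun i => exists_injOn_fin (vsupp (R.HX.col i)) ℓ hℓ (hR.2.2.1 i)
  choose gZ hgZ using fun i => exists_injOn_fin (vsupp (R.HZ.col i)) ℓ hℓ (hR.2.2.2 i)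
  let col : Vertex T n mx mz × Vertex T n mx mz →
      Bool ⊕ (Fin ℓ × Fin ℓ) ⊕ (Fin ℓ × Fin ℓ) := fun p =>
    match p with
    | (.code t _, .code _ _) => .inl (decide (Even (t : ℕ)))
    | (.code _ i, .zcheck _ c) => .inr (.inl (fZ c i, gZ i c))
    | (.code _ i, .xcheck _ c) => .inr (.inr (fX c i, gX i c))
    | _ => .inl true
  obtain ⟨W, h1, h2, h3⟩ := exists_circuit (fun u v => atgMatrix R T u v ≠ 0)
    (atgMatrix_asymm R T) col (by
      rintro ⟨u, v⟩ ⟨u', v'⟩ h h' hc hs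
      cases u with
      | zcheck t c => exact absurd rfl h
      | xcheck t c => exact absurd rfl h
      | code t i =>
      cases u' with
      | zcheck t c => exact absurd rfl h'
      | xcheck t c => exact absurd rfl h'
      | code t' i' =>
      cases v with
      | code s j =>
        cases v' with
        | code s' j' =>
          simp only [atgMatrix, ne_eq, ite_eq_right_iff, one_ne_zero, imp_false, not_not] at h h'
          simp only [col, Sum.inl.injEq, decide_eq_decide, Nat.even_iff] at hc
          simp only [Vertex.code.injEq, Fin.ext_iff] at hs
          simp only [Prod.mk.injEq, Vertex.code.injEq, Fin.ext_iff]
          obtain ⟨rfl, h⟩ := h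
          obtain ⟨rfl, h'⟩ := h'
          omega
        | zcheck s' c' => simp [col] at hc
        | xcheck s' c' => simp [col] at hc
      | zcheck s c =>
        cases v' with
        | code s' j' => simp [col] at hc
        | xcheck s' c' => simp [col] at hc
        | zcheck s' c' =>
          simp only [atgMatrix, ne_eq, ite_eq_right_iff, Classical.not_imp] at h h'
          simp only [col, Sum.inr.injEq, Sum.inl.injEq, Prod.mk.injEq] at hc
          simp only [Vertex.code.injEq, Vertex.zcheck.injEq, reduceCtorEq, false_or] at hs
          rcases hs with ⟨rfl, rfl⟩ | ⟨rfl, rfl⟩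
          · obtain rfl := hgZ i (mem_vsupp.2 h.2) (mem_vsupp.2 h'.2) hc.2
            have : s = s' := Fin.ext (by omega)
            rw [this]
          · obtain rfl := hfZ c (mem_vsupp.2 h.2) (mem_vsupp.2 h'.2) hc.1
            have : t = t' := Fin.ext (by omega)
            rw [this]
      | xcheck s c =>
        cases v' with
        | code s' j' => simp [col] at hc
        | zcheck s' c' => simp [col] at hc
        | xcheck s' c' =>
          simp only [atgMatrix, ne_eq, ite_eq_right_iff, Classical.not_imp] at h h'
          simp only [col, Sum.inr.injEq, Prod.mk.injEq] at hc
          simp only [Vertex.code.injEq, Vertex.xcheck.injEq, reduceCtorEq, false_or] at hs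
          rcases hs with ⟨rfl, rfl⟩ | ⟨rfl, rfl⟩
          · obtain rfl := hgX i (mem_vsupp.2 h.2) (mem_vsupp.2 h'.2) hc.2
            have : s = s' := Fin.ext (by omega)
            rw [this]
          · obtain rfl := hfX c (mem_vsupp.2 h.2) (mem_vsupp.2 h'.2) hc.1
            have : t = t' := Fin.ext (by omega)
            rw [this])
  refine ⟨W, h1, ?_, h3.trans (by rw [atg_eq_fromRel])⟩
  rw [h2]
  simp only [Fintype.card_sum, Fintype.card_bool, Fintype.card_prod, Fintype.card_fin]
  nlinarith

theorem card_vertex_le {n mx mz : ℕ} (R : CSSCode n mx mz) (T : ℕ) (hT : 1 ≤ T) :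
    Fintype.card (Vertex T n mx mz) ≤ 6 * (n * T) := by
  rw [Vertex.card_eq]
  have h1 := R.mx_le
  have h2 := R.mz_le
  have h3 : (T + 1) * mz ≤ (T + 1) * n := Nat.mul_le_mul_left _ h2
  have h4 : T * mx ≤ T * n := Nat.mul_le_mul_left _ h1
  nlinarith

/-! ### The encoded Bell state -/

variable {n mx mz : ℕ}

theorem dotProduct_surfaces (u v : Bool × Fin n → ZMod 2) :
    u ⬝ᵥ v = (fun i => u (false, i)) ⬝ᵥ (fun i => v (false, i)) +
      (fun i => u (true, i)) ⬝ᵥ fun i => v (true, i) := by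
  simp only [dotProduct]
  rw [Fintype.sum_prod_type, Fintype.sum_bool, add_comm]

namespace CSSCode

variable {Q : CSSCode n mx mz} {L : Fin Q.numLogical → Fin n → ZMod 2}

theorem IsLogicalBasis.sum_mem (hL : Q.IsLogicalBasis L) (x : Fin Q.numLogical → ZMod 2) :
    ∑ j, x j • L j ∈ Q.xLogical :=
  Submodule.sum_mem _ fun j _ => Submodule.smul_mem _ _ (hL.1 j)

theorem encoded_of_notMem (hL : Q.IsLogicalBasis L) (x : Fin Q.numLogical → ZMod 2)
    {y : Fin n → ZMod 2} (hy : y ∉ Q.xLogical) : Q.encoded L x y = 0 := by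
  refine if_neg fun h => hy ?_
  have := Q.xLogical.add_mem (Q.xStab_le_xLogical h) (hL.sum_mem x)
  rwa [sub_add_cancel] at this

-- Cosets of `xStab` in `xLogical` have unique labels, so at most one term of the sum over `x`
-- contributes. The support no longer mentions the logical basis.
open Classical in
theorem bellState_apply (hL : Q.IsLogicalBasis L) (y : Bool × Fin n → ZMod 2) :
    Q.bellState L y = if (fun i => y (false, i)) ∈ Q.xLogical ∧
      ((fun i => y (false, i)) + fun i => y (true, i)) ∈ Q.xStab
      then invSqrtTwo ^ Q.numLogical * (invSqrtTwo ^ mx * invSqrtTwo ^ mx) else 0 := by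
  unfold bellState
  by_cases hy : (fun i => y (false, i)) ∈ Q.xLogical
  · obtain ⟨x₀, hx₀, hu⟩ := hL.2 _ hy
    rw [Finset.sum_eq_single x₀]
    · have h1 : Q.encoded L x₀ (fun i => y (false, i)) = invSqrtTwo ^ mx := if_pos hx₀
      rw [h1]
      have h2 : (fun i => y (true, i)) - ∑ j, x₀ j • L j ∈ Q.xStab ↔
          ((fun i => y (false, i)) + fun i => y (true, i)) ∈ Q.xStab := by
        have h3 : ((fun i => y (false, i)) + fun i => y (true, i)) =
            ((fun i => y (false, i)) - ∑ j, x₀ j • L j) +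
            ((fun i => y (true, i)) - ∑ j, x₀ j • L j) := by
          have := vec_add_self (∑ j, x₀ j • L j)
          rw [sub_add_sub_comm, this, sub_zero]
        rw [h3, Submodule.add_mem_iff_right _ hx₀]
      simp only [encoded, h2, hy, true_and]
      split_ifs <;> simp
    · intro x _ hx
      have : Q.encoded L x (fun i => y (false, i)) = 0 := if_neg fun h => hx (hu x h)
      rw [this, zero_mul]
    · simp
  · rw [if_neg (fun h => hy h.1)]
    simp [encoded_of_notMem hL _ hy]

open Classical in
theorem encodedPlus_apply (hL : Q.IsLogicalBasis L) (y : Fin n → ZMod 2) :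
    Q.encodedPlus L y =
      if y ∈ Q.xLogical then invSqrtTwo ^ Q.numLogical * invSqrtTwo ^ mx else 0 := by
  unfold encodedPlus
  by_cases hy : y ∈ Q.xLogical
  · obtain ⟨x₀, hx₀, hu⟩ := hL.2 _ hy
    rw [if_pos hy, Finset.sum_eq_single x₀]
    · have h1 : Q.encoded L x₀ y = invSqrtTwo ^ mx := if_pos hx₀
      rw [h1]
    · exact fun x _ hx => if_neg fun h => hx (hu x h)
    · simp
  · simp [encoded_of_notMem hL _ hy, hy]

open Classical in
theorem encodedZero_apply (y : Fin n → ZMod 2) :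
    Q.encodedZero L y = if y ∈ Q.xStab then invSqrtTwo ^ mx else 0 := by
  simp [encodedZero, encoded]

end CSSCode

open CSSCode

theorem eq_zero_of_sgn_mul_eq {a : ZMod 2} {w : ℂ} (h : sgn a * w = w) (hw : w ≠ 0) : a = 0 := by
  by_contra ha
  rw [sgn, if_neg ha, neg_one_mul] at h
  exact hw (self_eq_neg.1 h.symm)

/-- The encoded Bell state is the only state stabilized by the Bell generators. -/
theorem exists_eq_smul_bellState {R Q : CSSCode n mx mz} (hRQ : R.SameCode Q) (T : ℕ)
    {L : Fin Q.numLogical → Fin n → ZMod 2} (hL : Q.IsLogicalBasis L)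
    (φ : State (Bool × Fin n)) (hφ : ∀ g ∈ bellGenerators R T, act g.1 φ = φ) :
    ∃ γ : ℂ, φ = γ • Q.bellState L := by
  classical
  have hZ : ∀ g ∈ bellGenerators R T, g.1.1 = 0 → ∀ y, φ y ≠ 0 → g.1.2 ⬝ᵥ y = 0 := by
    intro g hg h0 y hy
    have := congrFun (hφ g hg) y
    simp only [act, h0, add_zero] at this
    exact eq_zero_of_sgn_mul_eq this hy
  have hX : ∀ g ∈ bellGenerators R T, g.1.2 = 0 → ∀ y, φ (y + g.1.1) = φ y := by
    intro g hg h0 y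
    have := congrFun (hφ g hg) y
    simpa only [act, h0, zero_dotProduct, sgn_zero, one_mul] using this
  -- The `Z`-type generators confine the support; the encoded `Z̄Z̄` put the sum of the two surfaces
  -- into the double orthogonal of `xStab`.
  have hsupp : ∀ y, φ y ≠ 0 → (fun i => y (false, i)) ∈ Q.xLogical ∧
      ((fun i => y (false, i)) + fun i => y (true, i)) ∈ Q.xStab := by
    intro y hy
    constructor
    · rw [← hRQ.xLogical_eq, mem_xLogical]
      funext c
      have := hZ (zBoundary R T false c) (.inl ⟨false, c, rfl⟩) rfl y hy
      rw [dotProduct_surfaces] at this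
      simpa [zBoundary, dotProduct, Matrix.mulVec] using this
    · rw [← hRQ.1]
      refine R.mem_xStab_of_forall _ fun a ha => ?_
      have := hZ (zzLogical T mx mz a) (.inr (.inr (.inr ⟨a, ha, rfl⟩))) rfl y hy
      rw [dotProduct_surfaces] at this
      rw [dotProduct_add]
      exact this
  have hlog : ∀ a ∈ Q.xLogical, ∀ y, φ (y + fun q => a q.2) = φ y := fun a ha y =>
    hX (xxLogical T mx mz a) (.inr (.inr (.inl ⟨a, hRQ.xLogical_eq ▸ ha, rfl⟩))) rfl y
  have hstab : ∀ a ∈ Q.xStab, ∀ y, φ (y + twoSurfaces 0 a) = φ y := by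
    intro a ha
    rw [← hRQ.1] at ha
    induction ha using Submodule.span_induction with
    | mem a ha =>
      obtain ⟨c, rfl⟩ := ha
      intro y
      have := hX (xBoundary R T true c) (.inr (.inl ⟨true, c, rfl⟩)) rfl y
      exact this
    | zero =>
      intro y
      have : (twoSurfaces 0 0 : Bool × Fin n → ZMod 2) = 0 := by
        funext q
        simp [twoSurfaces]
      rw [this, add_zero]
    | add a b _ _ ha hb =>
      intro y
      have : (twoSurfaces 0 (a + b) : Bool × Fin n → ZMod 2) =
          twoSurfaces 0 a + twoSurfaces 0 b := by
        funext q
        simp only [twoSurfaces, Pi.add_apply]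
        split_ifs <;> simp
      rw [this, ← add_assoc, hb, ha]
    | smul k a _ ha =>
      intro y
      rcases eq_or_ne k 0 with rfl | hk
      · have : (twoSurfaces 0 ((0 : ZMod 2) • a) : Bool × Fin n → ZMod 2) = 0 := by
          funext q
          simp [twoSurfaces]
        rw [this, add_zero]
      · rw [zmod2_eq_one hk, one_smul, ha]
  refine ⟨φ 0 / (invSqrtTwo ^ Q.numLogical * (invSqrtTwo ^ mx * invSqrtTwo ^ mx)), ?_⟩
  funext y
  rw [Pi.smul_apply, bellState_apply hL, smul_eq_mul]
  split_ifs with h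
  · have hne := invSqrtTwo_ne_zero
    rw [div_mul_cancel₀ _ (by positivity)]
    -- The `X`-type generators act transitively on the allowed support, so `φ` is constant there
    -- with value `φ 0`.
    have hy : y = 0 + (fun q => y (false, q.2)) +
        twoSurfaces 0 ((fun i => y (false, i)) + fun i => y (true, i)) := by
      funext ⟨σ, i⟩
      cases σ
      · simp [twoSurfaces]
      · simp only [twoSurfaces, if_true, Pi.add_apply, Pi.zero_apply, zero_add]
        rw [← add_assoc, zmod2_add_self, zero_add]
    rw [hy, hstab _ h.2, hlog _ h.1]
  · rw [mul_zero]
    by_contra hy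
    exact h (hsupp y hy)

/-! ### Measuring the second surface -/

theorem twoSurfaces_add (y z : Fin n → ZMod 2) (x : Bool × Fin n → ZMod 2) :
    twoSurfaces y z + x =
      twoSurfaces (y + fun i => x (false, i)) (z + fun i => x (true, i)) := by
  funext ⟨σ, i⟩
  cases σ <;> simp [twoSurfaces]

theorem dotProduct_twoSurfaces (x : Bool × Fin n → ZMod 2) (y z : Fin n → ZMod 2) :
    x ⬝ᵥ twoSurfaces y z = (fun i => x (false, i)) ⬝ᵥ y + (fun i => x (true, i)) ⬝ᵥ z := by
  rw [dotProduct_surfaces]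
  rfl

theorem measureStandard_act (z : Fin n → ZMod 2) (P : Pauli (Bool × Fin n))
    (φ : State (Bool × Fin n)) : ∃ a : ℂ, measureStandard z (act P φ) =
      a • act (onSurface false P) (measureStandard (z + (onSurface true P).1) φ) := by
  refine ⟨sgn ((onSurface true P).2 ⬝ᵥ (z + (onSurface true P).1)), ?_⟩
  funext y
  simp only [measureStandard, act, Pi.smul_apply, smul_eq_mul]
  rw [twoSurfaces_add, dotProduct_twoSurfaces, sgn_add, mul_comm (sgn _) (sgn _), mul_assoc]
  rfl

theorem measureHadamard_act (z : Fin n → ZMod 2) (P : Pauli (Bool × Fin n))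
    (φ : State (Bool × Fin n)) : ∃ a : ℂ, measureHadamard z (act P φ) =
      a • act (onSurface false P) (measureHadamard (z + (onSurface true P).2) φ) := by
  refine ⟨sgn (z ⬝ᵥ (onSurface true P).1), ?_⟩
  funext y
  simp only [measureHadamard, act, Pi.smul_apply, smul_eq_mul, Finset.mul_sum]
  rw [← Equiv.sum_comp (Equiv.addRight (onSurface true P).1)]
  refine Finset.sum_congr rfl fun b _ => ?_
  rw [twoSurfaces_add, dotProduct_twoSurfaces]
  have h1 : ((Equiv.addRight (onSurface true P).1) b + fun i => P.1 (true, i)) = b := by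
    change b + (onSurface true P).1 + (onSurface true P).1 = b
    rw [add_assoc, vec_add_self, add_zero]
  rw [h1]
  change _ * (sgn (z ⬝ᵥ (b + (onSurface true P).1)) * (sgn ((onSurface false P).2 ⬝ᵥ
    (y + (onSurface false P).1) + (onSurface true P).2 ⬝ᵥ b) *
    φ (twoSurfaces (y + (onSurface false P).1) b))) = _
  rw [dotProduct_add, add_dotProduct, sgn_add, sgn_add, sgn_add]
  ring

section Measure

variable {Q : CSSCode n mx mz} {L : Fin Q.numLogical → Fin n → ZMod 2}

/-- Fixing the second string to `w` leaves the coset `w + xStab`, that is `X(w)|0̄⟩`; for `w`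
outside `xLogical` nothing is left. -/
theorem measureStandard_bellState (hL : Q.IsLogicalBasis L) (w : Fin n → ZMod 2) :
    ∃ γ : ℂ, measureStandard w (Q.bellState L) = γ • act (w, 0) (Q.encodedZero L) ∧
      (w ∉ Q.xLogical → γ = 0) := by
  classical
  refine ⟨if w ∈ Q.xLogical then invSqrtTwo ^ Q.numLogical * invSqrtTwo ^ mx else 0, ?_,
    fun h => if_neg h⟩
  funext y
  simp only [measureStandard, bellState_apply hL, act, Pi.smul_apply, smul_eq_mul,
    encodedZero_apply, zero_dotProduct, sgn_zero, one_mul]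
  have h1 : (fun i => twoSurfaces y w (false, i)) = y := rfl
  have h2 : (fun i => twoSurfaces y w (true, i)) = w := rfl
  rw [h1, h2]
  by_cases hyw : y + w ∈ Q.xStab
  · have : y ∈ Q.xLogical ↔ w ∈ Q.xLogical := by
      have h3 := Q.xStab_le_xLogical hyw
      constructor
      · exact fun h => (Submodule.add_mem_iff_right _ h).1 h3
      · exact fun h => (Submodule.add_mem_iff_left _ h).1 h3
    simp only [hyw, this, and_true, if_true]
    split_ifs <;> ring
  · simp [hyw]

/-- For fixed `y` in `xLogical` the second string runs over `y + xStab`. The sum is `sgn (w ⬝ᵥ y)`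
times a character sum over `xStab`, which vanishes unless `w` is orthogonal to `xStab`. -/
theorem measureHadamard_bellState (hL : Q.IsLogicalBasis L) (w : Fin n → ZMod 2) :
    ∃ γ : ℂ, measureHadamard w (Q.bellState L) = γ • act (0, w) (Q.encodedPlus L) ∧
      (w ∉ Q.zLogical → γ = 0) := by
  classical
  set S : ℂ := ∑ r, if r ∈ Q.xStab then sgn (w ⬝ᵥ r) else 0 with hS
  refine ⟨invSqrtTwo ^ n * invSqrtTwo ^ mx * S, ?_, fun hw => ?_⟩
  · funext y
    simp only [measureHadamard, bellState_apply hL, act, Pi.smul_apply, smul_eq_mul,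
      encodedPlus_apply hL, add_zero]
    have h1 : ∀ b, (fun i => twoSurfaces y b (false, i)) = y := fun b => rfl
    have h2 : ∀ b : Fin n → ZMod 2, (fun i => twoSurfaces y b (true, i)) = b := fun b => rfl
    simp only [h1, h2]
    by_cases hy : y ∈ Q.xLogical
    · simp only [hy, true_and, if_true, hS]
      rw [← Equiv.sum_comp (Equiv.addLeft y)]
      simp only [Finset.mul_sum, Finset.sum_mul]
      refine Finset.sum_congr rfl fun r _ => ?_
      rw [Equiv.coe_addLeft, ← add_assoc, vec_add_self, zero_add, dotProduct_add, sgn_add]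
      split_ifs <;> ring
    · simp [hy]
  · rw [mem_zLogical_iff] at hw
    push Not at hw
    obtain ⟨r₀, hr₀, hne⟩ := hw
    -- Translation by `r₀ ∈ xStab` with `w·r₀ = 1` negates the character sum.
    have h1 : S = -S := by
      conv_lhs => rw [hS, ← Equiv.sum_comp (Equiv.addLeft r₀)]
      rw [hS, ← Finset.sum_neg_distrib]
      refine Finset.sum_congr rfl fun r _ => ?_
      rw [Equiv.coe_addLeft, Submodule.add_mem_iff_right _ hr₀, dotProduct_add, sgn_add]
      have : sgn (w ⬝ᵥ r₀) = -1 := if_neg (by rwa [dotProduct_comm])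
      rw [this]
      split_ifs <;> simp
    rw [self_eq_neg.1 h1, mul_zero]

theorem act_encodedZero {w : Fin n → ZMod 2} (hw : w ∈ Q.xStab) :
    act (w, 0) (Q.encodedZero L) = Q.encodedZero L := by
  classical
  funext y
  simp only [act, zero_dotProduct, sgn_zero, one_mul, encodedZero_apply]
  rw [Submodule.add_mem_iff_left _ hw]

theorem act_encodedPlus (hL : Q.IsLogicalBasis L) {w : Fin n → ZMod 2} (hw : w ∈ Q.zStab) :
    act (0, w) (Q.encodedPlus L) = Q.encodedPlus L := by
  classical
  funext y
  simp only [act, add_zero, encodedPlus_apply hL]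
  split_ifs with hy
  · rw [(mem_xLogical_iff Q y).1 hy w hw, sgn_zero, one_mul]
  · rw [mul_zero]

/-- The encoded `|0̄⟩` from the encoded Bell state. -/
theorem correct_measureStandard (hL : Q.IsLogicalBasis L) (e : (Fin n → ZMod 2) → Fin n → ZMod 2)
    (he : ∀ z z', z + z' ∈ Q.xLogical → e z = e z') (P : Pauli (Bool × Fin n))
    (r : Fin n → ZMod 2) (hr : (onSurface true P).1 + e (onSurface true P).1 + r ∈ Q.xStab)
    (z : Fin n → ZMod 2) : ∃ γ : ℂ,
      act (z + e z, 0) (measureStandard z (act P (Q.bellState L))) =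
        γ • act (onSurface false P + (r, 0)) (Q.encodedZero L) := by
  obtain ⟨a, ha⟩ := measureStandard_act z P (Q.bellState L)
  set x := (onSurface true P).1 with hx
  obtain ⟨b, hb, hb0⟩ := measureStandard_bellState hL (z + x)
  rw [ha, hb, act_smul, act_smul, act_smul]
  by_cases hzx : z + x ∈ Q.xLogical
  · have h1 : ((z + e z, 0) : Pauli (Fin n)) + (onSurface false P + (z + x, 0)) =
        (onSurface false P + (r, 0)) + (x + e x + r, 0) := by
      rw [he z x hzx]
      refine Prod.ext (funext fun i => ?_) (by simp)
      simp only [Prod.fst_add, Pi.add_apply]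
      generalize z i = a
      generalize e x i = b
      generalize (onSurface false P).1 i = c
      generalize x i = d
      generalize r i = f
      revert a b c d f
      decide
    have h2 : act ((onSurface false P + (r, 0)) + (x + e x + r, 0)) (Q.encodedZero L) =
        sgn ((onSurface false P + (r, 0)).2 ⬝ᵥ (x + e x + r)) •
          act (onSurface false P + (r, 0)) (Q.encodedZero L) := by
      have h3 := act_act (onSurface false P + (r, 0)) (x + e x + r, 0) (Q.encodedZero L)
      rw [act_encodedZero hr] at h3
      rw [h3, smul_smul, sgn_mul_self, one_smul]
    rw [act_act, act_act, add_assoc, h1, h2, smul_smul, smul_smul, smul_smul, smul_smul]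
    exact ⟨_, rfl⟩
  · rw [hb0 hzx, zero_smul, smul_zero]
    exact ⟨0, (zero_smul _ _).symm⟩

/-- The encoded `|+̄⟩` from the encoded Bell state. -/
theorem correct_measureHadamard (hL : Q.IsLogicalBasis L) (e : (Fin n → ZMod 2) → Fin n → ZMod 2)
    (he : ∀ z z', z + z' ∈ Q.zLogical → e z = e z') (P : Pauli (Bool × Fin n))
    (r : Fin n → ZMod 2) (hr : (onSurface true P).2 + e (onSurface true P).2 + r ∈ Q.zStab)
    (z : Fin n → ZMod 2) : ∃ γ : ℂ,
      act (0, z + e z) (measureHadamard z (act P (Q.bellState L))) =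
        γ • act (onSurface false P + (0, r)) (Q.encodedPlus L) := by
  obtain ⟨a, ha⟩ := measureHadamard_act z P (Q.bellState L)
  set x := (onSurface true P).2 with hx
  obtain ⟨b, hb, hb0⟩ := measureHadamard_bellState hL (z + x)
  rw [ha, hb, act_smul, act_smul, act_smul]
  by_cases hzx : z + x ∈ Q.zLogical
  · have h1 : ((0, z + e z) : Pauli (Fin n)) + (onSurface false P + (0, z + x)) =
        (onSurface false P + (0, r)) + (0, x + e x + r) := by
      rw [he z x hzx]
      refine Prod.ext (by simp) (funext fun i => ?_)
      simp only [Prod.snd_add, Pi.add_apply]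
      generalize z i = a
      generalize e x i = b
      generalize (onSurface false P).2 i = c
      generalize x i = d
      generalize r i = f
      revert a b c d f
      decide
    have h2 : act ((onSurface false P + (0, r)) + (0, x + e x + r)) (Q.encodedPlus L) =
        sgn ((onSurface false P + (0, r)).2 ⬝ᵥ (0 : Fin n → ZMod 2)) •
          act (onSurface false P + (0, r)) (Q.encodedPlus L) := by
      have h3 := act_act (onSurface false P + (0, r)) (0, x + e x + r) (Q.encodedPlus L)
      rw [act_encodedPlus hL hr] at h3
      rw [h3, smul_smul, sgn_mul_self, one_smul]
    rw [act_act, act_act, add_assoc, h1, h2, smul_smul, smul_smul, smul_smul, smul_smul]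
    exact ⟨_, rfl⟩
  · rw [hb0 hzx, zero_smul, smul_zero]
    exact ⟨0, (zero_smul _ _).symm⟩

end Measure

/-! ### The two sectors of the alternating Tanner graph -/

section Sectors

variable {N n mx mz : ℕ}

theorem toSurface_code_of_lt {T : ℕ} {t : ℕ} (h0 : 0 < t) (hT : t < 2 * T) (i : Fin n) :
    (Vertex.code ⟨t, by omega⟩ i : Vertex T n mx mz).toSurface = none := by
  simp only [Vertex.toSurface]
  rw [if_neg (by omega), if_neg (by omega)]

theorem ne_surfaceVertex {T : ℕ} (hT : 1 ≤ T) {v : Vertex T n mx mz} (h : v.toSurface = none)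
    (q : Bool × Fin n) : v ≠ surfaceVertex T mx mz q := by
  rintro rfl
  rw [Vertex.toSurface_surfaceVertex hT] at h
  simp at h

/-- The sector of the `Z` meta-checks. -/
def zEmb (N mx : ℕ) : SV (N + 1) n mz ↪ Vertex (N + 1) n mx mz where
  toFun
    | .code t i => .code ⟨2 * t + 1, by omega⟩ i
    | .check t c => .zcheck t c
    | .surf σ i => surfaceVertex (N + 1) mx mz (σ, i)
  inj' := by
    rintro (⟨t, i⟩ | ⟨t, c⟩ | ⟨σ, i⟩) (⟨t', i'⟩ | ⟨t', c'⟩ | ⟨σ', i'⟩) h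
    · simp only [Vertex.code.injEq, Fin.mk.injEq] at h
      rw [h.2, Fin.ext (show (t : ℕ) = t' by omega)]
    · simp at h
    · exact absurd h (ne_surfaceVertex (by omega) (toSurface_code_of_lt (by omega) (by omega) _) _)
    · simp at h
    · simpa using h
    · simp [surfaceVertex] at h
    · exact absurd h.symm (ne_surfaceVertex (by omega) (toSurface_code_of_lt (by omega) (by omega) _) _)
    · simp [surfaceVertex] at h
    · have := Vertex.surfaceVertex_injective (by omega) h
      simpa using this

/-- The sector of the `X` meta-checks. -/
def xEmb (N mz : ℕ) : SV N n mx ↪ Vertex (N + 1) n mx mz where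
  toFun
    | .code t i => .code ⟨2 * t + 2, by omega⟩ i
    | .check t c => .xcheck t c
    | .surf σ i => surfaceVertex (N + 1) mx mz (σ, i)
  inj' := by
    rintro (⟨t, i⟩ | ⟨t, c⟩ | ⟨σ, i⟩) (⟨t', i'⟩ | ⟨t', c'⟩ | ⟨σ', i'⟩) h
    · simp only [Vertex.code.injEq, Fin.mk.injEq] at h
      rw [h.2, Fin.ext (show (t : ℕ) = t' by omega)]
    · simp at h
    · exact absurd h (ne_surfaceVertex (by omega) (toSurface_code_of_lt (by omega) (by omega) _) _)
    · simp at h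
    · simpa using h
    · simp [surfaceVertex] at h
    · exact absurd h.symm (ne_surfaceVertex (by omega) (toSurface_code_of_lt (by omega) (by omega) _) _)
    · simp [surfaceVertex] at h
    · have := Vertex.surfaceVertex_injective (by omega) h
      simpa using this

/-- The restriction of a bulk vector to a sector. -/
noncomputable def pull {X : Type} {T : ℕ} (φ : X ↪ Vertex T n mx mz)
    (ζ : Bulk T n mx mz → ZMod 2) : X → ZMod 2 := fun a => glue 0 ζ (φ a)

/-- The extension of a vector on a sector by zero. -/
noncomputable def push {X : Type} {T : ℕ} (φ : X ↪ Vertex T n mx mz) (ξ : X → ZMod 2) :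
    Bulk T n mx mz → ZMod 2 := fun v => Function.extend φ ξ 0 v.1

theorem pull_add {X : Type} {T : ℕ} (φ : X ↪ Vertex T n mx mz)
    (ζ ζ' : Bulk T n mx mz → ZMod 2) : pull φ (ζ + ζ') = pull φ ζ + pull φ ζ' := by
  funext a
  simp only [pull, glue, Pi.add_apply]
  split <;> simp

theorem glue_zero_of_some {T : ℕ} {ζ : Bulk T n mx mz → ZMod 2} {v : Vertex T n mx mz}
    (h : v.toSurface ≠ none) : glue 0 ζ v = 0 := by
  unfold glue
  split
  · rfl
  · rename_i h'
    exact absurd h' h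

theorem glue_of_none {T : ℕ} {y : Bool × Fin n → ZMod 2} {ζ : Bulk T n mx mz → ZMod 2}
    {v : Vertex T n mx mz} (h : v.toSurface = none) : glue y ζ v = ζ ⟨v, h⟩ :=
  glue_bulk y ζ ⟨v, h⟩

theorem pull_push {X : Type} {T : ℕ} (φ : X ↪ Vertex T n mx mz) (ξ : X → ZMod 2)
    (hξ : ∀ a, (φ a).toSurface ≠ none → ξ a = 0) : pull φ (push φ ξ) = ξ := by
  funext a
  by_cases h : (φ a).toSurface = none
  · rw [pull, glue_of_none h, push]
    exact φ.injective.extend_apply _ _ _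
  · rw [pull, glue_zero_of_some h, hξ a h]

theorem pull_push_of_disjoint {X Y : Type} {T : ℕ} (φ : X ↪ Vertex T n mx mz)
    (ψ : Y ↪ Vertex T n mx mz) (ξ : X → ZMod 2)
    (h : ∀ a b, φ a = ψ b → (ψ b).toSurface ≠ none) : pull ψ (push φ ξ) = 0 := by
  funext b
  by_cases hb : (ψ b).toSurface = none
  · rw [pull, glue_of_none hb, push, Function.extend_apply']
    · rfl
    · rintro ⟨a, ha⟩
      exact h a b ha hb
  · rw [pull, glue_zero_of_some hb]
    rfl

/-- A part of the restriction of `η + β` to a sector, where `β` is a minimum-weight correction. -/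
theorem card_le_of_push {X : Type} [Fintype X] [DecidableEq X] {T : ℕ}
    (φ : X ↪ Vertex T n mx mz) (η β : Bulk T n mx mz → ZMod 2) (ξ : X → ZMod 2)
    (hξ : IsPart ξ (pull φ (η + β))) (hle : hammingNorm β ≤ hammingNorm (β + push φ ξ)) :
    (vsupp ξ).card ≤ 2 * (vsupp ξ ∩ vsupp (pull φ η)).card := by
  have hs : ∀ a, ξ a ≠ 0 → (φ a).toSurface = none := by
    intro a ha
    by_contra h
    rcases hξ a with h1 | h1
    · exact ha h1
    · rw [pull, glue_zero_of_some h] at h1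
      exact ha h1
  have hpart : IsPart (push φ ξ) (η + β) := by
    rintro ⟨v, hv⟩
    by_cases h : ∃ a, φ a = v
    · obtain ⟨a, rfl⟩ := h
      rw [push, φ.injective.extend_apply]
      have := hξ a
      rwa [pull, glue_of_none hv] at this
    · left
      rw [push, Function.extend_apply' _ _ _ h]
      rfl
  have key := card_vsupp_le_of_le hpart hle
  have h1 : (vsupp ξ).map φ = (vsupp (push φ ξ)).map (Function.Embedding.subtype _) := by
    ext v
    simp only [Finset.mem_map, mem_vsupp]
    constructor
    · rintro ⟨a, ha, rfl⟩
      refine ⟨⟨φ a, hs a ha⟩, ?_, rfl⟩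
      rwa [push, φ.injective.extend_apply]
    · rintro ⟨⟨v, hv⟩, h, rfl⟩
      by_cases hav : ∃ a, φ a = v
      · obtain ⟨a, rfl⟩ := hav
        rw [push, φ.injective.extend_apply] at h
        exact ⟨a, h, rfl⟩
      · rw [push, Function.extend_apply' _ _ _ hav] at h
        exact absurd rfl h
  have h2 : (vsupp (push φ ξ) ∩ vsupp η).map (Function.Embedding.subtype _) ⊆
      (vsupp ξ ∩ vsupp (pull φ η)).map φ := by
    intro v hv
    obtain ⟨w, hw, rfl⟩ := Finset.mem_map.1 hv
    obtain ⟨hw1, hw2⟩ := Finset.mem_inter.1 hw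
    have : (w : Vertex T n mx mz) ∈ (vsupp ξ).map φ := by
      rw [h1]; exact Finset.mem_map_of_mem _ hw1
    obtain ⟨a, ha, hav⟩ := Finset.mem_map.1 this
    refine Finset.mem_map.2 ⟨a, Finset.mem_inter.2 ⟨ha, ?_⟩, hav⟩
    rw [mem_vsupp, pull, hav, glue_bulk]
    exact mem_vsupp.1 hw2
  have h3 := congrArg Finset.card h1
  have h4 := Finset.card_le_card h2
  rw [Finset.card_map, Finset.card_map] at h3 h4
  omega

/-- Extending `ζ` by zero turns a bulk sum into a sum over whole layers; what `F` does on the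
surfaces is irrelevant. -/
theorem bulk_dotProduct {T : ℕ} (hT : 1 ≤ T) (f ζ : Bulk T n mx mz → ZMod 2)
    (F : Vertex T n mx mz → ZMod 2) (hF : ∀ v, f v = F v.1) :
    f ⬝ᵥ ζ = (∑ t, ∑ i, F (.code t i) * glue 0 ζ (.code t i)) +
      ((∑ t, ∑ c, F (.zcheck t c) * glue 0 ζ (.zcheck t c)) +
        ∑ t, ∑ c, F (.xcheck t c) * glue 0 ζ (.xcheck t c)) := by
  have h1 := dotProduct_glue hT F 0 ζ
  rw [dotProduct_zero, zero_add] at h1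
  rw [← Vertex.sum_univ fun v => F v * glue 0 ζ v]
  refine Eq.trans ?_ h1.symm
  congr 1
  exact funext hF

theorem sum_single_layer {k l : ℕ} (a : ℕ) (ha : a < k) (h : Fin l → ZMod 2)
    (G : Fin k → Fin l → ZMod 2) :
    ∑ t : Fin k, ∑ i, (if (t : ℕ) = a then h i else 0) * G t i = ∑ i, h i * G ⟨a, ha⟩ i := by
  rw [Finset.sum_eq_single ⟨a, ha⟩]
  · simp
  · intro t _ ht
    have : (t : ℕ) ≠ a := fun h => ht (Fin.ext h)
    simp [this]
  · simp

theorem sum_single_check {k l : ℕ} (a : Fin k) (c : Fin l) (G : Fin k → Fin l → ZMod 2) :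
    ∑ t : Fin k, ∑ c', (if c' = c ∧ (t : ℕ) = a then (1 : ZMod 2) else 0) * G t c' = G a c := by
  rw [Finset.sum_eq_single a]
  · simp
  · intro t _ ht
    have : (t : ℕ) ≠ a := fun h => ht (Fin.ext h)
    simp [this]
  · simp

theorem sum_two_checks {k l : ℕ} (a b : Fin k) (hab : a ≠ b) (c : Fin l)
    (G : Fin k → Fin l → ZMod 2) :
    ∑ t : Fin k, ∑ c', (if c' = c ∧ ((t : ℕ) = a ∨ (t : ℕ) = b) then (1 : ZMod 2) else 0) * G t c' =
      G a c + G b c := by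
  rw [← sum_single_check a c G, ← sum_single_check b c G, ← Finset.sum_add_distrib]
  refine Finset.sum_congr rfl fun t _ => ?_
  rw [← Finset.sum_add_distrib]
  refine Finset.sum_congr rfl fun c' _ => ?_
  rw [← add_mul]
  congr 1
  have hab' : (a : ℕ) ≠ b := fun h => hab (Fin.ext h)
  by_cases h1 : c' = c <;> by_cases h2 : (t : ℕ) = a <;> by_cases h3 : (t : ℕ) = b <;>
    first
    | exact absurd (h2.symm.trans h3) hab'
    | simp [h1, h2, h3, hab', hab'.symm]

variable (R : CSSCode n mx mz) (ζ : Bulk (N + 1) n mx mz → ZMod 2)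

theorem zMeta_dotProduct (t : Fin (N + 1)) (c : Fin mz) :
    zMeta R t c ⬝ᵥ ζ = (sectorMatrix (N + 1) R.HZ *ᵥ pull (zEmb N mx) ζ) (.inl t, c) := by
  rw [sectorMatrix_mulVec_inl, bulk_dotProduct (by omega) _ _ (layered (N + 1)
    (fun τ => if τ = 2 * t + 1 then R.HZ c else 0)
    (fun τ c' => if c' = c ∧ (τ = t ∨ τ = t + 1) then 1 else 0) 0)]
  · simp only [layered, Pi.zero_apply, zero_mul, Finset.sum_const_zero, add_zero]
    congr 1
    · refine Eq.trans ?_ (sum_single_layer (2 * t + 1) (by omega) (R.HZ c)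
        fun t i => glue 0 ζ (.code t i))
      refine Finset.sum_congr rfl fun τ _ => Finset.sum_congr rfl fun i _ => ?_
      split_ifs <;> rfl
    · exact sum_two_checks t.castSucc t.succ Fin.castSucc_lt_succ.ne c
        fun t c' => glue 0 ζ (.zcheck t c')
  · rintro ⟨⟨τ, i⟩ | ⟨τ, c'⟩ | ⟨τ, c'⟩, hv⟩
    · simp only [zMeta, layered]
      split_ifs <;> rfl
    · rfl
    · rfl

theorem xMeta_dotProduct (t : Fin N) (c : Fin mx) :
    xMeta R (t : ℕ) c ⬝ᵥ ζ = (sectorMatrix N R.HX *ᵥ pull (xEmb N mz) ζ) (.inl t, c) := by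
  rw [sectorMatrix_mulVec_inl, bulk_dotProduct (by omega) _ _ (layered (N + 1)
    (fun τ => if τ = 2 * t + 2 then R.HX c else 0) 0
    (fun τ c' => if c' = c ∧ (τ = t ∨ τ = t + 1) then 1 else 0))]
  · simp only [layered, Pi.zero_apply, zero_mul, Finset.sum_const_zero, zero_add]
    congr 1
    · refine Eq.trans ?_ (sum_single_layer (2 * t + 2) (by omega) (R.HX c)
        fun t i => glue 0 ζ (.code t i))
      refine Finset.sum_congr rfl fun τ _ => Finset.sum_congr rfl fun i _ => ?_
      split_ifs <;> rfl
    · exact sum_two_checks t.castSucc t.succ Fin.castSucc_lt_succ.ne c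
        fun t c' => glue 0 ζ (.xcheck t c')
  · rintro ⟨⟨τ, i⟩ | ⟨τ, c'⟩ | ⟨τ, c'⟩, hv⟩
    · simp only [xMeta, layered]
      split_ifs <;> rfl
    · rfl
    · rfl

theorem forall_metaChecks_iff :
    (∀ α ∈ metaChecks R (N + 1), α ⬝ᵥ ζ = 0) ↔
      (∀ s c, (sectorMatrix (N + 1) R.HZ *ᵥ pull (zEmb N mx) ζ) (.inl s, c) = 0) ∧
      ∀ s c, (sectorMatrix N R.HX *ᵥ pull (xEmb N mz) ζ) (.inl s, c) = 0 := by
  constructor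
  · intro h
    refine ⟨fun s c => ?_, fun s c => ?_⟩
    · rw [← zMeta_dotProduct]; exact h _ (.inl ⟨s, c, rfl⟩)
    · rw [← xMeta_dotProduct]; exact h _ (.inr ⟨s, c, by omega, rfl⟩)
  · rintro ⟨h1, h2⟩ α (⟨t, c, rfl⟩ | ⟨t, c, ht, rfl⟩)
    · rw [zMeta_dotProduct, h1]
    · exact (xMeta_dotProduct R ζ ⟨t, by omega⟩ c).trans (h2 _ _)

theorem zBoundary_dotProduct (σ : Bool) (c : Fin mz) :
    (zBoundary R (N + 1) σ c).2 ⬝ᵥ ζ = pull (zEmb N mx) ζ (.check (endLayer (N + 1) σ) c) := by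
  rw [bulk_dotProduct (by omega) _ _ (layered (N + 1) 0
    (fun τ c' => if c' = c ∧ τ = (if σ then N + 1 else 0) then 1 else 0) 0)]
  · simp only [layered, Pi.zero_apply, zero_mul, Finset.sum_const_zero, add_zero, zero_add]
    have : (if σ then N + 1 else 0) = ((endLayer (N + 1) σ : Fin (N + 1 + 1)) : ℕ) := by
      cases σ <;> simp [endLayer]
    rw [this]
    exact sum_single_check _ c fun t c' => glue 0 ζ (.zcheck t c')
  · rintro ⟨⟨τ, i⟩ | ⟨τ, c'⟩ | ⟨τ, c'⟩, hv⟩ <;> rfl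

theorem xBoundary_dotProduct (σ : Bool) (c : Fin mx) :
    (xBoundary R (N + 1) σ c).2 ⬝ᵥ ζ = pull (xEmb N mz) ζ (.check (endLayer N σ) c) := by
  rw [bulk_dotProduct (by omega) _ _ (layered (N + 1) 0 0
    (fun τ c' => if c' = c ∧ τ = (if σ then N + 1 - 1 else 0) then 1 else 0))]
  · simp only [layered, Pi.zero_apply, zero_mul, Finset.sum_const_zero, zero_add]
    have : (if σ then N + 1 - 1 else 0) = ((endLayer N σ : Fin (N + 1)) : ℕ) := by
      cases σ <;> simp [endLayer]
    rw [this]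
    exact sum_single_check _ c fun t c' => glue 0 ζ (.xcheck t c')
  · rintro ⟨⟨τ, i⟩ | ⟨τ, c'⟩ | ⟨τ, c'⟩, hv⟩ <;> rfl

theorem zzLogical_dotProduct (a : Fin n → ZMod 2) :
    (zzLogical (N + 1) mx mz a).2 ⬝ᵥ ζ =
      a ⬝ᵥ fun i => ∑ t, pull (zEmb N mx) ζ (.code t i) := by
  rw [bulk_dotProduct (by omega) _ _ (layered (N + 1)
    (fun τ => if Even (τ + 1 : ℕ) then a else 0) 0 0)]
  · simp only [layered, Pi.zero_apply, zero_mul, Finset.sum_const_zero, add_zero, dotProduct,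
      Finset.mul_sum]
    rw [Finset.sum_comm (s := (Finset.univ : Finset (Fin n)))]
    symm
    refine Fintype.sum_of_injective
      (fun t : Fin (N + 1) => (⟨2 * t + 1, by omega⟩ : Fin (2 * (N + 1) + 1)))
      (fun s t h => Fin.ext (by simpa using h)) _ _ (fun t ht => ?_) fun t => ?_
    · have : ¬ Even ((t : ℕ) + 1) := by
        rintro ⟨k, hk⟩
        exact ht ⟨⟨k - 1, by omega⟩, Fin.ext (by simp; omega)⟩
      simp [this]
    · have : Even (2 * (t : ℕ) + 1 + 1) := ⟨t + 1, by ring⟩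
      simp only [this, if_true]
      rfl
  · rintro ⟨⟨τ, i⟩ | ⟨τ, c'⟩ | ⟨τ, c'⟩, hv⟩
    · simp only [zzLogical, layered]
      split_ifs <;> rfl
    · rfl
    · rfl

theorem xxLogical_dotProduct (a : Fin n → ZMod 2) :
    (xxLogical (N + 1) mx mz a).2 ⬝ᵥ ζ =
      a ⬝ᵥ fun i => ∑ t, pull (xEmb N mz) ζ (.code t i) := by
  rw [bulk_dotProduct (by omega) _ _ (layered (N + 1)
    (fun τ => if Odd (τ + 1 : ℕ) then a else 0) 0 0)]
  · simp only [layered, Pi.zero_apply, zero_mul, Finset.sum_const_zero, add_zero, dotProduct,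
      Finset.mul_sum]
    rw [Finset.sum_comm (s := (Finset.univ : Finset (Fin n)))]
    symm
    refine Fintype.sum_of_injective
      (fun t : Fin N => (⟨2 * t + 2, by omega⟩ : Fin (2 * (N + 1) + 1)))
      (fun s t h => Fin.ext (by simpa using h)) _ _ (fun t ht => ?_) fun t => ?_
    · refine Finset.sum_eq_zero fun i _ => ?_
      -- Odd layers outside the sector are the two surfaces, where the extension of `ζ` is zero.
      by_cases ho : Odd ((t : ℕ) + 1)
      · obtain ⟨k, hk⟩ := ho
        rw [glue_zero_of_some, mul_zero]
        simp only [Vertex.toSurface]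
        split_ifs with h1 h2
        · simp
        · simp
        · exact absurd ⟨⟨k - 1, by omega⟩, Fin.ext (by simp; omega)⟩ ht
      · simp [ho]
    · have : Odd (2 * (t : ℕ) + 2 + 1) := ⟨t + 1, by ring⟩
      simp only [this, if_true]
      rfl
  · rintro ⟨⟨τ, i⟩ | ⟨τ, c'⟩ | ⟨τ, c'⟩, hv⟩
    · simp only [xxLogical, layered]
      split_ifs <;> rfl
    · rfl
    · rfl

end Sectors

/-! ### Minimum-weight solutions -/

section MinWeight

variable {V : Type} [Fintype V]

theorem exists_minWeight (p : (V → ZMod 2) → Prop) (h : ∃ x, p x) :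
    ∃ x, p x ∧ ∀ y, p y → hammingNorm x ≤ hammingNorm y := by
  obtain ⟨x, hx⟩ := h
  obtain ⟨y, hy, hmin⟩ := exists_minimalFor_of_wellFoundedLT p hammingNorm ⟨x, hx⟩
  exact ⟨y, hy, fun z hz => (le_total (hammingNorm y) (hammingNorm z)).elim id fun h => hmin hz h⟩

/-- A minimum-weight vector with the property `p`, if there is one. -/
noncomputable def minWeight (p : (V → ZMod 2) → Prop) : V → ZMod 2 :=
  open Classical in if h : ∃ x, p x then (exists_minWeight p h).choose else 0

theorem minWeight_spec {p : (V → ZMod 2) → Prop} (h : ∃ x, p x) :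
    p (minWeight p) ∧ ∀ y, p y → hammingNorm (minWeight p) ≤ hammingNorm y := by
  rw [minWeight, dif_pos h]
  exact (exists_minWeight p h).choose_spec

theorem exists_isMinWeightDecoder {n mx mz : ℕ} (R : CSSCode n mx mz) (T : ℕ) :
    ∃ dec, IsMinWeightDecoder R T dec := by
  have h : ∀ s, ∃ β, ∀ α ∈ metaChecks R T, α ⬝ᵥ β = α ⬝ᵥ s := fun s => ⟨s, fun _ _ => rfl⟩
  refine ⟨fun s => minWeight fun β => ∀ α ∈ metaChecks R T, α ⬝ᵥ β = α ⬝ᵥ s,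
    fun s => (minWeight_spec (h s)).1, fun s => (minWeight_spec (h s)).2, fun s s' hs => ?_⟩
  -- Equal syndromes give the same predicate, hence the same chosen minimizer; this is how the
  -- decoder depends on the syndromes only.
  have : (fun β => ∀ α ∈ metaChecks R T, α ⬝ᵥ β = α ⬝ᵥ s) =
      fun β => ∀ α ∈ metaChecks R T, α ⬝ᵥ β = α ⬝ᵥ s' :=
    funext fun β => propext (forall₂_congr fun α hα => by rw [hs α hα])
  exact congrArg minWeight this

end MinWeight

/-! ### Residual syndromes and Pauli frames -/

section Frame

variable {N n mx mz : ℕ} (R : CSSCode n mx mz)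

theorem symp_zBoundary (T : ℕ) (F : Pauli (Bool × Fin n)) (σ : Bool) (c : Fin mz) :
    symp F (zBoundary R T σ c).1 = ∑ i, R.HZ c i * F.1 (σ, i) := by
  simp only [symp, zBoundary, dotProduct_zero, add_zero]
  rw [dotProduct_surfaces]
  cases σ <;> simp [dotProduct, mul_comm]

theorem symp_xBoundary (T : ℕ) (F : Pauli (Bool × Fin n)) (σ : Bool) (c : Fin mx) :
    symp F (xBoundary R T σ c).1 = ∑ i, R.HX c i * F.2 (σ, i) := by
  simp only [symp, xBoundary, dotProduct_zero, zero_add]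
  rw [dotProduct_surfaces]
  cases σ <;> simp [dotProduct, mul_comm]

theorem symp_zzLogical (T : ℕ) (F : Pauli (Bool × Fin n)) (a : Fin n → ZMod 2) :
    symp F (zzLogical T mx mz a).1 = a ⬝ᵥ fun i => F.1 (false, i) + F.1 (true, i) := by
  simp only [symp, zzLogical, dotProduct_zero, add_zero]
  rw [dotProduct_surfaces, dotProduct_comm _ a, dotProduct_comm _ a, ← dotProduct_add]
  rfl

theorem symp_xxLogical (T : ℕ) (F : Pauli (Bool × Fin n)) (a : Fin n → ZMod 2) :
    symp F (xxLogical T mx mz a).1 = a ⬝ᵥ fun i => F.2 (false, i) + F.2 (true, i) := by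
  simp only [symp, xxLogical, dotProduct_zero, zero_add]
  rw [dotProduct_surfaces, dotProduct_comm _ a, dotProduct_comm _ a, ← dotProduct_add]
  rfl

/-- The `X`-type logical operator left by the correction of the `Z` sector. -/
noncomputable def zResidue (ζ : Bulk (N + 1) n mx mz → ZMod 2) (e : Bool × Fin n → ZMod 2) :
    Fin n → ZMod 2 := layerSum (withSurf (pull (zEmb N mx) ζ) e)

/-- The `Z`-type logical operator left by the correction of the `X` sector. -/
noncomputable def xResidue (ζ : Bulk (N + 1) n mx mz → ZMod 2) (e : Bool × Fin n → ZMod 2) :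
    Fin n → ZMod 2 := layerSum (withSurf (pull (xEmb N mz) ζ) e)

/-- The correction `F` has the syndromes of `ζ` for the stabilizers of the two surfaces. -/
def HasResidualSyndrome (ζ : Bulk (N + 1) n mx mz → ZMod 2) (F : Pauli (Bool × Fin n)) : Prop :=
  (∀ σ c, ∑ i, R.HZ c i * F.1 (σ, i) = pull (zEmb N mx) ζ (.check (endLayer (N + 1) σ) c)) ∧
  ∀ σ c, ∑ i, R.HX c i * F.2 (σ, i) = pull (xEmb N mz) ζ (.check (endLayer N σ) c)

variable {R} {ζ : Bulk (N + 1) n mx mz → ZMod 2} {F : Pauli (Bool × Fin n)}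

/-- Solved meta-checks and matching surface syndromes are just what the telescoping argument needs;
nothing is assumed about weights. -/
theorem HasResidualSyndrome.zResidue_mem (h : HasResidualSyndrome R ζ F)
    (hζ : ∀ α ∈ metaChecks R (N + 1), α ⬝ᵥ ζ = 0) : zResidue ζ F.1 ∈ R.xLogical := by
  rw [CSSCode.mem_xLogical]
  refine IsSectorDecoding.mulVec_layerSum _ (IsSectorDecoding.mulVec_withSurf ?_ h.1)
  exact ((forall_metaChecks_iff R ζ).1 hζ).1

theorem HasResidualSyndrome.xResidue_mem (h : HasResidualSyndrome R ζ F)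
    (hζ : ∀ α ∈ metaChecks R (N + 1), α ⬝ᵥ ζ = 0) : xResidue ζ F.2 ∈ R.zLogical := by
  rw [CSSCode.mem_zLogical]
  refine IsSectorDecoding.mulVec_layerSum _ (IsSectorDecoding.mulVec_withSurf ?_ h.2)
  exact ((forall_metaChecks_iff R ζ).1 hζ).2

theorem sum_mul_twoSurfaces {m : ℕ} {H : Matrix (Fin m) (Fin n) (ZMod 2)} {a : Fin n → ZMod 2}
    (ha : H *ᵥ a = 0) (σ : Bool) (c : Fin m) : ∑ i, H c i * twoSurfaces a 0 (σ, i) = 0 := by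
  cases σ
  · exact congrFun ha c
  · simp [twoSurfaces]

/-- A correction with the right syndromes on the two surfaces becomes a Pauli frame by a logical
operator on the first surface. -/
theorem HasResidualSyndrome.symp_bellGenerator (h : HasResidualSyndrome R ζ F)
    {a b : Fin n → ZMod 2} (ha : a ∈ R.xLogical)
    (hb : b ∈ R.zLogical) (hay : a + zResidue ζ F.1 ∈ R.xStab) (hby : b + xResidue ζ F.2 ∈ R.zStab)
    (g : Pauli (Bool × Fin n) × (Bulk (N + 1) n mx mz → ZMod 2))
    (hg : g ∈ bellGenerators R (N + 1)) :
    symp (F + (twoSurfaces a 0, twoSurfaces b 0)) g.1 = g.2 ⬝ᵥ ζ := by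
  rcases hg with ⟨σ, c, rfl⟩ | ⟨σ, c, rfl⟩ | ⟨a', ha', rfl⟩ | ⟨a', ha', rfl⟩
  · rw [symp_add_left, symp_zBoundary, symp_zBoundary, h.1, zBoundary_dotProduct,
      sum_mul_twoSurfaces (CSSCode.mem_xLogical.1 ha), add_zero]
  · rw [symp_add_left, symp_xBoundary, symp_xBoundary, h.2, xBoundary_dotProduct,
      sum_mul_twoSurfaces (CSSCode.mem_zLogical.1 hb), add_zero]
  -- The two sides differ by the pairing of `a'` with `b` plus the residue, a `Z` stabilizer, which
  -- is orthogonal to the logical `a'`.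
  · have h0 := (CSSCode.mem_xLogical_iff R a').1 ha' _ hby
    rw [dotProduct_comm] at h0
    rw [symp_xxLogical, xxLogical_dotProduct, ← sub_eq_zero, ← dotProduct_sub, ← h0]
    congr 1
    funext i
    simp only [xResidue, layerSum, withSurf, twoSurfaces, Pi.sub_apply, Pi.add_apply, Prod.snd_add,
      CharTwo.sub_eq_add]
    simp
    ring
  · have h0 := (CSSCode.mem_zLogical_iff R a').1 ha' _ hay
    rw [dotProduct_comm] at h0
    rw [symp_zzLogical, zzLogical_dotProduct, ← sub_eq_zero, ← dotProduct_sub, ← h0]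
    congr 1
    funext i
    simp only [zResidue, layerSum, withSurf, twoSurfaces, Pi.sub_apply, Pi.add_apply, Prod.fst_add,
      CharTwo.sub_eq_add]
    simp
    ring

theorem exists_hasResidualSyndrome (R : CSSCode n mx mz) (ζ : Bulk (N + 1) n mx mz → ZMod 2) :
    ∃ F, HasResidualSyndrome R ζ F := by
  choose u hu using fun σ => R.HZ_surjective fun c =>
    pull (zEmb N mx) ζ (.check (endLayer (N + 1) σ) c)
  choose v hv using fun σ => R.HX_surjective fun c =>
    pull (xEmb N mz) ζ (.check (endLayer N σ) c)
  exact ⟨(fun q => u q.1 q.2, fun q => v q.1 q.2), fun σ c => congrFun (hu σ) c,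
    fun σ c => congrFun (hv σ) c⟩

theorem exists_isPauliFrame {dec : (Bulk (N + 1) n mx mz → ZMod 2) → Bulk (N + 1) n mx mz → ZMod 2}
    (hdec : IsMinWeightDecoder R (N + 1) dec) : ∃ Rec, IsPauliFrame R (N + 1) dec Rec := by
  choose F hF using fun s => exists_hasResidualSyndrome R (s + dec s)
  have hζ : ∀ s, ∀ α ∈ metaChecks R (N + 1), α ⬝ᵥ (s + dec s) = 0 := fun s α hα => by
    rw [dotProduct_add, hdec.1 s α hα, zmod2_add_self]
  -- Taking the residue itself as the logical correction makes its sum with the residue zero.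
  refine ⟨fun s => F s + (twoSurfaces (zResidue (s + dec s) (F s).1) 0,
    twoSurfaces (xResidue (s + dec s) (F s).2) 0), fun s g hg => ?_⟩
  rw [(hF s).symp_bellGenerator ((hF s).zResidue_mem (hζ s)) ((hF s).xResidue_mem (hζ s)) ?_ ?_ g
    hg, dotProduct_add]
  · rw [vec_add_self]; exact Submodule.zero_mem _
  · rw [vec_add_self]; exact Submodule.zero_mem _

theorem isMinWeightResidual_iff
    {dec : (Bulk (N + 1) n mx mz → ZMod 2) → Bulk (N + 1) n mx mz → ZMod 2}
    {Rmin : Pauli (Bulk (N + 1) n mx mz) → Pauli (Bool × Fin n)} :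
    IsMinWeightResidual R (N + 1) dec Rmin ↔ ∀ P, HasResidualSyndrome R (P.2 + dec P.2) (Rmin P) ∧
      (∀ e : Bool × Fin n → ZMod 2, (∀ σ c, ∑ i, R.HZ c i * e (σ, i) =
        pull (zEmb N mx) (P.2 + dec P.2) (.check (endLayer (N + 1) σ) c)) →
          hammingNorm (Rmin P).1 ≤ hammingNorm e) ∧
      ∀ e : Bool × Fin n → ZMod 2, (∀ σ c, ∑ i, R.HX c i * e (σ, i) =
        pull (xEmb N mz) (P.2 + dec P.2) (.check (endLayer N σ) c)) →
          hammingNorm (Rmin P).2 ≤ hammingNorm e := by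
  unfold IsMinWeightResidual HasResidualSyndrome
  refine forall_congr' fun P => ?_
  simp only [symp_zBoundary, symp_xBoundary, zBoundary_dotProduct, xBoundary_dotProduct,
    add_comm P.2 (dec P.2), pull_add, Pi.add_apply]
  tauto

theorem exists_isMinWeightResidual
    (dec : (Bulk (N + 1) n mx mz → ZMod 2) → Bulk (N + 1) n mx mz → ZMod 2) :
    ∃ Rmin, IsMinWeightResidual R (N + 1) dec Rmin := by
  choose F hF using fun P : Pauli (Bulk (N + 1) n mx mz) =>
    exists_hasResidualSyndrome R (P.2 + dec P.2)
  choose u hu using fun P => exists_minWeight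
    (fun e : Bool × Fin n → ZMod 2 => ∀ σ c, ∑ i, R.HZ c i * e (σ, i) =
      pull (zEmb N mx) (P.2 + dec P.2) (.check (endLayer (N + 1) σ) c)) ⟨_, (hF P).1⟩
  choose v hv using fun P => exists_minWeight
    (fun e : Bool × Fin n → ZMod 2 => ∀ σ c, ∑ i, R.HX c i * e (σ, i) =
      pull (xEmb N mz) (P.2 + dec P.2) (.check (endLayer N σ) c)) ⟨_, (hF P).2⟩
  exact ⟨fun P => (u P, v P), isMinWeightResidual_iff.2 fun P =>
    ⟨⟨(hu P).1, (hv P).1⟩, (hu P).2, (hv P).2⟩⟩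

end Frame

/-! ### Clusters in the alternating Tanner graph -/

section Clusters

variable {N n mx mz : ℕ}

theorem ncard_relationMap_le {X V : Type} [Finite X] (r : X → X → Prop) (φ : X ↪ V) (D : ℕ)
    (h : ∀ a, {b | r a b}.ncard ≤ D) (u : V) : {v | Relation.Map r φ φ u v}.ncard ≤ D := by
  by_cases hu : ∃ a, φ a = u
  · obtain ⟨a, rfl⟩ := hu
    have : {v | Relation.Map r φ φ (φ a) v} ⊆ φ '' {b | r a b} := by
      rintro _ ⟨a', b, hab, ha, rfl⟩
      rw [φ.injective ha] at hab
      exact ⟨b, hab, rfl⟩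
    exact (Set.ncard_le_ncard this (Set.toFinite _)).trans
      ((Set.ncard_image_le (Set.toFinite _)).trans (h a))
  · have : {v | Relation.Map r φ φ u v} = ∅ := by
      ext v
      simp only [Set.mem_ofPred_eq, Set.mem_empty_iff_false, iff_false]
      rintro ⟨a, b, -, ha, -⟩
      exact hu ⟨a, ha⟩
    rw [this, Set.ncard_empty]
    exact Nat.zero_le _

/-- Two qubits that are involved in a common check of one of the sectors. -/
def syndromeAdj (R : CSSCode n mx mz) (N : ℕ) (u v : Vertex (N + 1) n mx mz) : Prop :=
  Relation.Map (rowAdj (sectorMatrix (N + 1) R.HZ)) (zEmb N mx) (zEmb N mx) u v ∨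
    Relation.Map (rowAdj (sectorMatrix N R.HX)) (xEmb N mz) (xEmb N mz) u v

theorem ncard_syndromeAdj_le {R : CSSCode n mx mz} {ℓ : ℕ} (hR : R.IsSparse ℓ)
    (u : Vertex (N + 1) n mx mz) :
    {v | syndromeAdj R N u v}.ncard ≤ 2 * ((ℓ + 4) * (ℓ + 2)) := by
  have h1 := ncard_relationMap_le _ (zEmb N mx) _ (ncard_rowAdj_le _ _ _
    (hammingNorm_col_sectorMatrix_le (N := N + 1) R.HZ ℓ hR.2.2.2)
    (hammingNorm_row_sectorMatrix_le R.HZ ℓ hR.2.1)) u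
  have h2 := ncard_relationMap_le _ (xEmb N mz) _ (ncard_rowAdj_le _ _ _
    (hammingNorm_col_sectorMatrix_le (N := N) R.HX ℓ hR.2.2.1)
    (hammingNorm_row_sectorMatrix_le R.HX ℓ hR.1)) u
  rw [two_mul]
  exact (Set.ncard_union_le _ _).trans (add_le_add h1 h2)

/-- All clusters of the error `P` have fewer than `m` qubits. -/
def smallClusters (R : CSSCode n mx mz) (N m : ℕ) : Set (Pauli (Vertex (N + 1) n mx mz)) :=
  {P | ∀ v U, Rooted (syndromeAdj R N) {v} U → U.card ≤ 4 * (supp P ∩ U).card → U.card < m}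

theorem pull_ne_zero {X : Type} {T : ℕ} {φ : X ↪ Vertex T n mx mz} {ζ : Bulk T n mx mz → ZMod 2}
    {a : X} (h : pull φ ζ a ≠ 0) : ∃ hv : (φ a).toSurface = none, ζ ⟨φ a, hv⟩ ≠ 0 := by
  by_cases hv : (φ a).toSurface = none
  · refine ⟨hv, ?_⟩
    rwa [pull, glue_of_none hv] at h
  · exact absurd (glue_zero_of_some hv) h

theorem map_inter_vsupp_pull_subset {X : Type} [Fintype X] [DecidableEq X] {T : ℕ}
    (φ : X ↪ Vertex T n mx mz) (P : Pauli (Vertex T n mx mz)) (U : Finset X) :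
    (U ∩ vsupp (pull φ (bulkPart P).2)).map φ ⊆ supp P ∩ U.map φ := by
  intro v hv
  obtain ⟨a, ha, rfl⟩ := Finset.mem_map.1 hv
  obtain ⟨ha1, ha2⟩ := Finset.mem_inter.1 ha
  refine Finset.mem_inter.2 ⟨?_, Finset.mem_map_of_mem _ ha1⟩
  obtain ⟨_, h⟩ := pull_ne_zero (mem_vsupp.1 ha2)
  exact Finset.mem_filter.2 ⟨Finset.mem_univ _, .inr h⟩

/-- The `Z` sector uses the even code layers and the `Z` checks, the `X` sector the inner odd layers
and the `X` checks; they share the surfaces only. A change of the correction in one bulk sector is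
invisible to the other. -/
theorem toSurface_ne_none_of_zEmb_eq_xEmb {a : SV (N + 1) n mz} {b : SV N n mx}
    (h : zEmb N mx a = xEmb N mz b) : (xEmb N mz b).toSurface ≠ none := by
  intro hb
  cases b with
  | code t i =>
    cases a with
    | code t' i' =>
      have h1 : (⟨2 * t' + 1, by omega⟩ : Fin (2 * (N + 1) + 1)) = ⟨2 * t + 2, by omega⟩ :=
        (Vertex.code.inj h).1
      have := Fin.mk.inj h1
      omega
    | check t' c => simp [zEmb, xEmb] at h
    | surf σ i' => exact ne_surfaceVertex (by omega) hb (σ, i') h.symm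
  | check t c =>
    cases a with
    | code t' i' => simp [zEmb, xEmb] at h
    | check t' c => simp [zEmb, xEmb] at h
    | surf σ i' => exact ne_surfaceVertex (by omega) hb (σ, i') h.symm
  | surf σ i => exact ne_surfaceVertex (by omega) hb (σ, i) rfl

variable {R : CSSCode n mx mz}
  {dec : (Bulk (N + 1) n mx mz → ZMod 2) → Bulk (N + 1) n mx mz → ZMod 2}
  {Rmin : Pauli (Bulk (N + 1) n mx mz) → Pauli (Bool × Fin n)}

theorem hammingNorm_le_add_push {X : Type} (hdec : IsMinWeightDecoder R (N + 1) dec)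
    (η : Bulk (N + 1) n mx mz → ZMod 2) (φ : X ↪ Vertex (N + 1) n mx mz) (ξ : X → ZMod 2)
    (hξ : ∀ α ∈ metaChecks R (N + 1), α ⬝ᵥ push φ ξ = 0) :
    hammingNorm (dec η) ≤ hammingNorm (dec η + push φ ξ) :=
  hdec.2.1 _ _ fun α hα => by rw [dotProduct_add, hdec.1 _ α hα, hξ α hα, add_zero]

theorem meta_dotProduct_add_dec (hdec : IsMinWeightDecoder R (N + 1) dec)
    (η : Bulk (N + 1) n mx mz → ZMod 2) (α) (hα : α ∈ metaChecks R (N + 1)) :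
    α ⬝ᵥ (η + dec η) = 0 := by
  rw [dotProduct_add, hdec.1 _ α hα, zmod2_add_self]

theorem zEmb_surf_ne_none (σ : Bool) (i : Fin n) :
    (zEmb N mx (.surf σ i : SV (N + 1) n mz)).toSurface ≠ none := fun h =>
  ne_surfaceVertex (by omega) h (σ, i) rfl

theorem xEmb_surf_ne_none (σ : Bool) (i : Fin n) :
    (xEmb N mz (.surf σ i : SV N n mx)).toSurface ≠ none := fun h =>
  ne_surfaceVertex (by omega) h (σ, i) rfl

theorem isPart_pull_eq_zero {X : Type} {T : ℕ} {φ : X ↪ Vertex T n mx mz}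
    {ζ : Bulk T n mx mz → ZMod 2} {ξ : X → ZMod 2} (h : IsPart ξ (pull φ ζ)) (a : X)
    (ha : (φ a).toSurface ≠ none) : ξ a = 0 := by
  rcases h a with h | h
  · exact h
  · rw [h, pull, glue_zero_of_some ha]

/-- The decoder minimizes over the whole bulk. A vector that solves the meta-checks of one sector,
extended by zero, solves all of them, so minimality passes to the sector. -/
theorem isSectorDecoding_z (hdec : IsMinWeightDecoder R (N + 1) dec)
    (hmin : IsMinWeightResidual R (N + 1) dec Rmin) (P : Pauli (Bulk (N + 1) n mx mz)) :
    IsSectorDecoding R.HZ (pull (zEmb N mx) (P.2 + dec P.2)) (Rmin P).1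
      (vsupp (pull (zEmb N mx) P.2)) := by
  obtain ⟨h1, h2, -⟩ := isMinWeightResidual_iff.1 hmin P
  refine ⟨fun σ i => glue_zero_of_some (zEmb_surf_ne_none σ i),
    ((forall_metaChecks_iff R _).1 (meta_dotProduct_add_dec hdec P.2)).1, fun ξ hξ h0 => ?_, h1.1, h2⟩
  refine card_le_of_push _ _ (dec P.2) ξ hξ (hammingNorm_le_add_push hdec _ _ _ ?_)
  rw [forall_metaChecks_iff, pull_push _ _ (isPart_pull_eq_zero hξ), pull_push_of_disjoint]
  · exact ⟨h0, fun s c => by rw [Matrix.mulVec_zero]; rfl⟩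
  · exact fun a b h => toSurface_ne_none_of_zEmb_eq_xEmb h

theorem isSectorDecoding_x (hdec : IsMinWeightDecoder R (N + 1) dec)
    (hmin : IsMinWeightResidual R (N + 1) dec Rmin) (P : Pauli (Bulk (N + 1) n mx mz)) :
    IsSectorDecoding R.HX (pull (xEmb N mz) (P.2 + dec P.2)) (Rmin P).2
      (vsupp (pull (xEmb N mz) P.2)) := by
  obtain ⟨h1, -, h2⟩ := isMinWeightResidual_iff.1 hmin P
  refine ⟨fun σ i => glue_zero_of_some (xEmb_surf_ne_none σ i),
    ((forall_metaChecks_iff R _).1 (meta_dotProduct_add_dec hdec P.2)).2, fun ξ hξ h0 => ?_, h1.2, h2⟩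
  refine card_le_of_push _ _ (dec P.2) ξ hξ (hammingNorm_le_add_push hdec _ _ _ ?_)
  rw [forall_metaChecks_iff, pull_push _ _ (isPart_pull_eq_zero hξ), pull_push_of_disjoint]
  · exact ⟨fun s c => by rw [Matrix.mulVec_zero]; rfl, h0⟩
  · exact fun a b h => h ▸ toSurface_ne_none_of_zEmb_eq_xEmb h.symm

/-- In a sector whose checks are part of the adjacency relation, small clusters stay small. -/
theorem smallClusters_sector {m : ℕ} {P : Pauli (Vertex (N + 1) n mx mz)}
    (hP : P ∈ smallClusters R N m) {X : Type} [Fintype X] [DecidableEq X]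
    (φ : X ↪ Vertex (N + 1) n mx mz) (r : X → X → Prop)
    (hr : ∀ a b, r a b → syndromeAdj R N (φ a) (φ b)) (v : X) (U : Finset X)
    (hU : Rooted r {v} U) (hcard : U.card ≤ 4 * (U ∩ vsupp (pull φ (bulkPart P).2)).card) :
    U.card < m := by
  have h1 := hU.map φ hr
  rw [Finset.map_singleton] at h1
  have h2 := Finset.card_le_card (map_inter_vsupp_pull_subset φ P U)
  rw [Finset.card_map] at h2
  have h3 := hP _ _ h1 (by rw [Finset.card_map]; omega)
  rwa [Finset.card_map] at h3

variable {m : ℕ} {P : Pauli (Vertex (N + 1) n mx mz)}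

theorem decode_z (hdec : IsMinWeightDecoder R (N + 1) dec)
    (hmin : IsMinWeightResidual R (N + 1) dec Rmin) (hm : m ≤ N + 1)
    (hd : (m : ℕ∞) ≤ R.distance) (hP : P ∈ smallClusters R N m) :
    zResidue ((bulkPart P).2 + dec (bulkPart P).2) (Rmin (bulkPart P)).1 ∈ R.xStab ∧
    ∀ S : Finset (Bool × Fin n), S ⊆ vsupp (Rmin (bulkPart P)).1 → ∃ U,
      Rooted (rowAdj (sectorMatrix (N + 1) R.HZ)) (S.image fun q => .surf q.1 q.2) U ∧
      U.card ≤ 4 * (U ∩ vsupp (pull (zEmb N mx) (bulkPart P).2)).card ∧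
      S.card ≤ 2 * (U ∩ vsupp (pull (zEmb N mx) (bulkPart P).2)).card := by
  refine (isSectorDecoding_z hdec hmin (bulkPart P)).decode m (by omega) R.xStab
    (fun y hy hw => R.mem_xStab_of_lt_distance (CSSCode.mem_xLogical.2 hy) ?_)
    (smallClusters_sector hP (zEmb N mx) _ fun a b h => .inl ⟨a, b, h, rfl, rfl⟩)
  exact lt_of_lt_of_le (by exact_mod_cast hw) hd

/-- The `X` sector has `N = T - 1` code layers, so `m ≤ N + 1 = T` is exactly what `decode`
requires. The `Z` sector has one layer more and would allow `T + 1`. -/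
theorem decode_x (hdec : IsMinWeightDecoder R (N + 1) dec)
    (hmin : IsMinWeightResidual R (N + 1) dec Rmin) (hm : m ≤ N + 1)
    (hd : (m : ℕ∞) ≤ R.distance) (hP : P ∈ smallClusters R N m) :
    xResidue ((bulkPart P).2 + dec (bulkPart P).2) (Rmin (bulkPart P)).2 ∈ R.zStab ∧
    ∀ S : Finset (Bool × Fin n), S ⊆ vsupp (Rmin (bulkPart P)).2 → ∃ U,
      Rooted (rowAdj (sectorMatrix N R.HX)) (S.image fun q => .surf q.1 q.2) U ∧
      U.card ≤ 4 * (U ∩ vsupp (pull (xEmb N mz) (bulkPart P).2)).card ∧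
      S.card ≤ 2 * (U ∩ vsupp (pull (xEmb N mz) (bulkPart P).2)).card := by
  refine (isSectorDecoding_x hdec hmin (bulkPart P)).decode m (by omega) R.zStab
    (fun y hy hw => R.mem_zStab_of_lt_distance (CSSCode.mem_zLogical.2 hy) ?_)
    (smallClusters_sector hP (xEmb N mz) _ fun a b h => .inr ⟨a, b, h, rfl, rfl⟩)
  exact lt_of_lt_of_le (by exact_mod_cast hw) hd

theorem map_image_surf_z (S : Finset (Bool × Fin n)) :
    (S.image fun q => (.surf q.1 q.2 : SV (N + 1) n mz)).map (zEmb N mx) =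
      S.image (surfaceVertex (N + 1) mx mz) := by
  rw [Finset.map_eq_image, Finset.image_image]
  rfl

theorem map_image_surf_x (S : Finset (Bool × Fin n)) :
    (S.image fun q => (.surf q.1 q.2 : SV N n mx)).map (xEmb N mz) =
      S.image (surfaceVertex (N + 1) mx mz) := by
  rw [Finset.map_eq_image, Finset.image_image]
  rfl

/-- A set in the support of the residual error is covered by clusters of the error. -/
theorem exists_rooted_of_subset_supp (hdec : IsMinWeightDecoder R (N + 1) dec)
    (hmin : IsMinWeightResidual R (N + 1) dec Rmin) (hm : m ≤ N + 1)
    (hd : (m : ℕ∞) ≤ R.distance) (hP : P ∈ smallClusters R N m) (S : Finset (Bool × Fin n))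
    (hS : S ⊆ supp (Rmin (bulkPart P) + boundaryPart P)) :
    ∃ U, Rooted (syndromeAdj R N) (S.image (surfaceVertex (N + 1) mx mz)) U ∧
      U.card ≤ 4 * (supp P ∩ U).card ∧ 2 * S.card ≤ 4 * (supp P ∩ U).card := by
  classical
  set Sz := S.filter fun q => q ∈ vsupp (Rmin (bulkPart P)).1
  set Sx := S.filter fun q => q ∈ vsupp (Rmin (bulkPart P)).2
  set Sb := S.filter fun q => q ∈ supp (boundaryPart P) with hSb
  -- A boundary qubit is in the residual error because of its `X` part, its `Z` part or the error on
  -- the boundary itself; in the last case it is its own cluster.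
  have hcover : S = Sz ∪ Sx ∪ Sb := by
    refine Finset.Subset.antisymm (fun q hq => ?_) (Finset.union_subset (Finset.union_subset
      (Finset.filter_subset _ _) (Finset.filter_subset _ _)) (Finset.filter_subset _ _))
    have h1 := (Finset.mem_filter.1 (hS hq)).2
    simp only [Sz, Sx, hSb, Finset.mem_union, Finset.mem_filter, hq, true_and, mem_vsupp]
    by_contra hn
    push Not at hn
    obtain ⟨⟨h2, h3⟩, h4⟩ := hn
    have h5 : ¬((boundaryPart P).1 q ≠ 0 ∨ (boundaryPart P).2 q ≠ 0) := fun h =>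
      h4 (Finset.mem_filter.2 ⟨Finset.mem_univ _, h⟩)
    push Not at h5
    simp [h2, h3, h5.1, h5.2] at h1
  obtain ⟨Uz, hz1, hz2, hz3⟩ := (decode_z hdec hmin hm hd hP).2 Sz
    fun q hq => (Finset.mem_filter.1 hq).2
  obtain ⟨Ux, hx1, hx2, hx3⟩ := (decode_x hdec hmin hm hd hP).2 Sx
    fun q hq => (Finset.mem_filter.1 hq).2
  have hz4 := hz1.map (r' := syndromeAdj R N) (zEmb N mx) fun a b h => .inl ⟨a, b, h, rfl, rfl⟩
  have hx4 := hx1.map (r' := syndromeAdj R N) (xEmb N mz) fun a b h => .inr ⟨a, b, h, rfl, rfl⟩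
  rw [map_image_surf_z] at hz4
  rw [map_image_surf_x] at hx4
  set B := Sb.image (surfaceVertex (N + 1) mx mz) with hB
  have hBcard : B.card = Sb.card :=
    Finset.card_image_of_injective _ (Vertex.surfaceVertex_injective (by omega))
  refine ⟨Uz.map (zEmb N mx) ∪ Ux.map (xEmb N mz) ∪ B, ?_, ?_⟩
  · rw [hcover, Finset.image_union, Finset.image_union]
    exact (hz4.union hx4).union (Rooted.self _ _)
  set Ez := (Uz ∩ vsupp (pull (zEmb N mx) (bulkPart P).2)).map (zEmb N mx) with hEz
  set Ex := (Ux ∩ vsupp (pull (xEmb N mz) (bulkPart P).2)).map (xEmb N mz) with hEx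
  -- The covering sets may overlap on the surfaces, but the errors counted in them are bulk qubits
  -- of different sectors and boundary qubits. Being disjoint, the counts add.
  have hd1 : Disjoint Ez Ex := by
    rw [Finset.disjoint_left]
    intro v hv hv'
    obtain ⟨a, ha, rfl⟩ := Finset.mem_map.1 hv
    obtain ⟨b, hb, hab⟩ := Finset.mem_map.1 hv'
    obtain ⟨h, -⟩ := pull_ne_zero (mem_vsupp.1 (Finset.mem_inter.1 hb).2)
    exact toSurface_ne_none_of_zEmb_eq_xEmb hab.symm h
  have hd2 : Disjoint (Ez ∪ Ex) B := by
    rw [Finset.disjoint_left]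
    intro v hv hv'
    obtain ⟨q, -, rfl⟩ := Finset.mem_image.1 hv'
    rcases Finset.mem_union.1 hv with hv | hv
    · obtain ⟨a, ha, hq⟩ := Finset.mem_map.1 hv
      obtain ⟨h, -⟩ := pull_ne_zero (mem_vsupp.1 (Finset.mem_inter.1 ha).2)
      exact ne_surfaceVertex (by omega) h q hq
    · obtain ⟨a, ha, hq⟩ := Finset.mem_map.1 hv
      obtain ⟨h, -⟩ := pull_ne_zero (mem_vsupp.1 (Finset.mem_inter.1 ha).2)
      exact ne_surfaceVertex (by omega) h q hq
  have hsub : Ez ∪ Ex ∪ B ⊆ supp P ∩ (Uz.map (zEmb N mx) ∪ Ux.map (xEmb N mz) ∪ B) := by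
    refine Finset.union_subset (Finset.union_subset ?_ ?_) ?_
    · exact (map_inter_vsupp_pull_subset _ P Uz).trans (Finset.inter_subset_inter_left
        (Finset.subset_union_left.trans Finset.subset_union_left))
    · exact (map_inter_vsupp_pull_subset _ P Ux).trans (Finset.inter_subset_inter_left
        (Finset.subset_union_right.trans Finset.subset_union_left))
    · refine Finset.subset_inter (fun v hv => ?_) Finset.subset_union_right
      obtain ⟨q, hq, rfl⟩ := Finset.mem_image.1 hv
      have := (Finset.mem_filter.1 (Finset.mem_filter.1 hq).2).2
      exact Finset.mem_filter.2 ⟨Finset.mem_univ _, this⟩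
  have hc := Finset.card_le_card hsub
  rw [Finset.card_union_of_disjoint hd2, Finset.card_union_of_disjoint hd1, hEz, hEx,
    Finset.card_map, Finset.card_map] at hc
  have hu1 := Finset.card_union_le (Uz.map (zEmb N mx) ∪ Ux.map (xEmb N mz)) B
  have hu2 := Finset.card_union_le (Uz.map (zEmb N mx)) (Ux.map (xEmb N mz))
  rw [Finset.card_map, Finset.card_map] at hu2
  have hs1 := Finset.card_union_le (Sz ∪ Sx) Sb
  have hs2 := Finset.card_union_le Sz Sx
  rw [← hcover] at hs1
  omega

end Clusters

/-! ### The output state -/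

theorem CSSCode.SameCode.distance_eq {n mx mz : ℕ} {R Q : CSSCode n mx mz} (h : R.SameCode Q) :
    R.distance = Q.distance := by
  unfold CSSCode.distance
  rw [h.xLogical_eq, h.zLogical_eq, h.1, h.2]

section Output

variable {N n mx mz : ℕ} {R Q : CSSCode n mx mz}

/-- Signs of successive Pauli operators add up, so being stabilized becomes a linear equation over
`ZMod 2`. -/
theorem act_act_of_eigen {V : Type} [Fintype V] (P g : Pauli V) {ψ : State V} {a : ZMod 2}
    (h : act g ψ = sgn a • ψ) : act g (act P ψ) = sgn (symp P g + a) • act P ψ := by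
  rw [act_comm, h, act_smul, smul_smul, ← sgn_add, symp_comm]

theorem exists_eq_smul_act {V : Type} [Fintype V] (P : Pauli V) {χ φ : State V}
    (h : ∃ γ : ℂ, act P χ = γ • φ) : ∃ γ : ℂ, χ = γ • act P φ := by
  obtain ⟨γ, hγ⟩ := h
  refine ⟨sgn (P.2 ⬝ᵥ P.1) * γ, ?_⟩
  have h1 : act P (act P χ) = sgn (P.2 ⬝ᵥ P.1) • χ := by
    rw [act_act, show P + P = 0 from Prod.ext (vec_add_self _) (vec_add_self _), act_zero]
  rw [mul_smul, ← act_smul, ← hγ, h1, smul_smul, sgn_mul_self, one_smul]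

/-- The output is the encoded Bell state up to the residual error. -/
theorem exists_output_eq {dec : (Bulk (N + 1) n mx mz → ZMod 2) → Bulk (N + 1) n mx mz → ZMod 2}
    {Rec : (Bulk (N + 1) n mx mz → ZMod 2) → Pauli (Bool × Fin n)}
    {L : Fin Q.numLogical → Fin n → ZMod 2} (hRQ : R.SameCode Q)
    (hdec : IsMinWeightDecoder R (N + 1) dec) (hRec : IsPauliFrame R (N + 1) dec Rec)
    (hL : Q.IsLogicalBasis L) (P : Pauli (Vertex (N + 1) n mx mz)) (F : Pauli (Bool × Fin n))
    (hF : ∀ g ∈ bellGenerators R (N + 1),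
      symp F g.1 = g.2 ⬝ᵥ ((bulkPart P).2 + dec (bulkPart P).2) + symp (boundaryPart P) g.1)
    (s : Bulk (N + 1) n mx mz → ZMod 2) : ∃ γ : ℂ,
      act (Rec s) (measureBulk s (act P (graphState (atg R (N + 1))))) =
        γ • act F (Q.bellState L) := by
  have hT : 1 ≤ N + 1 := by omega
  set η := (bulkPart P).2 with hη
  rw [measureBulk_act hT, act_smul]
  set ψ := measureBulk (s + η) (graphState (atg R (N + 1))) with hψ
  by_cases hs : ∀ α ∈ metaChecks R (N + 1), α ⬝ᵥ (s + η) = 0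
  · have hds : dec s = dec η := hdec.2.2 s η fun α hα => by
      have := hs α hα
      rw [dotProduct_add] at this
      exact CharTwo.add_eq_zero.1 this
    obtain ⟨γ, hγ⟩ := exists_eq_smul_act F (exists_eq_smul_bellState hRQ (N + 1) hL
      (act F (act (Rec s) (act (boundaryPart P) ψ))) fun g hg => by
        have h1 := act_bellGenerator (R := R) hT (s + η) g hg
        rw [act_act_of_eigen _ _ (act_act_of_eigen _ _ (act_act_of_eigen _ _ h1)), hF g hg,
          hRec s g hg, hds]
        have : g.2 ⬝ᵥ (η + dec η) + symp (boundaryPart P) g.1 + (g.2 ⬝ᵥ s + g.2 ⬝ᵥ dec η +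
            (symp (boundaryPart P) g.1 + g.2 ⬝ᵥ (s + η))) = 0 := by
          rw [dotProduct_add, dotProduct_add]
          linear_combination (g.2 ⬝ᵥ η + g.2 ⬝ᵥ dec η + symp (boundaryPart P) g.1 + g.2 ⬝ᵥ s) *
            (CharTwo.two_eq_zero (R := ZMod 2))
        rw [this, sgn_zero, one_smul])
    rw [hγ, smul_smul]
    exact ⟨_, rfl⟩
  · push Not at hs
    obtain ⟨α, hα, h1⟩ := hs
    have h2 := measureBulk_eq_sgn_smul hT (s + η) α hα
    have h3 : ψ = 0 := by
      rw [← hψ, zmod2_eq_one h1, sgn, if_neg one_ne_zero, neg_one_smul] at h2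
      exact self_eq_neg.1 h2
    refine ⟨0, ?_⟩
    rw [h3, act_zero_state, act_zero_state, smul_zero, zero_smul]

end Output

/-! ### Probability bounds -/

section Bounds

variable {N n mx mz : ℕ} {R Q : CSSCode n mx mz} {Δ : ℕ}

/-- The rate is written as `r⁴` because only a quarter of a cluster need be error: each of its
qubits costs one factor `r`. A union bound over the root gives the number of vertices. -/
theorem prob_compl_smallClusters_le (hΔ : ∀ u, {v | syndromeAdj R N u v}.ncard ≤ Δ) (m : ℕ)
    (μ : PMF (Pauli (Vertex (N + 1) n mx mz))) {r : ℝ} (hr : 0 ≤ r)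
    (hsmall : 2 * 2 ^ (Δ + 1) * r ≤ 1) (hμ : IsLocalStochastic μ (r ^ 4)) :
    prob μ (smallClusters R N m)ᶜ ≤
      Fintype.card (Vertex (N + 1) n mx mz) * (2 * 2 ^ (Δ + 1) * r) ^ m := by
  have h : (smallClusters R N m)ᶜ ⊆ ⋃ v ∈ (Finset.univ : Finset (Vertex (N + 1) n mx mz)),
      {P | P ∈ Set.univ ∧ ∃ U, Rooted (syndromeAdj R N) {v} U ∧ U.card ≤ 4 * (supp P ∩ U).card ∧
        m ≤ 4 * (supp P ∩ U).card} := by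
    intro P hP
    by_contra hn
    refine hP fun v U hU hc => not_le.1 fun hmU => hn ?_
    exact Set.mem_biUnion (Finset.mem_coe.2 (Finset.mem_univ v))
      ⟨Set.mem_univ _, U, hU, hc, hmU.trans hc⟩
  refine (prob_mono μ h).trans ((prob_biUnion_le μ _ _).trans ?_)
  refine (Finset.sum_le_card_nsmul _ _ _ fun v _ => prob_rooted_le (syndromeAdj R N) Δ hΔ μ
    Set.univ supp 4 r hr hsmall (fun B => ?_) {v} m).trans ?_
  · simpa using hμ.2.2 B
  · rw [nsmul_eq_mul, Finset.card_univ]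

/-- The origin of `√p`: a set `S` in the residual forces at least `|S|/2` errors, so the Peierls
bound applies with `k = 2|S|` and yields `r² = √p` per qubit. -/
theorem prob_subset_supp_le
    {dec : (Bulk (N + 1) n mx mz → ZMod 2) → Bulk (N + 1) n mx mz → ZMod 2}
    {Rmin : Pauli (Bulk (N + 1) n mx mz) → Pauli (Bool × Fin n)}
    (hΔ : ∀ u, {v | syndromeAdj R N u v}.ncard ≤ Δ) (hdec : IsMinWeightDecoder R (N + 1) dec)
    (hmin : IsMinWeightResidual R (N + 1) dec Rmin) {m : ℕ} (hm : m ≤ N + 1)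
    (hd : (m : ℕ∞) ≤ R.distance)
    (μ : PMF (Pauli (Vertex (N + 1) n mx mz))) {r : ℝ} (hr : 0 ≤ r)
    (hsmall : 2 * 2 ^ (Δ + 1) * r ≤ 1) (hμ : IsLocalStochastic μ (r ^ 4))
    (S : Finset (Bool × Fin n)) :
    prob μ {P | P ∈ smallClusters R N m ∧ S ⊆ supp (Rmin (bulkPart P) + boundaryPart P)} ≤
      ((2 * 2 ^ (Δ + 1) * r) ^ 2) ^ S.card := by
  rw [← pow_mul]
  refine le_trans (prob_mono μ ?_) (prob_rooted_le (syndromeAdj R N) Δ hΔ μ Set.univ supp 4 r hr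
    hsmall (fun B => ?_) (S.image (surfaceVertex (N + 1) mx mz)) (2 * S.card))
  · rintro P ⟨h1, h2⟩
    exact ⟨Set.mem_univ _, exists_rooted_of_subset_supp hdec hmin hm hd h1 S h2⟩
  · simpa using hμ.2.2 B

/-- A minimum-weight vector with the same syndrome. -/
noncomputable def cosetLeader {m : ℕ} (H : Matrix (Fin m) (Fin n) (ZMod 2)) (z : Fin n → ZMod 2) :
    Fin n → ZMod 2 := minWeight fun y => H *ᵥ y = H *ᵥ z

theorem cosetLeader_spec {m : ℕ} (H : Matrix (Fin m) (Fin n) (ZMod 2)) (z : Fin n → ZMod 2) :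
    H *ᵥ cosetLeader H z = H *ᵥ z ∧
      ∀ y, H *ᵥ y = H *ᵥ z → hammingNorm (cosetLeader H z) ≤ hammingNorm y :=
  minWeight_spec (p := fun y => H *ᵥ y = H *ᵥ z) ⟨z, rfl⟩

theorem mulVec_add_cosetLeader {m : ℕ} (H : Matrix (Fin m) (Fin n) (ZMod 2))
    (z : Fin n → ZMod 2) : H *ᵥ (z + cosetLeader H z) = 0 := by
  rw [Matrix.mulVec_add, (cosetLeader_spec H z).1, vec_add_self]

theorem cosetLeader_congr {m : ℕ} (H : Matrix (Fin m) (Fin n) (ZMod 2)) {z z' : Fin n → ZMod 2}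
    (h : H *ᵥ (z + z') = 0) : cosetLeader H z = cosetLeader H z' := by
  rw [Matrix.mulVec_add] at h
  have : H *ᵥ z = H *ᵥ z' := funext fun c => CharTwo.add_eq_zero.1 (congrFun h c)
  rw [cosetLeader, cosetLeader, this]

/-- Here there is one minimality instead of two, so half of a failing cluster is error. The Peierls
bound is used with `a = 2`, and an error rate `ρ²` suffices. -/
theorem prob_add_cosetLeader_notMem_le {Ω : Type} {l : ℕ} (H : Matrix (Fin l) (Fin n) (ZMod 2))
    (hΔ : ∀ u, {v | rowAdj H u v}.ncard ≤ Δ) (m : ℕ)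
    (Stab : Submodule (ZMod 2) (Fin n → ZMod 2))
    (hStab : ∀ y, H *ᵥ y = 0 → hammingNorm y < m → y ∈ Stab) (μ : PMF Ω) (F : Set Ω)
    (x : Ω → Fin n → ZMod 2) {ρ : ℝ} (hρ : 0 ≤ ρ) (hsmall : 2 * 2 ^ (Δ + 1) * ρ ≤ 1)
    (hx : ∀ B : Finset (Fin n), prob μ {ω | ω ∈ F ∧ B ⊆ vsupp (x ω)} ≤ (ρ ^ 2) ^ B.card) :
    prob μ {ω | ω ∈ F ∧ x ω + cosetLeader H (x ω) ∉ Stab} ≤ n * (2 * 2 ^ (Δ + 1) * ρ) ^ m := by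
  have h : {ω | ω ∈ F ∧ x ω + cosetLeader H (x ω) ∉ Stab} ⊆
      ⋃ v ∈ (Finset.univ : Finset (Fin n)), {ω | ω ∈ F ∧ ∃ U, Rooted (rowAdj H) {v} U ∧
        U.card ≤ 2 * (vsupp (x ω) ∩ U).card ∧ m ≤ 2 * (vsupp (x ω) ∩ U).card} := by
    rintro ω ⟨hω, hne⟩
    obtain ⟨v, U, h1, h2, h3⟩ := exists_rooted_of_add_notMem H (x ω) (cosetLeader H (x ω))
      (cosetLeader_spec H _).1 (cosetLeader_spec H _).2 m Stab hStab hne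
    exact Set.mem_biUnion (Finset.mem_coe.2 (Finset.mem_univ v)) ⟨hω, U, h1, h2, h3.trans h2⟩
  refine (prob_mono μ h).trans ((prob_biUnion_le μ _ _).trans ?_)
  refine (Finset.sum_le_card_nsmul _ _ _ fun v _ => prob_rooted_le (rowAdj H) Δ hΔ μ
    F (fun ω => vsupp (x ω)) 2 ρ hρ hsmall hx {v} m).trans ?_
  rw [nsmul_eq_mul, Finset.card_univ, Fintype.card_fin]

/-- The constants: with `r = p^(1/4)` and `R₀ = 1/(56A²)` one has `4A²r = (r/R₀)/14`. For `m =
min(T,d) ≥ 1` the factor `7·14^(-m)` is at most `1/2`, which leaves half of `nT (p/p*)^(m/4)`. Also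
`(2Ar)² = 4A²√p` is half of `C√p`. The prefactor is `6nT` for the qubits of the graph plus at most
`nT` for decoding a measured surface. -/
theorem guarantee_of_cluster_bounds {V W : Type} [Fintype V] [Fintype W] {A : ℝ} (hA : 1 ≤ A)
    {T : ℕ} {d : ℕ∞} {Succ : Set (Pauli V)} {Rep : Pauli V → Pauli W}
    (hm : 1 ≤ (min (T : ℕ∞) d).toNat)
    (h1 : ∀ (r : ℝ) (μ : PMF (Pauli V)), 0 ≤ r → 4 * A ^ 2 * r ≤ 1 → IsLocalStochastic μ (r ^ 4) →
      prob μ Succᶜ ≤ 7 * (n * T) * (4 * A ^ 2 * r) ^ (min (T : ℕ∞) d).toNat)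
    (h2 : ∀ (r : ℝ) (μ : PMF (Pauli V)), 0 ≤ r → 4 * A ^ 2 * r ≤ 1 → IsLocalStochastic μ (r ^ 4) →
      ∀ S : Finset W, prob μ {P | P ∈ Succ ∧ S ⊆ supp (Rep P)} ≤ ((2 * A * r) ^ 2) ^ S.card) :
    Guarantee (1 / 4) ((1 / (56 * A ^ 2)) ^ 4) (8 * A ^ 2) n T d Succ Rep := by
  have hA0 : 0 < A := by linarith
  have hA2 : 1 ≤ A ^ 2 := one_le_pow₀ hA
  set R₀ : ℝ := 1 / (56 * A ^ 2) with hR₀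
  have hR₀pos : 0 < R₀ := by positivity
  have hroot : ∀ p : ℝ, 0 ≤ p → p < R₀ ^ 4 → ∃ r, 0 ≤ r ∧ r ^ 4 = p ∧ r < R₀ ∧
      Real.sqrt p = r ^ 2 ∧ 4 * A ^ 2 * r ≤ 1 := by
    intro p hp hlt
    have hr4 : Real.sqrt (Real.sqrt p) ^ 4 = p := by
      rw [show 4 = 2 * 2 from rfl, pow_mul, Real.sq_sqrt (Real.sqrt_nonneg _), Real.sq_sqrt hp]
    have hlt' : Real.sqrt (Real.sqrt p) < R₀ := by
      rw [← hr4] at hlt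
      exact lt_of_pow_lt_pow_left₀ 4 hR₀pos.le hlt
    refine ⟨_, Real.sqrt_nonneg _, hr4, hlt', (Real.sq_sqrt (Real.sqrt_nonneg _)).symm, ?_⟩
    have : 4 * A ^ 2 * R₀ = 1 / 14 := by rw [hR₀]; field_simp; norm_num
    have h4 : 4 * A ^ 2 * Real.sqrt (Real.sqrt p) ≤ 4 * A ^ 2 * R₀ :=
      mul_le_mul_of_nonneg_left hlt'.le (by positivity)
    linarith
  refine guarantee_of_bounds (by positivity) ?_ (fun p μ hp hμ => ?_) fun p μ hp hμ S => ?_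
  · rw [show R₀ ^ 4 = (R₀ ^ 2) ^ 2 by ring, Real.sqrt_sq (by positivity), hR₀]
    rw [div_pow, one_pow, mul_one_div, div_le_one (by positivity)]
    nlinarith
  · obtain ⟨r, hr, rfl, hlt, -, hsmall⟩ := hroot p hμ.1 hp
    have h3 := h1 r μ hr hsmall hμ
    have h4 := one_le_prob_add_prob_compl μ Succ
    set m := (min (T : ℕ∞) d).toNat
    have h5 : (r ^ 4 / R₀ ^ 4) ^ (1 / 4 * (m : ℝ)) = (r / R₀) ^ m := by
      rw [← div_pow, ← Real.rpow_natCast (r / R₀) 4, ← Real.rpow_mul (by positivity),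
        ← Real.rpow_natCast]
      congr 1
      push_cast
      ring
    have h6 : 4 * A ^ 2 * r = 1 / 14 * (r / R₀) := by rw [hR₀]; field_simp; ring
    have h7 : (1 / 14 : ℝ) ^ m ≤ 1 / 14 := pow_le_of_le_one (by norm_num) (by norm_num) (by omega)
    rw [h5]
    rw [h6, mul_pow] at h3
    have h8 : 0 ≤ (n * T : ℝ) * (r / R₀) ^ m := by positivity
    have h9 : 7 * (n * T : ℝ) * ((1 / 14) ^ m * (r / R₀) ^ m) ≤ n * T * (r / R₀) ^ m / 2 := by
      nlinarith
    linarith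
  · obtain ⟨r, hr, rfl, -, hsq, hsmall⟩ := hroot p hμ.1 hp
    refine (h2 r μ hr hsmall hμ S).trans_eq ?_
    rw [hsq]
    congr 1
    ring

end Bounds

/-! ### Measuring the second surface -/

section Preparation

variable {n mx mz : ℕ} {R Q : CSSCode n mx mz}

theorem measureStandard_smul (z : Fin n → ZMod 2) (a : ℂ) (φ : State (Bool × Fin n)) :
    measureStandard z (a • φ) = a • measureStandard z φ := rfl

theorem measureHadamard_smul (z : Fin n → ZMod 2) (a : ℂ) (φ : State (Bool × Fin n)) :
    measureHadamard z (a • φ) = a • measureHadamard z φ := by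
  funext y
  simp only [measureHadamard, Pi.smul_apply, smul_eq_mul, Finset.mul_sum]
  refine Finset.sum_congr rfl fun b _ => ?_
  ring

theorem exists_smul_smul {V : Type} {χ χ' φ : State V} (γ : ℂ) (h : χ = γ • χ')
    (h' : ∃ γ : ℂ, χ' = γ • φ) : ∃ γ : ℂ, χ = γ • φ := by
  obtain ⟨γ', rfl⟩ := h'
  exact ⟨γ * γ', by rw [h, smul_smul]⟩

theorem card_image_surface (σ : Bool) (B : Finset (Fin n)) :
    (B.image fun i => (σ, i)).card = B.card :=
  Finset.card_image_of_injective _ fun _ _ h => (Prod.mk.inj h).2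

theorem image_subset_supp_iff (σ : Bool) (B : Finset (Fin n)) (P : Pauli (Bool × Fin n)) :
    (B.image fun i => (σ, i)) ⊆ supp P ↔ B ⊆ supp (onSurface σ P) := by
  simp only [Finset.subset_iff, Finset.forall_mem_image, supp, Finset.mem_filter, Finset.mem_univ,
    true_and]
  rfl

variable {V : Type} [Fintype V] {Δ T : ℕ} {Succ : Set (Pauli V)}
  {Rep : Pauli V → Pauli (Bool × Fin n)}

/-- Bounds on the success probability and on the residual error that the corrected measurement of
one surface turns into guarantees. -/
structure ClusterBounds (Δ T : ℕ) (d : ℕ∞) (Succ : Set (Pauli V))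
    (Rep : Pauli V → Pauli (Bool × Fin n)) : Prop where
  fail : ∀ (r : ℝ) (μ : PMF (Pauli V)), 0 ≤ r → 4 * (2 ^ (Δ + 1)) ^ 2 * r ≤ 1 →
    IsLocalStochastic μ (r ^ 4) → prob μ Succᶜ ≤
      6 * (n * T) * (2 * 2 ^ (Δ + 1) * r) ^ (min (T : ℕ∞) d).toNat
  residual : ∀ (r : ℝ) (μ : PMF (Pauli V)), 0 ≤ r → 4 * (2 ^ (Δ + 1)) ^ 2 * r ≤ 1 →
    IsLocalStochastic μ (r ^ 4) → ∀ S : Finset (Bool × Fin n),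
      prob μ {P | P ∈ Succ ∧ S ⊆ supp (Rep P)} ≤ ((2 * 2 ^ (Δ + 1) * r) ^ 2) ^ S.card

theorem one_le_two_pow_real (k : ℕ) : (1 : ℝ) ≤ 2 ^ k := one_le_pow₀ (by norm_num)

theorem pow_scale_le {A r : ℝ} (hA : 1 ≤ A) (hr : 0 ≤ r) (m : ℕ) :
    (2 * A * r) ^ m ≤ (4 * A ^ 2 * r) ^ m := by
  refine pow_le_pow_left₀ (by positivity) (mul_le_mul_of_nonneg_right ?_ hr) m
  nlinarith

theorem ClusterBounds.guarantee {d : ℕ∞} (h : ClusterBounds Δ T d Succ Rep)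
    (hm : 1 ≤ (min (T : ℕ∞) d).toNat) :
    Guarantee (1 / 4) ((1 / (56 * (2 ^ (Δ + 1)) ^ 2)) ^ 4) (8 * (2 ^ (Δ + 1)) ^ 2) n T d Succ
      Rep := by
  refine guarantee_of_cluster_bounds (one_le_two_pow_real _) hm (fun r μ hr hs hμ => ?_) h.residual
  refine (h.fail r μ hr hs hμ).trans ?_
  have := pow_scale_le (one_le_two_pow_real (Δ + 1)) hr (min (T : ℕ∞) d).toNat
  have h0 : (0 : ℝ) ≤ n * T := by positivity
  have h1 : (0 : ℝ) ≤ (4 * (2 ^ (Δ + 1)) ^ 2 * r) ^ (min (T : ℕ∞) d).toNat := by positivity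
  nlinarith [mul_le_mul_of_nonneg_left this h0, mul_nonneg h0 h1]

/-- Decoding the outcome of a measurement of the second surface, whose error is `x P`. -/
theorem ClusterBounds.guarantee_onSurface {d : ℕ∞} (h : ClusterBounds Δ T d Succ Rep) (hT : 1 ≤ T)
    (hm : 1 ≤ (min (T : ℕ∞) d).toNat) {l : ℕ} (H : Matrix (Fin l) (Fin n) (ZMod 2))
    (hΔ : ∀ u, {v | rowAdj H u v}.ncard ≤ Δ) (Stab : Submodule (ZMod 2) (Fin n → ZMod 2))
    (hStab : ∀ y, H *ᵥ y = 0 → hammingNorm y < (min (T : ℕ∞) d).toNat → y ∈ Stab)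
    (x : Pauli V → Fin n → ZMod 2) (hx : ∀ P, vsupp (x P) ⊆ supp (onSurface true (Rep P)))
    (Rep' : Pauli V → Pauli (Fin n))
    (hRep' : ∀ P, x P + cosetLeader H (x P) ∈ Stab → Rep' P = onSurface false (Rep P)) :
    Guarantee (1 / 4) ((1 / (56 * (2 ^ (Δ + 1)) ^ 2)) ^ 4) (8 * (2 ^ (Δ + 1)) ^ 2) n T d
      {P | P ∈ Succ ∧ x P + cosetLeader H (x P) ∈ Stab} Rep' := by
  refine guarantee_of_cluster_bounds (one_le_two_pow_real _) hm (fun r μ hr hs hμ => ?_)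
    fun r μ hr hs hμ S => ?_
  · set A : ℝ := 2 ^ (Δ + 1) with hA
    set m := (min (T : ℕ∞) d).toNat
    have hA1 : 1 ≤ A := one_le_two_pow_real _
    have h1 := h.fail r μ hr hs hμ
    -- On success the residual has rate `(2Ar)²`, so `ρ = 2Ar`, and the Peierls bound multiplies it
    -- by another `2A`. Hence the quantity `4A²r`.
    have h2 := prob_add_cosetLeader_notMem_le H hΔ m Stab hStab μ Succ x
      (ρ := 2 * 2 ^ (Δ + 1) * r) (by positivity) (by linarith) fun B => by
        have := h.residual r μ hr hs hμ (B.image fun i => (true, i))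
        rw [card_image_surface] at this
        refine (prob_mono μ ?_).trans this
        rintro P ⟨hP, hB⟩
        exact ⟨hP, (image_subset_supp_iff true B _).2 (hB.trans (hx P))⟩
    have h3 : {P | P ∈ Succ ∧ x P + cosetLeader H (x P) ∈ Stab}ᶜ ⊆
        Succᶜ ∪ {P | P ∈ Succ ∧ x P + cosetLeader H (x P) ∉ Stab} := by
      intro P hP
      by_cases hS : P ∈ Succ
      · exact .inr ⟨hS, fun hs => hP ⟨hS, hs⟩⟩
      · exact .inl hS
    refine (prob_mono μ h3).trans ((prob_union_le μ _ _).trans ((add_le_add h1 h2).trans ?_))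
    rw [← hA, show 2 * A * (2 * A * r) = 4 * A ^ 2 * r by ring]
    have h4 := pow_scale_le hA1 hr m
    have h5 : (0 : ℝ) ≤ n * T := by positivity
    have h6 : (0 : ℝ) ≤ (4 * A ^ 2 * r) ^ m := by positivity
    have h7 : (n : ℝ) ≤ n * T :=
      le_mul_of_one_le_right (by positivity) (by exact_mod_cast hT)
    nlinarith [mul_le_mul_of_nonneg_left h4 h5, mul_le_mul_of_nonneg_right h7 h6]
  · have := h.residual r μ hr hs hμ (S.image fun i => (false, i))
    rw [card_image_surface] at this
    refine (prob_mono μ ?_).trans this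
    rintro P ⟨⟨hP, hw⟩, hS⟩
    rw [hRep' P hw] at hS
    exact ⟨hP, (image_subset_supp_iff false S _).2 hS⟩

variable {ι : Type} {out : Pauli V → ι → State (Bool × Fin n)}
  {L : Fin Q.numLogical → Fin n → ZMod 2}

-- The outcome is corrected by `z` plus a coset leader, which depends on the syndrome of `z` only.
-- What remains of the residual `x P` on the second surface is `w P`, a logical operator; it acts
-- trivially on `|0̄⟩` when it is a stabilizer, and this is the additional success condition.
open Classical in
theorem exists_standard_preparation (hRQ : R.SameCode Q) (hL : Q.IsLogicalBasis L) (hT : 1 ≤ T)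
    (hm : 1 ≤ (min (T : ℕ∞) Q.distance).toNat) (hΔ : ∀ u, {v | rowAdj R.HZ u v}.ncard ≤ Δ)
    (h : ClusterBounds Δ T Q.distance Succ Rep)
    (hout : ∀ P s, ∃ γ : ℂ, out P s = γ • act (Rep P) (Q.bellState L)) :
    ∃ (corr : (Fin n → ZMod 2) → (Fin n → ZMod 2)) (Rep₀ : Pauli V → Pauli (Fin n))
      (Succ₀ : Set (Pauli V)), (∀ z, corr z ∈ Q.xLogical) ∧
      (∀ P s z, ∃ γ : ℂ, act (corr z, 0) (measureStandard z (out P s)) =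
        γ • act (Rep₀ P) (Q.encodedZero L)) ∧
      (∀ P ∈ Succ₀, P ∈ Succ ∧ Rep₀ P = onSurface false (Rep P)) ∧
      Guarantee (1 / 4) ((1 / (56 * (2 ^ (Δ + 1)) ^ 2)) ^ 4) (8 * (2 ^ (Δ + 1)) ^ 2) n T Q.distance
        Succ₀ Rep₀ := by
  have hmd : ((min (T : ℕ∞) Q.distance).toNat : ℕ∞) ≤ Q.distance :=
    (ENat.natCast_toNat_le_self _).trans (min_le_right _ _)
  let x : Pauli V → Fin n → ZMod 2 := fun P => (onSurface true (Rep P)).1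
  let w : Pauli V → Fin n → ZMod 2 := fun P => x P + cosetLeader R.HZ (x P)
  -- On failure the whole logical operator is charged to the error; on success nothing is.
  let r : Pauli V → Fin n → ZMod 2 := fun P => if w P ∈ Q.xStab then 0 else w P
  have hRep' : ∀ P, w P ∈ Q.xStab → onSurface false (Rep P) + (r P, 0) = onSurface false (Rep P) :=
    fun P hP => by rw [show r P = 0 from if_pos hP]; exact add_zero _
  refine ⟨fun z => z + cosetLeader R.HZ z, fun P => onSurface false (Rep P) + (r P, 0),
    {P | P ∈ Succ ∧ w P ∈ Q.xStab}, fun z => ?_, fun P s z => ?_, fun P hP => ⟨hP.1, hRep' P hP.2⟩,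
    h.guarantee_onSurface hT hm R.HZ hΔ Q.xStab (fun y hy hw => ?_) x (fun P i hi => ?_) _ hRep'⟩
  · rw [← hRQ.xLogical_eq, CSSCode.mem_xLogical]
    exact mulVec_add_cosetLeader R.HZ z
  · obtain ⟨γ, hγ⟩ := hout P s
    refine exists_smul_smul γ (by rw [hγ, measureStandard_smul, act_smul])
      (correct_measureStandard hL (cosetLeader R.HZ) (fun z z' hz => ?_) (Rep P) (r P) ?_ z)
    · rw [← hRQ.xLogical_eq, CSSCode.mem_xLogical] at hz
      exact cosetLeader_congr R.HZ hz
    · change w P + r P ∈ Q.xStab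
      by_cases hw : w P ∈ Q.xStab
      · rw [show r P = 0 from if_pos hw, add_zero]; exact hw
      · rw [show r P = w P from if_neg hw, vec_add_self]; exact Submodule.zero_mem _
  · refine Q.mem_xStab_of_lt_distance ?_ (lt_of_lt_of_le (by exact_mod_cast hw) hmd)
    rw [← hRQ.xLogical_eq]
    exact CSSCode.mem_xLogical.2 hy
  · exact Finset.mem_filter.2 ⟨Finset.mem_univ _, .inl (mem_vsupp.1 hi)⟩

open Classical in
theorem exists_hadamard_preparation (hRQ : R.SameCode Q) (hL : Q.IsLogicalBasis L) (hT : 1 ≤ T)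
    (hm : 1 ≤ (min (T : ℕ∞) Q.distance).toNat) (hΔ : ∀ u, {v | rowAdj R.HX u v}.ncard ≤ Δ)
    (h : ClusterBounds Δ T Q.distance Succ Rep)
    (hout : ∀ P s, ∃ γ : ℂ, out P s = γ • act (Rep P) (Q.bellState L)) :
    ∃ (corr : (Fin n → ZMod 2) → (Fin n → ZMod 2)) (Rep₁ : Pauli V → Pauli (Fin n))
      (Succ₁ : Set (Pauli V)), (∀ z, corr z ∈ Q.zLogical) ∧
      (∀ P s z, ∃ γ : ℂ, act (0, corr z) (measureHadamard z (out P s)) =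
        γ • act (Rep₁ P) (Q.encodedPlus L)) ∧
      (∀ P ∈ Succ₁, P ∈ Succ ∧ Rep₁ P = onSurface false (Rep P)) ∧
      Guarantee (1 / 4) ((1 / (56 * (2 ^ (Δ + 1)) ^ 2)) ^ 4) (8 * (2 ^ (Δ + 1)) ^ 2) n T Q.distance
        Succ₁ Rep₁ := by
  have hmd : ((min (T : ℕ∞) Q.distance).toNat : ℕ∞) ≤ Q.distance :=
    (ENat.natCast_toNat_le_self _).trans (min_le_right _ _)
  let x : Pauli V → Fin n → ZMod 2 := fun P => (onSurface true (Rep P)).2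
  let w : Pauli V → Fin n → ZMod 2 := fun P => x P + cosetLeader R.HX (x P)
  let r : Pauli V → Fin n → ZMod 2 := fun P => if w P ∈ Q.zStab then 0 else w P
  have hRep' : ∀ P, w P ∈ Q.zStab → onSurface false (Rep P) + (0, r P) = onSurface false (Rep P) :=
    fun P hP => by rw [show r P = 0 from if_pos hP]; exact add_zero _
  refine ⟨fun z => z + cosetLeader R.HX z, fun P => onSurface false (Rep P) + (0, r P),
    {P | P ∈ Succ ∧ w P ∈ Q.zStab}, fun z => ?_, fun P s z => ?_, fun P hP => ⟨hP.1, hRep' P hP.2⟩,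
    h.guarantee_onSurface hT hm R.HX hΔ Q.zStab (fun y hy hw => ?_) x (fun P i hi => ?_) _ hRep'⟩
  · rw [← hRQ.zLogical_eq, CSSCode.mem_zLogical]
    exact mulVec_add_cosetLeader R.HX z
  · obtain ⟨γ, hγ⟩ := hout P s
    refine exists_smul_smul γ (by rw [hγ, measureHadamard_smul, act_smul])
      (correct_measureHadamard hL (cosetLeader R.HX) (fun z z' hz => ?_) (Rep P) (r P) ?_ z)
    · rw [← hRQ.zLogical_eq, CSSCode.mem_zLogical] at hz
      exact cosetLeader_congr R.HX hz
    · change w P + r P ∈ Q.zStab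
      by_cases hw : w P ∈ Q.zStab
      · rw [show r P = 0 from if_pos hw, add_zero]; exact hw
      · rw [show r P = w P from if_neg hw, vec_add_self]; exact Submodule.zero_mem _
  · refine Q.mem_zStab_of_lt_distance ?_ (lt_of_lt_of_le (by exact_mod_cast hw) hmd)
    rw [← hRQ.zLogical_eq]
    exact CSSCode.mem_zLogical.2 hy
  · exact Finset.mem_filter.2 ⟨Finset.mem_univ _, .inr (mem_vsupp.1 hi)⟩

end Preparation

/-! ### The residual error -/

section Residual

variable {N n mx mz : ℕ} {R Q : CSSCode n mx mz}
  {dec : (Bulk (N + 1) n mx mz → ZMod 2) → Bulk (N + 1) n mx mz → ZMod 2}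
  {Rec : (Bulk (N + 1) n mx mz → ZMod 2) → Pauli (Bool × Fin n)}
  {Rmin : Pauli (Bulk (N + 1) n mx mz) → Pauli (Bool × Fin n)}
  {L : Fin Q.numLogical → Fin n → ZMod 2}

open Classical in
/-- The residual error is the minimum-weight one up to a logical operator on the first surface,
which is trivial if the clusters of the error are small. -/
theorem exists_residual {Δ : ℕ} (hRQ : R.SameCode Q)
    (hΔ : ∀ u, {v | syndromeAdj R N u v}.ncard ≤ Δ) (hdec : IsMinWeightDecoder R (N + 1) dec)
    (hRec : IsPauliFrame R (N + 1) dec Rec) (hmin : IsMinWeightResidual R (N + 1) dec Rmin)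
    (hL : Q.IsLogicalBasis L) :
    ∃ (Rep : Pauli (Vertex (N + 1) n mx mz) → Pauli (Bool × Fin n))
      (Succ : Set (Pauli (Vertex (N + 1) n mx mz))),
      (∀ P s, ∃ γ : ℂ, act (Rec s) (measureBulk s (act P (graphState (atg R (N + 1))))) =
        γ • act (Rep P) (Q.bellState L)) ∧
      (∀ P, ∃ a ∈ Q.xLogical, ∃ b ∈ Q.zLogical,
        Rep P = Rmin (bulkPart P) + boundaryPart P + (twoSurfaces a 0, twoSurfaces b 0) ∧
        (P ∈ Succ → a = 0 ∧ b = 0)) ∧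
      ClusterBounds Δ (N + 1) Q.distance Succ Rep := by
  set m := (min ((N + 1 : ℕ) : ℕ∞) Q.distance).toNat with hm
  have hmd : (m : ℕ∞) ≤ R.distance := by
    rw [hRQ.distance_eq]
    exact (ENat.natCast_toNat_le_self _).trans (min_le_right _ _)
  have hmN : m ≤ N + 1 := by
    have : (m : ℕ∞) ≤ (N + 1 : ℕ) := (ENat.natCast_toNat_le_self _).trans (min_le_left _ _)
    exact_mod_cast this
  let y : Pauli (Vertex (N + 1) n mx mz) → Fin n → ZMod 2 := fun P =>
    zResidue ((bulkPart P).2 + dec (bulkPart P).2) (Rmin (bulkPart P)).1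
  let y' : Pauli (Vertex (N + 1) n mx mz) → Fin n → ZMod 2 := fun P =>
    xResidue ((bulkPart P).2 + dec (bulkPart P).2) (Rmin (bulkPart P)).2
  -- In either case `a + y` is a stabilizer, as `symp_bellGenerator` needs; the case distinction
  -- makes the logical operator exactly zero on success.
  let a : Pauli (Vertex (N + 1) n mx mz) → Fin n → ZMod 2 := fun P =>
    if y P ∈ R.xStab then 0 else y P
  let b : Pauli (Vertex (N + 1) n mx mz) → Fin n → ZMod 2 := fun P =>
    if y' P ∈ R.zStab then 0 else y' P
  have hF := fun P => (isMinWeightResidual_iff.1 hmin (bulkPart P)).1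
  have hy : ∀ P, y P ∈ R.xLogical := fun P =>
    (hF P).zResidue_mem (meta_dotProduct_add_dec hdec (bulkPart P).2)
  have hy' : ∀ P, y' P ∈ R.zLogical := fun P =>
    (hF P).xResidue_mem (meta_dotProduct_add_dec hdec (bulkPart P).2)
  have ha : ∀ P, a P ∈ R.xLogical ∧ a P + y P ∈ R.xStab := fun P => by
    by_cases h : y P ∈ R.xStab
    · rw [show a P = 0 from if_pos h, zero_add]; exact ⟨Submodule.zero_mem _, h⟩
    · rw [show a P = y P from if_neg h, vec_add_self]; exact ⟨hy P, Submodule.zero_mem _⟩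
  have hb : ∀ P, b P ∈ R.zLogical ∧ b P + y' P ∈ R.zStab := fun P => by
    by_cases h : y' P ∈ R.zStab
    · rw [show b P = 0 from if_pos h, zero_add]; exact ⟨Submodule.zero_mem _, h⟩
    · rw [show b P = y' P from if_neg h, vec_add_self]; exact ⟨hy' P, Submodule.zero_mem _⟩
  have h0 : ∀ P ∈ smallClusters R N m, a P = 0 ∧ b P = 0 := fun P hP =>
    ⟨if_pos (decode_z hdec hmin hmN hmd hP).1, if_pos (decode_x hdec hmin hmN hmd hP).1⟩
  refine ⟨fun P => Rmin (bulkPart P) + boundaryPart P + (twoSurfaces (a P) 0, twoSurfaces (b P) 0),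
    smallClusters R N m, fun P s => exists_output_eq hRQ hdec hRec hL P _ (fun g hg => ?_) s,
    fun P => ⟨a P, hRQ.xLogical_eq ▸ (ha P).1, b P, hRQ.zLogical_eq ▸ (hb P).1, rfl, h0 P⟩, ?_⟩
  · simp only
    rw [add_right_comm, symp_add_left,
      (hF P).symp_bellGenerator (ha P).1 (hb P).1 (ha P).2 (hb P).2 g hg]
  · have hA := one_le_two_pow_real (Δ + 1)
    have hsmall : ∀ r : ℝ, 0 ≤ r → 4 * (2 ^ (Δ + 1)) ^ 2 * r ≤ 1 → 2 * 2 ^ (Δ + 1) * r ≤ 1 :=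
      fun r hr h => by simpa using (pow_scale_le hA hr 1).trans (by simpa using h)
    constructor
    · intro r μ hr hs hμ
      refine (prob_compl_smallClusters_le hΔ m μ hr (hsmall r hr hs) hμ).trans
        (mul_le_mul_of_nonneg_right ?_ (by positivity))
      exact_mod_cast card_vertex_le R (N + 1) (by omega)
    · intro r μ hr hs hμ S
      refine (prob_mono μ ?_).trans
        (prob_subset_supp_le hΔ hdec hmin hmN hmd μ hr (hsmall r hr hs) hμ S)
      rintro P ⟨hP, hS⟩
      refine ⟨hP, ?_⟩
      have h1 : twoSurfaces (0 : Fin n → ZMod 2) 0 = 0 := by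
        funext q; simp [twoSurfaces]
      rw [(h0 P hP).1, (h0 P hP).2, h1] at hS
      rwa [show ((0, 0) : Pauli (Bool × Fin n)) = 0 from rfl, add_zero] at hS

end Residual

end SSSP

/-! ### Assembly of the main theorem -/

theorem mainTheorem1 :
    ∃ (c : ℝ) (K : ℕ), 0 < c ∧ ∀ ℓ : ℕ, 1 ≤ ℓ →
    ∃ pstar C : ℝ, 0 < pstar ∧ pstar < 1 ∧ 0 < C ∧
    ∀ (T : ℕ), 1 ≤ T → ∀ (n mx mz : ℕ) (Q : CSSCode n mx mz), Q.IsLDPC ℓ →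
    -- the code has a sparse presentation by full-rank check matrices
    (∃ R : CSSCode n mx mz, R.SameCode Q ∧ R.IsSparse ℓ) ∧
    -- and every such presentation yields a single-shot state preparation procedure
    ∀ R : CSSCode n mx mz, R.SameCode Q → R.IsSparse ℓ →
      -- number of qubits
      Fintype.card (Vertex T n mx mz) ≤ K * (ℓ * n * T) ∧
      -- depth of the circuit that prepares the alternating Tanner graph state
      (∃ W : Circuit (Vertex T n mx mz), W.WellFormed ∧ W.length ≤ K * ℓ ^ 2 ∧
        W.run (zeroState (Vertex T n mx mz)) = graphState (atg R T)) ∧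
      -- a logical basis, the minimum-weight decoder, the Pauli frame and the minimum-weight
      -- residual exist
      (∃ L, Q.IsLogicalBasis L) ∧
      (∃ dec, IsMinWeightDecoder R T dec) ∧
      (∀ dec, IsMinWeightDecoder R T dec →
        (∃ Rec, IsPauliFrame R T dec Rec) ∧ ∃ Rmin, IsMinWeightResidual R T dec Rmin) ∧
      -- and for all choices of them, including the logical basis
      ∀ (dec : (Bulk T n mx mz → ZMod 2) → (Bulk T n mx mz → ZMod 2))
        (Rec : (Bulk T n mx mz → ZMod 2) → Pauli (Bool × Fin n))
        (Rmin : Pauli (Bulk T n mx mz) → Pauli (Bool × Fin n))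
        (L : Fin Q.numLogical → Fin n → ZMod 2),
        IsMinWeightDecoder R T dec → IsPauliFrame R T dec Rec →
        IsMinWeightResidual R T dec Rmin → Q.IsLogicalBasis L →
        ∃ (Rep : Pauli (Vertex T n mx mz) → Pauli (Bool × Fin n))
          (Succ : Set (Pauli (Vertex T n mx mz))),
          -- the output is the encoded Bell state up to the residual error
          (∀ P s, ∃ γ : ℂ, act (Rec s) (measureBulk s (act P (graphState (atg R T)))) =
            γ • act (Rep P) (Q.bellState L)) ∧
          -- the residual error is the minimum-weight one up to a logical operator on the first
          -- surface, which is trivial in case of success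
          (∀ P, ∃ a ∈ Q.xLogical, ∃ b ∈ Q.zLogical,
            Rep P = Rmin (bulkPart P) + boundaryPart P + (twoSurfaces a 0, twoSurfaces b 0) ∧
            (P ∈ Succ → a = 0 ∧ b = 0)) ∧
          Guarantee c pstar C n T Q.distance Succ Rep ∧
          -- measuring the second surface in the standard basis prepares the encoded zero state
          (∃ (corr : (Fin n → ZMod 2) → (Fin n → ZMod 2))
            (Rep₀ : Pauli (Vertex T n mx mz) → Pauli (Fin n))
            (Succ₀ : Set (Pauli (Vertex T n mx mz))),
            (∀ z, corr z ∈ Q.xLogical) ∧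
            (∀ P s z, ∃ γ : ℂ, act (corr z, 0) (measureStandard z
                (act (Rec s) (measureBulk s (act P (graphState (atg R T)))))) =
              γ • act (Rep₀ P) (Q.encodedZero L)) ∧
            (∀ P ∈ Succ₀, P ∈ Succ ∧ Rep₀ P = onSurface false (Rep P)) ∧
            Guarantee c pstar C n T Q.distance Succ₀ Rep₀) ∧
          -- measuring the second surface in the Hadamard basis prepares the encoded plus state
          (∃ (corr : (Fin n → ZMod 2) → (Fin n → ZMod 2))
            (Rep₁ : Pauli (Vertex T n mx mz) → Pauli (Fin n))
            (Succ₁ : Set (Pauli (Vertex T n mx mz))),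
            (∀ z, corr z ∈ Q.zLogical) ∧
            (∀ P s z, ∃ γ : ℂ, act (0, corr z) (measureHadamard z
                (act (Rec s) (measureBulk s (act P (graphState (atg R T)))))) =
              γ • act (Rep₁ P) (Q.encodedPlus L)) ∧
            (∀ P ∈ Succ₁, P ∈ Succ ∧ Rep₁ P = onSurface false (Rep P)) ∧
            Guarantee c pstar C n T Q.distance Succ₁ Rep₁) := by
  refine ⟨1 / 4, 6, by norm_num, fun ℓ hℓ => ?_⟩
  -- Column weight times row weight of a sector matrix, for two sectors.
  set Δ := 2 * ((ℓ + 4) * (ℓ + 2)) with hΔdef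
  have hA := one_le_two_pow_real (Δ + 1)
  have hp : (1 / (56 * (2 ^ (Δ + 1)) ^ 2) : ℝ) < 1 := by
    rw [div_lt_one (by positivity)]
    nlinarith
  refine ⟨(1 / (56 * (2 ^ (Δ + 1)) ^ 2)) ^ 4, 8 * (2 ^ (Δ + 1)) ^ 2, by positivity,
    pow_lt_one₀ (by positivity) hp (by norm_num), by positivity, ?_⟩
  intro T hT n mx mz Q hQ
  refine ⟨hQ.exists_isSparse, fun R hRQ hR => ?_⟩
  -- The `X` sector has `T - 1` code layers; this substitution avoids truncated subtraction.
  obtain ⟨N, rfl⟩ : ∃ N, T = N + 1 := ⟨T - 1, by omega⟩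
  refine ⟨?_, exists_circuit_atg R (N + 1) ℓ hℓ hR, Q.exists_isLogicalBasis,
    exists_isMinWeightDecoder R (N + 1),
    fun dec hdec => ⟨exists_isPauliFrame hdec, exists_isMinWeightResidual dec⟩, ?_⟩
  · refine (card_vertex_le R (N + 1) hT).trans (Nat.mul_le_mul_left 6 ?_)
    rw [mul_assoc]
    exact Nat.le_mul_of_pos_left _ hℓ
  intro dec Rec Rmin L hdec hRec hmin hL
  have hm : 1 ≤ (min ((N + 1 : ℕ) : ℕ∞) Q.distance).toNat := by
    have h1 : (1 : ℕ∞) ≤ min ((N + 1 : ℕ) : ℕ∞) Q.distance :=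
      le_min (by exact_mod_cast hT) Q.one_le_distance
    exact ENat.toNat_le_toNat h1 (ne_top_of_le_ne_top (ENat.natCast_ne_top _) (min_le_left _ _))
  -- The adjacency of a single code, used to decode a measured surface, has smaller degree, so the
  -- same constants serve in every part.
  have hdeg : ℓ * ℓ ≤ Δ := by
    rw [hΔdef]
    nlinarith
  obtain ⟨Rep, Succ, hout, hlog, hbounds⟩ :=
    exists_residual hRQ (ncard_syndromeAdj_le hR) hdec hRec hmin hL
  exact ⟨Rep, Succ, hout, hlog, hbounds.guarantee hm,
    exists_standard_preparation hRQ hL hT hm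
      (fun u => (ncard_rowAdj_le R.HZ ℓ ℓ hR.2.2.2 hR.2.1 u).trans hdeg) hbounds hout,
    exists_hadamard_preparation hRQ hL hT hm
      (fun u => (ncard_rowAdj_le R.HX ℓ ℓ hR.2.2.1 hR.1 u).trans hdeg) hbounds hout⟩
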